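/- Let $M$ be a smooth manifold. Schouten--Nijenhuis brackets follow the sign convention $[X,f]=X(f)$, $[X,Y\wedge Z]=[X,Y]\wedge Z+(-1)^{(k-1)l}Y\wedge[X,Z]$ for a $k$-vector field $X$ and an $l$-vector field $Y$ (so that $[\Lambda,\Lambda](df,dg,dh)=-2(\{\{f,g\},h\}+\{\{g,h\},f\}+\{\{h,f\},g\})$ for a bivector field $\Lambda$ with $\{f,g\}=\langle\Lambda,df\wedge dg\rangle$). A Jacobi structure on $M$ is $X=\Lambda+I\wedge\Gamma$, where $\Lambda$ is a bivector field and $\Gamma$ a vector field on $M$ with $[\Gamma,\Lambda]=0$ and $[\Lambda,\Lambda]=-2\Lambda\wedge\Gamma$, and $I$ is the section $(0,1)$ of $L=TM\oplus\mathbb R$; thus $X$ is a section of $\bigwedge^2L$. The bundle $L$ is a Lie algebroid with anchor $a(Y,h)=Y$ and bracket $[(Y,h),(Z,k)]=([Y,Z],Y(k)-Z(h))$, and $\Phi(Y,h)=h$ is a 1-cocycle. For a section $\mu$ of $L^*$ let $\iota_\mu$ be the corresponding fibrewise linear function on $L$; let $^v$ and $^c$ denote the vertical and complete lifts of multisections of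 a Lie algebroid to multivector fields on its total space. The complete lift is the unique $\mathbb R$-linear lift with $f^c=\iota_{df}$ for functions $f$, $X^c(\iota_\mu)=\iota_{\pounds_X\mu}$ for sections $X$, and $(X\wedge Y)^c=X^c\wedge Y^v+X^v\wedge Y^c$. The Poisson lift of a section $X$ of $\bigwedge^2L$ is $$X^c_\Phi=X^c-\iota_\Phi X^v+\nabla_L\wedge(i_\Phi X)^v,$$ where $\nabla_L$ is the Liouville vector field of $L$. If $X=\Lambda+I\wedge\Gamma$ is a Jacobi structure on $M$, then $P=X^c_\Phi$ is a Poisson structure on $TM\oplus\mathbb R$ that is homogeneous, i.e. $[\nabla_L,P]=-P$. Explicitly, $$X^c_\Phi=\Lambda^c+\partial_t\wedge\Gamma^c-t\Lambda^v+\nabla\wedge\Gamma^v,$$ where $\Lambda^c,\Lambda^v,\Gamma^c,\Gamma^v$ are the complete and vertical lifts to $TM$, $\nabla$ is the Liouville vector field of $TM$ and $t$ is the canonical coordinate of $\mathbb R$ (objects on $TM$ being viewed on $TM\oplus\mathbb R=TM\times\mathbb R$). There is a unique bracket on sections of $T^*M\oplus\mathbb R$ with $\{\iota_\mu,\iota_\nu\}_P=\iota_{[\mu,\nu]}$;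 it is a Lie algebroid bracket, and for $\mu=(\alpha,f)$, $\nu=(\beta,g)$ it is given by $$[\mu,\nu]=\pounds^\Phi_{X_\mu}\nu-\pounds^\Phi_{X_\nu}\mu-d^\Phi\langle X,\mu\wedge\nu\rangle,$$ where $X_\mu=i_\mu X=(i_\alpha\Lambda+f\Gamma,-i_\alpha\Gamma)$, and $d^\Phi$, $\pounds^\Phi_s=i_s d^\Phi+d^\Phi i_s$ are the exterior and Lie differentials of $L$ built with $[(Y,h),f]^\Phi=Y(f)+hf$ in place of $a(Y,h)(f)$. It coincides with the bracket associated with the Jacobi structure: with $\Lambda_\alpha=i_\alpha\Lambda$, $$[(\alpha,f),(\beta,g)]=\bigl(\mathcal L_{\Lambda_\alpha}\beta-\mathcal L_{\Lambda_\beta}\alpha-d\langle\Lambda,\alpha\wedge\beta\rangle+f\mathcal L_\Gamma\beta-g\mathcal L_\Gamma\alpha-i_\Gamma(\alpha\wedge\beta),$$ $$\langle\Lambda,\beta\wedge\alpha\rangle+\Lambda_\alpha(g)-\Lambda_\beta(f)+f\Gamma(g)-g\Gamma(f)\bigr).$$ -/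

import Mathlib

open Bundle Manifold
open scoped ContDiff

noncomputable section

namespace JacobiLift

/-! ### Linear algebra of bivectors

For a finite-dimensional space `V`, a bivector `B ∈ ⋀² V` is encoded by its contraction with
covectors `ξ ↦ i_ξ B ∈ V`, so that `⟨B, ξ ∧ η⟩ = η (B ξ)`; skew-symmetry is `ξ (B ξ) = 0`. -/

section Linear

variable (V : Type*) [AddCommGroup V] [Module ℝ V] [TopologicalSpace V]
  [IsTopologicalAddGroup V] [ContinuousSMul ℝ V]

/-- Contravariant 2-tensors on `V` in the form `ξ ↦ i_ξ B`. -/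
abbrev Tensor2 : Type _ := (V →L[ℝ] ℝ) →L[ℝ] V

variable {V}

/-- Evaluation of covectors at a vector. -/
def evalAt (a : V) : (V →L[ℝ] ℝ) →L[ℝ] ℝ where
  toFun ξ := ξ a
  map_add' _ _ := rfl
  map_smul' _ _ := rfl
  cont := continuous_eval_const a

/-- `a ∧ b`, i.e. `⟨a ∧ b, ξ ∧ η⟩ = ξ(a) η(b) - η(a) ξ(b)`. -/
def wedge (a b : V) : Tensor2 V :=
  (evalAt a).smulRight b - (evalAt b).smulRight a

variable {W : Type*} [AddCommGroup W] [Module ℝ W] [TopologicalSpace W]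
  [IsTopologicalAddGroup W] [ContinuousSMul ℝ W]

/-- The image of a 2-tensor under `S ⊗ T`: `(ξ, η) ↦ B (ξ ∘ S, η ∘ T)`. -/
def push (S T : V →L[ℝ] W) (B : Tensor2 V) : Tensor2 W :=
  T ∘L B ∘L ContinuousLinearMap.precomp ℝ S

end Linear

/-! ### Tensor fields on a manifold -/

section Manifold

variable {E : Type*} [NormedAddCommGroup E] [NormedSpace ℝ E]
  {H : Type*} [TopologicalSpace H] (I : ModelWithCorners ℝ E H)
  {M : Type*} [TopologicalSpace M] [ChartedSpace H M]

/-- The bracket `{f, g}_Λ = ⟨Λ, df ∧ dg⟩`. -/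
def fnBracket (Λ : Π p : M, Tensor2 (TangentSpace I p)) (f g : M → ℝ) (p : M) : ℝ :=
  mvfderiv I g p (Λ p (mvfderiv I f p))

/-- The derivative `Z(f) = df(Z)` of a function along a vector field. -/
def dirDeriv (Z : Π p : M, TangentSpace I p) (f : M → ℝ) (p : M) : ℝ :=
  mvfderiv I f p (Z p)

/-- The Schouten-Nijenhuis bracket `[Z, Λ]` of a vector field with a bivector field, evaluated on
functions: `Z{f, g} - {Z f, g} - {f, Z g}`. -/
def schoutenVec (Z : Π p : M, TangentSpace I p) (Λ : Π p : M, Tensor2 (TangentSpace I p))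
    (f g : M → ℝ) (p : M) : ℝ :=
  dirDeriv I Z (fnBracket I Λ f g) p - fnBracket I Λ (dirDeriv I Z f) g p
    - fnBracket I Λ f (dirDeriv I Z g) p

/-- The Schouten-Nijenhuis bracket `[Λ, Λ]` of a bivector field with itself, evaluated on three
functions, in the sign convention in which `[A, B] = -i_A B + (-1)^{ab} i_B A`:
it is `-2` times the Jacobiator `{{f, g}, h} + {{g, h}, f} + {{h, f}, g}`. -/
def schoutenSelf (Λ : Π p : M, Tensor2 (TangentSpace I p)) (f g h : M → ℝ) (p : M) : ℝ :=
  -2 * (fnBracket I Λ (fnBracket I Λ f g) h p + fnBracket I Λ (fnBracket I Λ g h) f p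
    + fnBracket I Λ (fnBracket I Λ h f) g p)

/-- The 3-vector field `Λ ∧ Z` evaluated on the differentials of three functions. -/
def wedgeBivecVec (Λ : Π p : M, Tensor2 (TangentSpace I p)) (Z : Π p : M, TangentSpace I p)
    (f g h : M → ℝ) (p : M) : ℝ :=
  fnBracket I Λ f g p * dirDeriv I Z h p + fnBracket I Λ g h p * dirDeriv I Z f p
    + fnBracket I Λ h f p * dirDeriv I Z g p

variable [IsManifold I ∞ M]

/-- Smooth bivector fields. -/
structure IsBivectorField (Λ : Π p : M, Tensor2 (TangentSpace I p)) : Prop where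
  smooth : ContMDiff I (I.prod 𝓘(ℝ, (E →L[ℝ] ℝ) →L[ℝ] E)) ∞
    (fun p => TotalSpace.mk' ((E →L[ℝ] ℝ) →L[ℝ] E)
      (E := fun p : M => (TangentSpace I p →L[ℝ] ℝ) →L[ℝ] TangentSpace I p) p (Λ p))
  skew : ∀ (p : M) (ξ : TangentSpace I p →L[ℝ] ℝ), ξ (Λ p ξ) = 0

/-- Poisson structures: smooth bivector fields with `[P, P] = 0`. -/
structure IsPoisson (P : Π p : M, Tensor2 (TangentSpace I p)) : Prop where
  bivector : IsBivectorField I P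
  schouten : ∀ f g h : M → ℝ, ContMDiff I 𝓘(ℝ) ∞ f → ContMDiff I 𝓘(ℝ) ∞ g →
    ContMDiff I 𝓘(ℝ) ∞ h → ∀ p, schoutenSelf I P f g h p = 0

variable (M) in
/-- Smooth vector fields. -/
abbrev VectorFields : Type _ := Cₛ^∞⟮I; E, (TangentSpace I : M → Type _)⟯

variable (M) in
/-- Smooth 1-forms. -/
abbrev OneForms : Type _ := Cₛ^∞⟮I; E →L[ℝ] ℝ, fun p : M => TangentSpace I p →L[ℝ] ℝ⟯

/-- Jacobi structures `(Λ, Γ)`, or `Λ + I ∧ Γ`: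
`[Γ, Λ] = 0` and `[Λ, Λ] = -2 Λ ∧ Γ` for the Schouten-Nijenhuis bracket. -/
structure IsJacobi (Λ : Π p : M, Tensor2 (TangentSpace I p)) (Γ : VectorFields I M) : Prop where
  bivector : IsBivectorField I Λ
  schouten_vec : ∀ f g : M → ℝ, ContMDiff I 𝓘(ℝ) ∞ f → ContMDiff I 𝓘(ℝ) ∞ g →
    ∀ p, schoutenVec I Γ Λ f g p = 0
  schouten_self : ∀ f g h : M → ℝ, ContMDiff I 𝓘(ℝ) ∞ f → ContMDiff I 𝓘(ℝ) ∞ g →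
    ContMDiff I 𝓘(ℝ) ∞ h →
    ∀ p, schoutenSelf I Λ f g h p = -2 * wedgeBivecVec I Λ Γ f g h p

end Manifold

/-! ### Vertical and complete lifts

`V` is a vector bundle with fibre `F` over `M`. The tangent space to its total space at `n` is
`E × F` in the chart given by the preferred chart of `M` and the preferred trivialization of `V`
at the base point of `n`. -/

section Lifts

variable {E : Type*} [NormedAddCommGroup E] [NormedSpace ℝ E]
  {H : Type*} [TopologicalSpace H] (I : ModelWithCorners ℝ E H)
  {M : Type*} [TopologicalSpace M] [ChartedSpace H M]
  {F : Type*} [NormedAddCommGroup F] [NormedSpace ℝ F]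
  {V : M → Type*} [TopologicalSpace (TotalSpace F V)] [∀ x, AddCommGroup (V x)]
  [∀ x, Module ℝ (V x)] [∀ x, TopologicalSpace (V x)]
  [∀ x, IsTopologicalAddGroup (V x)] [∀ x, ContinuousSMul ℝ (V x)]
  [FiberBundle F V] [VectorBundle ℝ F V]

variable (F) in
/-- Coordinates in the fibre over `q` with respect to the preferred trivialization at `p`. -/
def fibreCoord (p q : M) : V q →L[ℝ] F :=
  (trivializationAt F V p).continuousLinearMapAt ℝ q

/-- Inclusion of the coordinate directions of the base. -/
def horIncl (n : TotalSpace F V) : E →L[ℝ] TangentSpace (I.prod 𝓘(ℝ, F)) n :=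
  (ContinuousLinearMap.inl ℝ E F : E →L[ℝ] E × F)

/-- Inclusion of the vertical directions. -/
def verIncl (n : TotalSpace F V) : F →L[ℝ] TangentSpace (I.prod 𝓘(ℝ, F)) n :=
  (ContinuousLinearMap.inr ℝ E F : F →L[ℝ] E × F)

/-- The components near `p` of a section `X` of `V ⊗ V` in the preferred trivialization at `p`. -/
def components (X : Π p : M, Tensor2 (V p)) (p q : M) : Tensor2 F :=
  push (fibreCoord F p q) (fibreCoord F p q) (X q)

/-- Vertical lift `s^v` of a section of `V`. -/
def vecVerticalLift (s : Π p : M, V p) (n : TotalSpace F V) :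
    TangentSpace (I.prod 𝓘(ℝ, F)) n :=
  verIncl I n (fibreCoord F n.proj n.proj (s n.proj))

/-- Vertical lift `X^v` of a bisection of `V`. -/
def verticalLift (X : Π p : M, Tensor2 (V p)) (n : TotalSpace F V) :
    Tensor2 (TangentSpace (I.prod 𝓘(ℝ, F)) n) :=
  push (verIncl I n) (verIncl I n) (components X n.proj n.proj)

/-- The Liouville vector field `∇` of the vector bundle `V`. -/
def liouville (n : TotalSpace F V) : TangentSpace (I.prod 𝓘(ℝ, F)) n :=
  verIncl I n (fibreCoord F n.proj n.proj n.2)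

/-- Complete lift of a section `s = ∑ sⁱ eᵢ` of a Lie algebroid `V` whose anchor in the local
frame `(eᵢ)` of the preferred trivialization is the constant map `ρ`, and for which
`[eᵢ, eⱼ] = 0`: then `eᵢ^c = ρ(eᵢ)` and `(f eᵢ)^c = f eᵢ^c + f^c eᵢ^v`, where
`f^c (y) = df(ρ(y))`, so that `s^c (y) = ∑ sⁱ ρ(eᵢ) + ∑ dsⁱ(ρ(y)) eᵢ^v`. -/
def vecCompleteLift (ρ : F →L[ℝ] E) (s : Π p : M, V p) (n : TotalSpace F V) :
    TangentSpace (I.prod 𝓘(ℝ, F)) n :=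
  horIncl I n (ρ (fibreCoord F n.proj n.proj (s n.proj)))
    + verIncl I n (mvfderiv I (fun q => fibreCoord F n.proj q (s q)) n.proj
        (ρ (fibreCoord F n.proj n.proj n.2)))

/-- Complete lift of a bisection `X = ½ ∑ Xⁱʲ eᵢ ∧ eⱼ` under the same assumptions; the rules
`(Y ∧ Z)^c = Y^c ∧ Z^v + Y^v ∧ Z^c` and those for sections give
`X^c (y) = ½ ∑ Xⁱʲ (ρ(eᵢ) ∧ eⱼ^v + eᵢ^v ∧ ρ(eⱼ)) + ½ ∑ dXⁱʲ(ρ(y)) eᵢ^v ∧ eⱼ^v`. -/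
def completeLift (ρ : F →L[ℝ] E) (X : Π p : M, Tensor2 (V p)) (n : TotalSpace F V) :
    Tensor2 (TangentSpace (I.prod 𝓘(ℝ, F)) n) :=
  push (horIncl I n ∘L ρ) (verIncl I n) (components X n.proj n.proj)
    + push (verIncl I n) (horIncl I n ∘L ρ) (components X n.proj n.proj)
    + push (verIncl I n) (verIncl I n)
        (mvfderiv I (components X n.proj) n.proj (ρ (fibreCoord F n.proj n.proj n.2)))

/-- Poisson structures on the total space of `V` that are homogeneous for the Liouville vector
field: `[∇, P] = -P`. -/
def IsHomogeneous (P : Π n : TotalSpace F V, Tensor2 (TangentSpace (I.prod 𝓘(ℝ, F)) n)) : Prop :=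
  ∀ f g : TotalSpace F V → ℝ, ContMDiff (I.prod 𝓘(ℝ, F)) 𝓘(ℝ) ∞ f →
    ContMDiff (I.prod 𝓘(ℝ, F)) 𝓘(ℝ) ∞ g →
    ∀ n, schoutenVec (I.prod 𝓘(ℝ, F)) (liouville I) P f g n
      = -fnBracket (I.prod 𝓘(ℝ, F)) P f g n

end Lifts

/-! ### The Jacobi algebroid `TM ⊕ ℝ` -/

section Algebroid

variable {E : Type*} [NormedAddCommGroup E] [NormedSpace ℝ E]
  {H : Type*} [TopologicalSpace H] (I : ModelWithCorners ℝ E H)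
  {M : Type*} [TopologicalSpace M] [ChartedSpace H M]

/-- The fibre of `TM ⊕ ℝ`. -/
abbrev LFib (p : M) : Type _ := TangentSpace I p × Bundle.Trivial M ℝ p

variable (M) in
/-- The total space of `TM ⊕ ℝ`. -/
abbrev LTot : Type _ := TotalSpace (E × ℝ) (fun p : M => LFib I p)

/-- The 1-cocycle `Φ`, i.e. the projection `(Y, h) ↦ h`. -/
def cocycle (p : M) : LFib I p →L[ℝ] ℝ := ContinuousLinearMap.snd ℝ (TangentSpace I p) ℝ

/-- Inclusion of `TM` into `TM ⊕ ℝ`. -/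
def inclTM (p : M) : TangentSpace I p →L[ℝ] LFib I p :=
  ContinuousLinearMap.inl ℝ (TangentSpace I p) ℝ

/-- The section `I = (0, 1)` of `TM ⊕ ℝ`, i.e. the identity operator on functions. -/
def unitSec (p : M) : LFib I p := (0, 1)

/-- The bisection `Λ + I ∧ Γ` of `TM ⊕ ℝ`. -/
def jacobiElement (Λ : Π p : M, Tensor2 (TangentSpace I p)) (Γ : Π p : M, TangentSpace I p)
    (p : M) : Tensor2 (LFib I p) :=
  push (inclTM I p) (inclTM I p) (Λ p) + wedge (unitSec I p) (inclTM I p (Γ p))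

/-- The Lie algebroid bracket of `TM ⊕ ℝ`: `[(Y, h), (Z, k)] = ([Y, Z], Y(k) - Z(h))`. -/
def secBracket (s t : Π p : M, LFib I p) (p : M) : LFib I p :=
  (VectorField.mlieBracket I (fun q => (s q).1) (fun q => (t q).1) p,
    dirDeriv I (fun q => (s q).1) (fun q => (t q).2) p
      - dirDeriv I (fun q => (t q).1) (fun q => (s q).2) p)

/-- The bracket `[s, f]^Φ = a(s)(f) + Φ(s) f` of a section with a function, where the anchor
is `a(Y, h) = Y`. -/
def brPhi (s : Π p : M, LFib I p) (f : M → ℝ) (p : M) : ℝ :=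
  dirDeriv I (fun q => (s q).1) f p + cocycle I p (s p) * f p

/-- `d^Φ f` for a function `f`, evaluated on a section. -/
def dPhiFun (f : M → ℝ) (s : Π p : M, LFib I p) (p : M) : ℝ := brPhi I s f p

/-- `d^Φ μ` for a section `μ` of the dual bundle, evaluated on two sections. -/
def dPhiForm (μ : Π p : M, LFib I p →L[ℝ] ℝ) (s t : Π p : M, LFib I p) (p : M) : ℝ :=
  brPhi I s (fun q => μ q (t q)) p - brPhi I t (fun q => μ q (s q)) p - μ p (secBracket I s t p)

/-- `£^Φ_s μ = i_s d^Φ μ + d^Φ i_s μ`, evaluated on a section `t`. -/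
def liePhi (s : Π p : M, LFib I p) (μ : Π p : M, LFib I p →L[ℝ] ℝ)
    (t : Π p : M, LFib I p) (p : M) : ℝ :=
  dPhiForm I μ s t p + dPhiFun I (fun q => μ q (s q)) t p

/-- The Poisson lift `X^c_Φ = X^c - x ι_Φ X^v + ∇ ∧ (i_Φ X)^v` of a bisection `X` of `TM ⊕ ℝ`
(whose degree is `x = 1`); the anchor is the projection, and the preferred trivializations give
the coordinate frames `(∂₁, …, ∂ₘ, I)`, whose members commute. -/
def poissonLift [IsManifold I ∞ M] (X : Π p : M, Tensor2 (LFib I p)) (n : LTot I M) :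
    Tensor2 (TangentSpace (I.prod 𝓘(ℝ, E × ℝ)) n) :=
  completeLift I (ContinuousLinearMap.fst ℝ E ℝ) X n
    - cocycle I n.proj n.2 • verticalLift I X n
    + wedge (liouville I n) (vecVerticalLift I (fun p => X p (cocycle I p)) n)

/-! ### Tensor fields on `TM` viewed on `TM ⊕ ℝ = TM × ℝ` -/

/-- The projection `TM ⊕ ℝ → TM`. -/
def toTM (n : LTot I M) : TangentBundle I M := ⟨n.proj, n.2.1⟩

/-- The inclusion of the tangent space of `TM` into that of `TM ⊕ ℝ = TM × ℝ`. -/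
def inclTTM [IsManifold I ∞ M] (n : LTot I M) :
    TangentSpace I.tangent (toTM I n) →L[ℝ] TangentSpace (I.prod 𝓘(ℝ, E × ℝ)) n :=
  ((ContinuousLinearMap.id ℝ E).prodMap (ContinuousLinearMap.inl ℝ E ℝ) : E × E →L[ℝ] E × E × ℝ)

/-- The vector field `∂_t` on `TM ⊕ ℝ`. -/
def partialT [IsManifold I ∞ M] (n : LTot I M) : TangentSpace (I.prod 𝓘(ℝ, E × ℝ)) n :=
  ((0, 0, 1) : E × E × ℝ)

/-- A vector field on `TM` viewed on `TM ⊕ ℝ`. -/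
def extVec [IsManifold I ∞ M] (Z : Π v : TangentBundle I M, TangentSpace I.tangent v)
    (n : LTot I M) : TangentSpace (I.prod 𝓘(ℝ, E × ℝ)) n :=
  inclTTM I n (Z (toTM I n))

/-- A bivector field on `TM` viewed on `TM ⊕ ℝ`. -/
def extBivec [IsManifold I ∞ M] (B : Π v : TangentBundle I M, Tensor2 (TangentSpace I.tangent v))
    (n : LTot I M) : Tensor2 (TangentSpace (I.prod 𝓘(ℝ, E × ℝ)) n) :=
  push (inclTTM I n) (inclTTM I n) (B (toTM I n))

/-! ### Sections of `T*M ⊕ ℝ` and brackets on them -/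

variable [IsManifold I ∞ M]

variable (M) in
/-- Smooth sections `μ = (α, f)` of `T*M ⊕ ℝ`. -/
abbrev DualSec : Type _ := OneForms I M × C^∞⟮I, M; 𝓘(ℝ), ℝ⟯

/-- `(α, f)` as a section of the dual of `TM ⊕ ℝ`: `⟨(α, f), (Y, h)⟩ = α(Y) + f h`. -/
def DualSec.toDual (μ : DualSec I M) (p : M) : LFib I p →L[ℝ] ℝ :=
  (μ.1 p).comp (ContinuousLinearMap.fst ℝ (TangentSpace I p) ℝ)
    + μ.2 p • ContinuousLinearMap.snd ℝ (TangentSpace I p) ℝ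

/-- The linear function `ι_μ` on `TM ⊕ ℝ`. -/
def linFun (μ : DualSec I M) (n : LTot I M) : ℝ := DualSec.toDual I μ n.proj n.2

/-- The bracket on sections of `T*M ⊕ ℝ` induced by a bivector field `P` on `TM ⊕ ℝ`:
`{ι_μ, ι_ν}_P = ι_[μ, ν]`. -/
def Induces (P : Π n : LTot I M, Tensor2 (TangentSpace (I.prod 𝓘(ℝ, E × ℝ)) n))
    (br : DualSec I M → DualSec I M → DualSec I M) : Prop :=
  ∀ (μ ν : DualSec I M) (n : LTot I M),
    fnBracket (I.prod 𝓘(ℝ, E × ℝ)) P (linFun I μ) (linFun I ν) n = linFun I (br μ ν) n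

/-- The product of a function and a section of `T*M ⊕ ℝ`. -/
def DualSec.fsmul (f : C^∞⟮I, M; 𝓘(ℝ), ℝ⟯) (μ : DualSec I M) : DualSec I M :=
  (⟨fun p => f p • μ.1 p, f.contMDiff.smul_section μ.1.contMDiff⟩, f * μ.2)

/-- The product of a function and a vector field. -/
def vsmul (f : C^∞⟮I, M; 𝓘(ℝ), ℝ⟯) (Y : VectorFields I M) : VectorFields I M :=
  ⟨fun p => f p • Y p, f.contMDiff.smul_section Y.contMDiff⟩

/-- Lie algebroid brackets on the vector bundle `T*M ⊕ ℝ`. -/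
structure IsLieAlgebroidBracket (br : DualSec I M → DualSec I M → DualSec I M) : Prop where
  add_left : ∀ μ₁ μ₂ ν, br (μ₁ + μ₂) ν = br μ₁ ν + br μ₂ ν
  smul_left : ∀ (c : ℝ) (μ ν), br (c • μ) ν = c • br μ ν
  alternating : ∀ μ, br μ μ = 0
  add_right : ∀ μ ν₁ ν₂, br μ (ν₁ + ν₂) = br μ ν₁ + br μ ν₂
  smul_right : ∀ (c : ℝ) (μ ν), br μ (c • ν) = c • br μ ν
  jacobi : ∀ μ ν κ, br (br μ ν) κ + br (br ν κ) μ + br (br κ μ) ν = 0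
  /-- the anchor -/
  anchor : ∃ a : DualSec I M → VectorFields I M,
    (∀ μ ν, a (μ + ν) = a μ + a ν) ∧
    (∀ f μ, a (DualSec.fsmul I f μ) = vsmul I f (a μ)) ∧
    ∀ (μ : DualSec I M) (f : C^∞⟮I, M; 𝓘(ℝ), ℝ⟯) (ν : DualSec I M) (p : M),
      DualSec.toDual I (br μ (DualSec.fsmul I f ν)) p
        = f p • DualSec.toDual I (br μ ν) p
          + dirDeriv I (a μ) f p • DualSec.toDual I ν p

/-- The pairing `⟨X, μ ∧ ν⟩`. -/
def pairing (X : Π p : M, Tensor2 (LFib I p)) (μ ν : DualSec I M) (p : M) : ℝ :=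
  DualSec.toDual I ν p (X p (DualSec.toDual I μ p))

/-- The contraction `X_μ = i_μ X`. -/
def contraction (X : Π p : M, Tensor2 (LFib I p)) (μ : DualSec I M) (p : M) : LFib I p :=
  X p (DualSec.toDual I μ p)

/-- The 1-form `£^Φ_{X_μ} ν - £^Φ_{X_ν} μ - d^Φ ⟨X, μ ∧ ν⟩`, evaluated on a section `s`. -/
def cartanBracket (X : Π p : M, Tensor2 (LFib I p)) (μ ν : DualSec I M)
    (s : Π p : M, LFib I p) (p : M) : ℝ :=
  liePhi I (contraction I X μ) (DualSec.toDual I ν) s p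
    - liePhi I (contraction I X ν) (DualSec.toDual I μ) s p
    - dPhiFun I (pairing I X μ ν) s p

/-- The Lie derivative `ℒ_Y α` of a 1-form, evaluated on a vector field `Z`. -/
def lieForm (Y : Π p : M, TangentSpace I p) (α : Π p : M, TangentSpace I p →L[ℝ] ℝ)
    (Z : Π p : M, TangentSpace I p) (p : M) : ℝ :=
  dirDeriv I Y (fun q => α q (Z q)) p - α p (VectorField.mlieBracket I Y Z p)

/-- `Λ_α = i_α Λ`. -/
def sharp (Λ : Π p : M, Tensor2 (TangentSpace I p)) (α : OneForms I M) (p : M) :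
    TangentSpace I p := Λ p (α p)

/-- `⟨Λ, α ∧ β⟩`. -/
def formPairing (Λ : Π p : M, Tensor2 (TangentSpace I p)) (α β : OneForms I M) (p : M) : ℝ :=
  β p (Λ p (α p))

/-- The `T*M`-part of the bracket of `(α, f)` and `(β, g)` associated with a Jacobi structure,
`ℒ_{Λ_α} β - ℒ_{Λ_β} α - d⟨Λ, α ∧ β⟩ + f ℒ_Γ β - g ℒ_Γ α - i_Γ (α ∧ β)`,
evaluated on a vector field `Z`. -/
def jbForm (Λ : Π p : M, Tensor2 (TangentSpace I p)) (Γ : VectorFields I M) (μ ν : DualSec I M)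
    (Z : VectorFields I M) (p : M) : ℝ :=
  lieForm I (sharp I Λ μ.1) ν.1 Z p - lieForm I (sharp I Λ ν.1) μ.1 Z p
    - dirDeriv I Z (formPairing I Λ μ.1 ν.1) p
    + μ.2 p * lieForm I Γ ν.1 Z p - ν.2 p * lieForm I Γ μ.1 Z p
    - (μ.1 p (Γ p) * ν.1 p (Z p) - ν.1 p (Γ p) * μ.1 p (Z p))

/-- The function part of the bracket of `(α, f)` and `(β, g)` associated with a Jacobi structure,
`⟨Λ, β ∧ α⟩ + Λ_α(g) - Λ_β(f) + f Γ(g) - g Γ(f)`. -/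
def jbFun (Λ : Π p : M, Tensor2 (TangentSpace I p)) (Γ : VectorFields I M) (μ ν : DualSec I M)
    (p : M) : ℝ :=
  formPairing I Λ ν.1 μ.1 p + dirDeriv I (sharp I Λ μ.1) ν.2 p
    - dirDeriv I (sharp I Λ ν.1) μ.2 p
    + μ.2 p * dirDeriv I Γ ν.2 p - ν.2 p * dirDeriv I Γ μ.2 p

end Algebroid

end JacobiLift

end

noncomputable section

namespace JacobiLift

set_option linter.unusedSectionVars false
set_option synthInstance.maxHeartbeats 400000

section ChartCalculus

variable {E : Type*} [NormedAddCommGroup E] [NormedSpace ℝ E]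
  {H : Type*} [TopologicalSpace H] (I : ModelWithCorners ℝ E H)
  {M : Type*} [TopologicalSpace M] [ChartedSpace H M] [IsManifold I ∞ M]

/-- The coordinate frame at `q` of the preferred chart at `p`. -/
def tangentCoord (p q : M) : TangentSpace I q →L[ℝ] E := fibreCoord E p q

/-- The inverse of `tangentCoord`. -/
def tangentCoordSymm (p q : M) : E →L[ℝ] TangentSpace I q :=
  (trivializationAt E (TangentSpace I) p).symmL ℝ q

/-- The components near `p` of a 1-form. -/
def formCoord (α : Π q : M, TangentSpace I q →L[ℝ] ℝ) (p q : M) : E →L[ℝ] ℝ :=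
  (α q).comp (tangentCoordSymm I p q)

/-- The components near `p` of a vector field. -/
def vecCoord (X : Π q : M, TangentSpace I q) (p q : M) : E := tangentCoord I p q (X q)

/-- The components near `p` of a bivector field. -/
def bivecCoord (Λ : Π q : M, Tensor2 (TangentSpace I q)) (p q : M) : Tensor2 E :=
  components Λ p q

lemma tangentCoord_eq_mfderiv {p q : M} (hq : q ∈ (chartAt H p).source) :
    tangentCoord I p q = mfderiv I 𝓘(ℝ, E) (extChartAt I p) q :=
  TangentBundle.continuousLinearMapAt_trivializationAt hq

lemma tangentCoord_self (p : M) : tangentCoord I p p = ContinuousLinearMap.id ℝ E := by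
  rw [tangentCoord_eq_mfderiv I (mem_chart_source H p)]
  exact mfderiv_extChartAt_self

lemma tangentCoordSymm_tangentCoord {p q : M} (hq : q ∈ (chartAt H p).source)
    (v : TangentSpace I q) : tangentCoordSymm I p q (tangentCoord I p q v) = v :=
  (trivializationAt E (TangentSpace I) p).symmL_continuousLinearMapAt (by simpa using hq) v

lemma tangentCoord_tangentCoordSymm {p q : M} (hq : q ∈ (chartAt H p).source) (v : E) :
    tangentCoord I p q (tangentCoordSymm I p q v) = v :=
  (trivializationAt E (TangentSpace I) p).continuousLinearMapAt_symmL (by simpa using hq) v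

lemma tangentCoordSymm_self (p : M) :
    tangentCoordSymm I p p = ContinuousLinearMap.id ℝ E := by
  ext v
  have h := tangentCoord_tangentCoordSymm I (mem_chart_source H p) v
  rw [tangentCoord_self] at h
  exact h

lemma eventually_mem_chart (p : M) : ∀ᶠ q in nhds p, q ∈ (chartAt H p).source :=
  (chartAt H p).open_source.mem_nhds (mem_chart_source H p)

@[simp] lemma vecCoord_self (X : Π q : M, TangentSpace I q) (p : M) : vecCoord I X p p = X p := by
  rw [vecCoord, tangentCoord_self]; rfl

@[simp] lemma formCoord_self (α : Π q : M, TangentSpace I q →L[ℝ] ℝ) (p : M) :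
    formCoord I α p p = α p := by
  rw [formCoord, tangentCoordSymm_self]; rfl

lemma bivecCoord_apply (Λ : Π q : M, Tensor2 (TangentSpace I q)) (p q : M) (ξ : E →L[ℝ] ℝ) :
    bivecCoord I Λ p q ξ = tangentCoord I p q (Λ q (ξ.comp (tangentCoord I p q))) := rfl

@[simp] lemma bivecCoord_self (Λ : Π q : M, Tensor2 (TangentSpace I q)) (p : M) :
    bivecCoord I Λ p p = Λ p := by
  refine ContinuousLinearMap.ext fun ξ => ?_
  rw [bivecCoord_apply, tangentCoord_self]; rfl

lemma form_apply_eq (α : Π q : M, TangentSpace I q →L[ℝ] ℝ) (X : Π q : M, TangentSpace I q)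
    {p q : M} (hq : q ∈ (chartAt H p).source) :
    α q (X q) = formCoord I α p q (vecCoord I X p q) := by
  simp [formCoord, vecCoord, tangentCoordSymm_tangentCoord I hq]

lemma formCoord_comp_tangentCoord (α : Π q : M, TangentSpace I q →L[ℝ] ℝ)
    {p q : M} (hq : q ∈ (chartAt H p).source) :
    (formCoord I α p q).comp (tangentCoord I p q) = α q := by
  ext v
  simp [formCoord, tangentCoordSymm_tangentCoord I hq]

lemma vecCoord_sharp (Λ : Π q : M, Tensor2 (TangentSpace I q))
    (α : Π q : M, TangentSpace I q →L[ℝ] ℝ) {p q : M} (hq : q ∈ (chartAt H p).source) :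
    vecCoord I (fun q => Λ q (α q)) p q = bivecCoord I Λ p q (formCoord I α p q) := by
  rw [bivecCoord_apply, formCoord_comp_tangentCoord I α hq]; rfl

lemma contMDiffAt_vec_iff {X : Π q : M, TangentSpace I q} {p : M} :
    ContMDiffAt I (I.prod 𝓘(ℝ, E)) ∞ (fun q => TotalSpace.mk' E q (X q)) p ↔
      ContMDiffAt I 𝓘(ℝ, E) ∞ (vecCoord I X p) p := by
  rw [contMDiffAt_section]
  refine Filter.EventuallyEq.contMDiffAt_iff ?_
  filter_upwards [eventually_mem_chart (H := H) p] with q hq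
  simp only [vecCoord, tangentCoord, fibreCoord]
  rw [Trivialization.continuousLinearMapAt_apply, Trivialization.coe_linearMapAt_of_mem]
  simpa using hq

lemma contMDiffAt_form_iff {α : Π q : M, TangentSpace I q →L[ℝ] ℝ} {p : M} :
    ContMDiffAt I (I.prod 𝓘(ℝ, E →L[ℝ] ℝ)) ∞ (fun q => TotalSpace.mk' (E →L[ℝ] ℝ)
      (E := fun q : M => TangentSpace I q →L[ℝ] ℝ) q (α q)) p ↔
      ContMDiffAt I 𝓘(ℝ, E →L[ℝ] ℝ) ∞ (formCoord I α p) p := by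
  rw [contMDiffAt_section]
  refine Filter.EventuallyEq.contMDiffAt_iff ?_
  filter_upwards [eventually_mem_chart (H := H) p] with q hq
  ext v
  simp [hom_trivializationAt_apply, ContinuousLinearMap.inCoordinates, formCoord, tangentCoordSymm]

lemma contMDiffAt_bivec_iff {Λ : Π q : M, Tensor2 (TangentSpace I q)} {p : M} :
    ContMDiffAt I (I.prod 𝓘(ℝ, (E →L[ℝ] ℝ) →L[ℝ] E)) ∞
    (fun p => TotalSpace.mk' ((E →L[ℝ] ℝ) →L[ℝ] E)
      (E := fun p : M => (TangentSpace I p →L[ℝ] ℝ) →L[ℝ] TangentSpace I p) p (Λ p)) p ↔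
      ContMDiffAt I 𝓘(ℝ, Tensor2 E) ∞ (bivecCoord I Λ p) p := by
  rw [contMDiffAt_section]
  refine Filter.EventuallyEq.contMDiffAt_iff ?_
  filter_upwards [eventually_mem_chart (H := H) p] with q hq
  refine ContinuousLinearMap.ext fun v => ?_
  have hq' : q ∈ (trivializationAt (E →L[ℝ] ℝ)
      (fun x : M => TangentSpace I x →L[ℝ] ℝ) p).baseSet := by
    simpa using hq
  have h := (trivializationAt (E →L[ℝ] ℝ) (fun x : M => TangentSpace I x →L[ℝ] ℝ)
    p).symmL_continuousLinearMapAt (R := ℝ) hq' (v.comp (tangentCoord I p q))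
  have h2 : (trivializationAt (E →L[ℝ] ℝ) (fun x : M => TangentSpace I x →L[ℝ] ℝ)
      p).continuousLinearMapAt ℝ q (v.comp (tangentCoord I p q)) = v := by
    rw [Trivialization.continuousLinearMapAt_apply, Trivialization.coe_linearMapAt_of_mem _ hq']
    ext w
    simpa [hom_trivializationAt_apply, ContinuousLinearMap.inCoordinates, tangentCoordSymm] using
      congrArg v (tangentCoord_tangentCoordSymm I hq w)
  rw [h2] at h
  simp only [hom_trivializationAt_apply, ContinuousLinearMap.inCoordinates,
    ContinuousLinearMap.comp_apply, bivecCoord_apply, h]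
  rfl

/-! ### Derivatives in the preferred chart -/

section Deriv

variable {G G' : Type*} [NormedAddCommGroup G] [NormedSpace ℝ G]
  [NormedAddCommGroup G'] [NormedSpace ℝ G']

variable {I} in
lemma mvfderiv_congr {f g : M → G} {p : M} (h : f =ᶠ[nhds p] g) :
    mvfderiv I f p = mvfderiv I g p := by
  have h1 := h.mfderiv_eq (I := I) (I' := 𝓘(ℝ, G))
  exact h1

variable {I} in
lemma mvfderiv_clm_comp (T : G →L[ℝ] G') {f : M → G} {p : M} (hf : MDifferentiableAt I 𝓘(ℝ, G) f p) :
    mvfderiv I (fun q => T (f q)) p = T.comp (mvfderiv I f p) := by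
  have h := (T.hasMFDerivAt (x := f p)).comp p hf.hasMFDerivAt
  exact h.mfderiv

variable [I.Boundaryless]

lemma mvfderiv_eq_fderiv {f : M → G} {p : M} (hf : MDifferentiableAt I 𝓘(ℝ, G) f p) :
    mvfderiv I f p = fderiv ℝ (f ∘ (extChartAt I p).symm) (extChartAt I p p) := by
  rw [hf.mvfderiv, I.range_eq_univ, fderivWithin_univ]
  rfl

lemma differentiableAt_comp_chart_symm {f : M → G} {p : M}
    (hf : MDifferentiableAt I 𝓘(ℝ, G) f p) :
    DifferentiableAt ℝ (f ∘ (extChartAt I p).symm) (extChartAt I p p) := by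
  have := hf.differentiableWithinAt_writtenInExtChartAt
  rw [I.range_eq_univ, differentiableWithinAt_univ] at this
  exact this

lemma mvfderiv_clm_apply {L : M → G →L[ℝ] G'} {w : M → G} {p : M}
    (hL : MDifferentiableAt I 𝓘(ℝ, G →L[ℝ] G') L p) (hw : MDifferentiableAt I 𝓘(ℝ, G) w p)
    (v : TangentSpace I p) :
    mvfderiv I (fun q => L q (w q)) p v = mvfderiv I L p v (w p) + L p (mvfderiv I w p v) := by
  rw [mvfderiv_eq_fderiv I (hL.clm_apply hw), mvfderiv_eq_fderiv I hL, mvfderiv_eq_fderiv I hw]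
  have h := fderiv_clm_apply (differentiableAt_comp_chart_symm I hL)
    (differentiableAt_comp_chart_symm I hw)
  have h2 : ((fun q => L q (w q)) ∘ (extChartAt I p).symm) =
    fun y => (L ∘ (extChartAt I p).symm) y ((w ∘ (extChartAt I p).symm) y) := rfl
  rw [h2, h, add_comm]
  simp only [Function.comp_apply, extChartAt_to_inv]
  rfl

lemma formCoord_mvfderiv {f : M → ℝ} {p q : M} (hq : q ∈ (chartAt H p).source)
    (hf : MDifferentiableAt I 𝓘(ℝ) f q) :
    formCoord I (mvfderiv I f) p q = fderiv ℝ (f ∘ (extChartAt I p).symm) (extChartAt I p q) := by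
  have hq' : q ∈ (extChartAt I p).source := by simpa using hq
  have h1 := (mdifferentiableWithinAt_extChartAt_symm (I := I)
    ((extChartAt I p).map_source hq'))
  rw [I.range_eq_univ, mdifferentiableWithinAt_univ] at h1
  have h2 : MDifferentiableAt I 𝓘(ℝ) f ((extChartAt I p).symm (extChartAt I p q)) := by
    rwa [(extChartAt I p).left_inv hq']
  have h3 := mfderiv_comp (extChartAt I p q) h2 h1
  rw [mfderiv_eq_fderiv] at h3
  rw [formCoord, tangentCoordSymm, TangentBundle.symmL_trivializationAt hq, I.range_eq_univ,
    mfderivWithin_univ]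
  erw [h3]
  rw [(extChartAt I p).left_inv hq']
  rfl

lemma contDiffAt_comp_chart_symm {f : M → ℝ} {p : M} (hf : ContMDiffAt I 𝓘(ℝ) ∞ f p) :
    ContDiffAt ℝ ∞ (f ∘ (extChartAt I p).symm) (extChartAt I p p) := by
  have := (contMDiffAt_iff.1 hf).2
  rw [I.range_eq_univ, contDiffWithinAt_univ] at this
  exact this

lemma mvfderiv_formCoord_symm {f : M → ℝ} {p : M} (hf : ContMDiff I 𝓘(ℝ) ∞ f)
    (u v : TangentSpace I p) :
    mvfderiv I (formCoord I (mvfderiv I f) p) p u v =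
      mvfderiv I (formCoord I (mvfderiv I f) p) p v u := by
  set F := f ∘ (extChartAt I p).symm with hF
  have hcd := contDiffAt_comp_chart_symm I (hf p)
  have hd : DifferentiableAt ℝ (fderiv ℝ F) (extChartAt I p p) :=
    (hcd.fderiv_right (m := 1) (by norm_cast)).differentiableAt one_ne_zero
  have hev : formCoord I (mvfderiv I f) p =ᶠ[nhds p] fun q => fderiv ℝ F (extChartAt I p q) := by
    filter_upwards [eventually_mem_chart (H := H) p] with q hq
    exact formCoord_mvfderiv I hq (hf.mdifferentiable (by simp) q)
  have hm : MDifferentiableAt I 𝓘(ℝ, E →L[ℝ] ℝ) (fun q => fderiv ℝ F (extChartAt I p q)) p :=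
    hd.mdifferentiableAt.comp p (mdifferentiableAt_extChartAt (mem_chart_source H p))
  rw [mvfderiv_congr hev, mvfderiv_eq_fderiv I hm]
  have hev2 : ((fun q => fderiv ℝ F (extChartAt I p q)) ∘ (extChartAt I p).symm)
      =ᶠ[nhds (extChartAt I p p)] fderiv ℝ F := by
    filter_upwards [extChartAt_target_mem_nhds (I := I) p] with y hy
    simp only [Function.comp_apply, (extChartAt I p).right_inv hy]
  rw [hev2.fderiv_eq]
  refine (hcd.isSymmSndFDerivAt ?_).eq u v
  simp only [minSmoothness_of_isRCLikeNormedField]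
  norm_cast

lemma contMDiff_mvfderiv {f : M → ℝ} (hf : ContMDiff I 𝓘(ℝ) ∞ f) :
    ContMDiff I (I.prod 𝓘(ℝ, E →L[ℝ] ℝ)) ∞ (fun q => TotalSpace.mk' (E →L[ℝ] ℝ)
      (E := fun q : M => TangentSpace I q →L[ℝ] ℝ) q (mvfderiv I f q)) := by
  intro p
  rw [contMDiffAt_form_iff]
  have hcd := contDiffAt_comp_chart_symm I (hf p)
  have hd : ContDiffAt ℝ ∞ (fderiv ℝ (f ∘ (extChartAt I p).symm)) (extChartAt I p p) :=
    hcd.fderiv_right (by simp)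
  have hev : formCoord I (mvfderiv I f) p =ᶠ[nhds p]
      fun q => fderiv ℝ (f ∘ (extChartAt I p).symm) (extChartAt I p q) := by
    filter_upwards [eventually_mem_chart (H := H) p] with q hq
    exact formCoord_mvfderiv I hq (hf.mdifferentiable (by simp) q)
  exact (hd.contMDiffAt.comp p contMDiffAt_extChartAt).congr_of_eventuallyEq hev

lemma mlieBracket_eq_coord {X Y : Π q : M, TangentSpace I q} {p : M}
    (hX : MDifferentiableAt I 𝓘(ℝ, E) (vecCoord I X p) p)
    (hY : MDifferentiableAt I 𝓘(ℝ, E) (vecCoord I Y p) p) :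
    VectorField.mlieBracket I X Y p =
      (mvfderiv I (vecCoord I Y p) p (X p) - mvfderiv I (vecCoord I X p) p (Y p) : E) := by
  have key : ∀ Z : Π q : M, TangentSpace I q,
      VectorField.mpullbackWithin 𝓘(ℝ, E) I (extChartAt I p).symm Z (Set.range I)
        =ᶠ[nhds (extChartAt I p p)] (vecCoord I Z p) ∘ (extChartAt I p).symm := by
    intro Z
    filter_upwards [extChartAt_target_mem_nhds (I := I) p] with y hy
    rw [VectorField.mpullbackWithin_apply, Function.comp_apply, vecCoord, tangentCoord_eq_mfderiv]
    · rw [ContinuousLinearMap.inverse_eq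
        (mfderivWithin_extChartAt_symm_comp_mfderiv_extChartAt hy)
        (mfderiv_extChartAt_comp_mfderivWithin_extChartAt_symm hy)]
      rfl
    · simpa using (extChartAt I p).map_target hy
  have h0 := VectorField.mlieBracketWithin_apply (I := I) (V := X) (W := Y) (s := Set.univ)
    (x₀ := p)
  rw [Set.preimage_univ, Set.univ_inter] at h0
  have hinv : ∀ v : E, (mfderiv I 𝓘(ℝ, E) (extChartAt I p) p).inverse v = v := by
    intro v
    rw [mfderiv_extChartAt_self]
    exact congrArg (fun T : E →L[ℝ] E => T v) ContinuousLinearMap.inverse_id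
  have h1 : ∀ V W : E → E, VectorField.lieBracketWithin ℝ V W (Set.range I) (extChartAt I p p)
      = VectorField.lieBracket ℝ V W (extChartAt I p p) := by
    intro V W
    rw [I.range_eq_univ, VectorField.lieBracketWithin_univ]
  refine h0.trans ((hinv _).trans ((h1 _ _).trans ?_))
  rw [(key X).lieBracket_vectorField_eq (key Y), VectorField.lieBracket,
    ← mvfderiv_eq_fderiv I hX, ← mvfderiv_eq_fderiv I hY]
  simp only [Function.comp_apply, extChartAt_to_inv, vecCoord_self]
  rfl

end Deriv

end ChartCalculus

section TensorCalculus

variable {E : Type*} [NormedAddCommGroup E] [NormedSpace ℝ E]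
  {H : Type*} [TopologicalSpace H] (I : ModelWithCorners ℝ E H)
  {M : Type*} [TopologicalSpace M] [ChartedSpace H M] [IsManifold I ∞ M]

lemma mdifferentiableAt_of_smooth {G : Type*} [NormedAddCommGroup G] [NormedSpace ℝ G]
    {f : M → G} {p : M} (hf : ContMDiffAt I 𝓘(ℝ, G) ∞ f p) : MDifferentiableAt I 𝓘(ℝ, G) f p :=
  hf.mdifferentiableAt (by simp)

lemma contMDiffAt_form_apply {α : Π q : M, TangentSpace I q →L[ℝ] ℝ}
    {X : Π q : M, TangentSpace I q} {p : M}
    (hα : ContMDiffAt I 𝓘(ℝ, E →L[ℝ] ℝ) ∞ (formCoord I α p) p)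
    (hX : ContMDiffAt I 𝓘(ℝ, E) ∞ (vecCoord I X p) p) :
    ContMDiffAt I 𝓘(ℝ) ∞ (fun q => α q (X q)) p := by
  refine (hα.clm_apply hX).congr_of_eventuallyEq ?_
  filter_upwards [eventually_mem_chart (H := H) p] with q hq
  exact form_apply_eq I α X hq

lemma contMDiffAt_vecCoord_sharp {Λ : Π q : M, Tensor2 (TangentSpace I q)}
    {α : Π q : M, TangentSpace I q →L[ℝ] ℝ} {p : M}
    (hΛ : ContMDiffAt I 𝓘(ℝ, Tensor2 E) ∞ (bivecCoord I Λ p) p)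
    (hα : ContMDiffAt I 𝓘(ℝ, E →L[ℝ] ℝ) ∞ (formCoord I α p) p) :
    ContMDiffAt I 𝓘(ℝ, E) ∞ (vecCoord I (fun q => Λ q (α q)) p) p := by
  refine (hΛ.clm_apply hα).congr_of_eventuallyEq ?_
  filter_upwards [eventually_mem_chart (H := H) p] with q hq
  exact vecCoord_sharp I Λ α hq

lemma contMDiffAt_finDim {G : Type*} [NormedAddCommGroup G] [NormedSpace ℝ G]
    [FiniteDimensional ℝ G] {f : M → G} {p : M}
    (h : ∀ ξ : G →L[ℝ] ℝ, ContMDiffAt I 𝓘(ℝ) ∞ (fun q => ξ (f q)) p) :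
    ContMDiffAt I 𝓘(ℝ, G) ∞ f p := by
  let b := Module.finBasis ℝ G
  have h1 : ContMDiffAt I 𝓘(ℝ, Fin (Module.finrank ℝ G) → ℝ) ∞
      (fun q => b.equivFunL (f q)) p := by
    rw [contMDiffAt_pi_space]
    intro i
    exact h ((ContinuousLinearMap.proj i).comp b.equivFunL.toContinuousLinearMap)
  have h2 := b.equivFunL.symm.contDiff.contMDiff.contMDiffAt.comp p h1
  simpa [Function.comp_def] using h2

lemma contMDiffAt_clm_of_apply {G G' : Type*} [NormedAddCommGroup G] [NormedSpace ℝ G]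
    [FiniteDimensional ℝ G] [NormedAddCommGroup G'] [NormedSpace ℝ G'] {f : M → G →L[ℝ] G'} {p : M}
    (h : ∀ v, ContMDiffAt I 𝓘(ℝ, G') ∞ (fun q => f q v) p) :
    ContMDiffAt I 𝓘(ℝ, G →L[ℝ] G') ∞ f p := by
  let b := Module.finBasis ℝ G
  let c : Fin (Module.finrank ℝ G) → G →L[ℝ] ℝ := fun i =>
    (ContinuousLinearMap.proj i).comp b.equivFunL.toContinuousLinearMap
  have h1 : f = fun q => ∑ i, ContinuousLinearMap.smulRightL ℝ G G' (c i) (f q (b i)) := by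
    funext q
    ext v
    conv_lhs => rw [← b.sum_equivFun v, map_sum]
    simp [c, ContinuousLinearMap.smulRightL]
  rw [h1]
  refine ContMDiffAt.sum fun i _ => ?_
  exact (ContinuousLinearMap.smulRightL ℝ G G' (c i)).contDiff.contMDiff.contMDiffAt.comp p (h (b i))

lemma mvfderiv_comp_chart (ξ : E →L[ℝ] ℝ) {p q : M} (hq : q ∈ (chartAt H p).source) :
    mvfderiv I (fun q => ξ (extChartAt I p q)) q = ξ.comp (tangentCoord I p q) := by
  rw [tangentCoord_eq_mfderiv I hq]
  exact mvfderiv_clm_comp (I := I) ξ (mdifferentiableAt_extChartAt hq)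

lemma eventually_mvfderiv_of_eq_chart {ξ : E →L[ℝ] ℝ} {p : M} {F : M → ℝ}
    (h : F =ᶠ[nhds p] fun q => ξ (extChartAt I p q)) :
    ∀ᶠ q in nhds p, mvfderiv I F q = ξ.comp (tangentCoord I p q) := by
  filter_upwards [h.eventually_nhds, eventually_mem_chart (H := H) p] with q hF hq
  rw [mvfderiv_congr hF, mvfderiv_comp_chart I ξ hq]

/-- A vector field is smooth at `p` if the derivatives of functions that extend the
coordinates at `p` are. -/
lemma contMDiffAt_vecCoord_of_test [FiniteDimensional ℝ E] {X : Π q : M, TangentSpace I q} {p : M}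
    (T : (E →L[ℝ] ℝ) → M → ℝ) (hT : ∀ ξ, T ξ =ᶠ[nhds p] fun q => ξ (extChartAt I p q))
    (h : ∀ ξ, ContMDiffAt I 𝓘(ℝ) ∞ (dirDeriv I X (T ξ)) p) :
    ContMDiffAt I 𝓘(ℝ, E) ∞ (vecCoord I X p) p := by
  refine contMDiffAt_finDim I fun ξ => (h ξ).congr_of_eventuallyEq ?_
  filter_upwards [eventually_mvfderiv_of_eq_chart I (hT ξ)] with q hq
  rw [dirDeriv, hq]; rfl

/-- A bivector field is smooth at `p` if the brackets of functions that extend the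
coordinates at `p` are. -/
lemma contMDiffAt_bivecCoord_of_test [FiniteDimensional ℝ E]
    {Λ : Π q : M, Tensor2 (TangentSpace I q)} {p : M}
    (T : (E →L[ℝ] ℝ) → M → ℝ) (hT : ∀ ξ, T ξ =ᶠ[nhds p] fun q => ξ (extChartAt I p q))
    (h : ∀ ξ η, ContMDiffAt I 𝓘(ℝ) ∞ (fnBracket I Λ (T ξ) (T η)) p) :
    ContMDiffAt I 𝓘(ℝ, Tensor2 E) ∞ (bivecCoord I Λ p) p := by
  refine contMDiffAt_clm_of_apply I fun ξ => contMDiffAt_finDim I fun η =>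
    (h ξ η).congr_of_eventuallyEq ?_
  filter_upwards [eventually_mvfderiv_of_eq_chart I (hT ξ),
    eventually_mvfderiv_of_eq_chart I (hT η)] with q hq hq'
  rw [fnBracket, hq, hq']; rfl

section Bump

variable [FiniteDimensional ℝ E] [T2Space M]

lemma exists_smooth_eq_chart (p : M) (ξ : E →L[ℝ] ℝ) :
    ∃ f : M → ℝ, ContMDiff I 𝓘(ℝ) ∞ f ∧ f =ᶠ[nhds p] fun q => ξ (extChartAt I p q) := by
  let ρ : SmoothBumpFunction I p := Classical.choice inferInstance
  refine ⟨fun q => ρ q • ξ (extChartAt I p q), ρ.contMDiff_smul ?_, ?_⟩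
  · exact ξ.contDiff.contMDiff.comp_contMDiffOn contMDiffOn_extChartAt
  · filter_upwards [ρ.eventuallyEq_one] with q hq
    simp [hq]

lemma exists_smooth_mvfderiv_eq (p : M) (ξ : TangentSpace I p →L[ℝ] ℝ) :
    ∃ f : M → ℝ, ContMDiff I 𝓘(ℝ) ∞ f ∧ mvfderiv I f p = ξ := by
  obtain ⟨f, hf, hfe⟩ := exists_smooth_eq_chart I p ξ
  refine ⟨f, hf, ?_⟩
  rw [(eventually_mvfderiv_of_eq_chart I hfe).self_of_nhds, tangentCoord_self]
  rfl

end Bump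

variable [I.Boundaryless]

lemma contMDiffAt_formCoord_mvfderiv {f : M → ℝ} (hf : ContMDiff I 𝓘(ℝ) ∞ f) (p : M) :
    ContMDiffAt I 𝓘(ℝ, E →L[ℝ] ℝ) ∞ (formCoord I (mvfderiv I f) p) p :=
  (contMDiffAt_form_iff I).1 (contMDiff_mvfderiv I hf p)

lemma contMDiffAt_dirDeriv {X : Π q : M, TangentSpace I q} {f : M → ℝ} {p : M}
    (hX : ContMDiffAt I 𝓘(ℝ, E) ∞ (vecCoord I X p) p) (hf : ContMDiff I 𝓘(ℝ) ∞ f) :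
    ContMDiffAt I 𝓘(ℝ) ∞ (dirDeriv I X f) p :=
  contMDiffAt_form_apply I (contMDiffAt_formCoord_mvfderiv I hf p) hX

lemma contMDiffAt_fnBracket {Λ : Π q : M, Tensor2 (TangentSpace I q)} {f g : M → ℝ} {p : M}
    (hΛ : ContMDiffAt I 𝓘(ℝ, Tensor2 E) ∞ (bivecCoord I Λ p) p)
    (hf : ContMDiff I 𝓘(ℝ) ∞ f) (hg : ContMDiff I 𝓘(ℝ) ∞ g) :
    ContMDiffAt I 𝓘(ℝ) ∞ (fnBracket I Λ f g) p :=
  contMDiffAt_form_apply I (contMDiffAt_formCoord_mvfderiv I hg p)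
    (contMDiffAt_vecCoord_sharp I hΛ (contMDiffAt_formCoord_mvfderiv I hf p))

lemma mvfderiv_form_apply {α : Π q : M, TangentSpace I q →L[ℝ] ℝ}
    {X : Π q : M, TangentSpace I q} {p : M}
    (hα : MDifferentiableAt I 𝓘(ℝ, E →L[ℝ] ℝ) (formCoord I α p) p)
    (hX : MDifferentiableAt I 𝓘(ℝ, E) (vecCoord I X p) p) (v : TangentSpace I p) :
    mvfderiv I (fun q => α q (X q)) p v =
      mvfderiv I (formCoord I α p) p v (X p) + α p (mvfderiv I (vecCoord I X p) p v : E) := by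
  have h : (fun q => α q (X q)) =ᶠ[nhds p] fun q => formCoord I α p q (vecCoord I X p q) := by
    filter_upwards [eventually_mem_chart (H := H) p] with q hq
    exact form_apply_eq I α X hq
  rw [mvfderiv_congr h, mvfderiv_clm_apply I hα hX, vecCoord_self, formCoord_self]
  rfl

lemma mvfderiv_vecCoord_sharp {Λ : Π q : M, Tensor2 (TangentSpace I q)}
    {α : Π q : M, TangentSpace I q →L[ℝ] ℝ} {p : M}
    (hΛ : MDifferentiableAt I 𝓘(ℝ, Tensor2 E) (bivecCoord I Λ p) p)
    (hα : MDifferentiableAt I 𝓘(ℝ, E →L[ℝ] ℝ) (formCoord I α p) p) (v : TangentSpace I p) :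
    mvfderiv I (vecCoord I (fun q => Λ q (α q)) p) p v =
      mvfderiv I (bivecCoord I Λ p) p v (α p)
        + bivecCoord I Λ p p (mvfderiv I (formCoord I α p) p v) := by
  have h : vecCoord I (fun q => Λ q (α q)) p =ᶠ[nhds p]
      fun q => bivecCoord I Λ p q (formCoord I α p q) := by
    filter_upwards [eventually_mem_chart (H := H) p] with q hq
    exact vecCoord_sharp I Λ α hq
  rw [mvfderiv_congr h, mvfderiv_clm_apply I hΛ hα, formCoord_self]

lemma lieForm_eq_coord {Y Z : Π q : M, TangentSpace I q} {α : Π q : M, TangentSpace I q →L[ℝ] ℝ}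
    {p : M} (hY : MDifferentiableAt I 𝓘(ℝ, E) (vecCoord I Y p) p)
    (hZ : MDifferentiableAt I 𝓘(ℝ, E) (vecCoord I Z p) p)
    (hα : MDifferentiableAt I 𝓘(ℝ, E →L[ℝ] ℝ) (formCoord I α p) p) :
    lieForm I Y α Z p = mvfderiv I (formCoord I α p) p (Y p) (Z p)
      + α p (mvfderiv I (vecCoord I Y p) p (Z p) : E) := by
  rw [lieForm, dirDeriv, mvfderiv_form_apply I hα hZ, mlieBracket_eq_coord I hY hZ]
  have := (α p).map_sub (mvfderiv I (vecCoord I Z p) p (Y p) : E)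
    (mvfderiv I (vecCoord I Y p) p (Z p) : E)
  erw [this]
  ring

/-- `X(Y(f)) - Y(X(f)) = [X, Y](f)`. -/
lemma dirDeriv_mlieBracket {X Y : Π q : M, TangentSpace I q} {f : M → ℝ} {p : M}
    (hX : MDifferentiableAt I 𝓘(ℝ, E) (vecCoord I X p) p)
    (hY : MDifferentiableAt I 𝓘(ℝ, E) (vecCoord I Y p) p) (hf : ContMDiff I 𝓘(ℝ) ∞ f) :
    mvfderiv I f p (VectorField.mlieBracket I X Y p) =
      dirDeriv I X (dirDeriv I Y f) p - dirDeriv I Y (dirDeriv I X f) p := by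
  have hα := mdifferentiableAt_of_smooth I (contMDiffAt_formCoord_mvfderiv I hf p)
  have h1 : dirDeriv I X (dirDeriv I Y f) p = _ := mvfderiv_form_apply I hα hY (X p)
  have h2 : dirDeriv I Y (dirDeriv I X f) p = _ := mvfderiv_form_apply I hα hX (Y p)
  rw [h1, h2, mvfderiv_formCoord_symm I hf (X p) (Y p), mlieBracket_eq_coord I hX hY]
  have := (mvfderiv I f p).map_sub (mvfderiv I (vecCoord I Y p) p (X p) : E)
    (mvfderiv I (vecCoord I X p) p (Y p) : E)
  erw [this]
  ring

lemma dirDeriv_comm_of_critical {X Y : Π q : M, TangentSpace I q} {f : M → ℝ} {p : M}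
    (hX : MDifferentiableAt I 𝓘(ℝ, E) (vecCoord I X p) p)
    (hY : MDifferentiableAt I 𝓘(ℝ, E) (vecCoord I Y p) p) (hf : ContMDiff I 𝓘(ℝ) ∞ f)
    (h0 : mvfderiv I f p = 0) :
    dirDeriv I X (dirDeriv I Y f) p = dirDeriv I Y (dirDeriv I X f) p := by
  have h := dirDeriv_mlieBracket I hX hY hf
  rw [h0] at h
  simpa [sub_eq_zero] using h.symm

end TensorCalculus

section LiftFormula

variable {E : Type*} [NormedAddCommGroup E] [NormedSpace ℝ E]
  {H : Type*} [TopologicalSpace H] (I : ModelWithCorners ℝ E H)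
  {M : Type*} [TopologicalSpace M] [ChartedSpace H M] [IsManifold I ∞ M]

lemma fibreCoord_LFib {p q : M} (hq : q ∈ (chartAt H p).source) (y : LFib I q) :
    fibreCoord (V := fun q : M => LFib I q) (E × ℝ) p q y = (tangentCoord I p q y.1, y.2) := by
  have hq' : q ∈ (trivializationAt (E × ℝ) (fun q : M => LFib I q) p).baseSet := by
    change q ∈ (trivializationAt E (TangentSpace I) p).baseSet ∩ Set.univ
    simpa using hq
  have hq2 : q ∈ (trivializationAt E (TangentSpace I) p).baseSet := by simpa using hq
  rw [fibreCoord, tangentCoord, fibreCoord, Trivialization.continuousLinearMapAt_apply,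
    Trivialization.coe_linearMapAt_of_mem _ hq', Trivialization.continuousLinearMapAt_apply,
    Trivialization.coe_linearMapAt_of_mem _ hq2]
  rfl

lemma fibreCoord_LFib_self (p : M) (y : LFib I p) :
    fibreCoord (V := fun q : M => LFib I q) (E × ℝ) p p y = y := by
  rw [fibreCoord_LFib I (mem_chart_source H p), tangentCoord_self]; rfl

lemma mvfderiv_prodMk {G G' : Type*} [NormedAddCommGroup G] [NormedSpace ℝ G]
    [NormedAddCommGroup G'] [NormedSpace ℝ G'] {f : M → G} {g : M → G'} {p : M}
    (hf : MDifferentiableAt I 𝓘(ℝ, G) f p) (hg : MDifferentiableAt I 𝓘(ℝ, G') g p)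
    (v : TangentSpace I p) :
    mvfderiv I (fun q => (f q, g q)) p v = (mvfderiv I f p v, mvfderiv I g p v) := by
  have h : MDifferentiableAt I 𝓘(ℝ, G × G') (fun q => (f q, g q)) p := hf.prodMk_space hg
  have e1 := mvfderiv_clm_comp (I := I) (ContinuousLinearMap.fst ℝ G G') h
  have e2 := mvfderiv_clm_comp (I := I) (ContinuousLinearMap.snd ℝ G G') h
  exact Prod.ext (congrArg (fun T => T v) e1).symm (congrArg (fun T => T v) e2).symm

section Linear

variable {V : Type*} [AddCommGroup V] [Module ℝ V] [TopologicalSpace V]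
  [IsTopologicalAddGroup V] [ContinuousSMul ℝ V]
  {W : Type*} [AddCommGroup W] [Module ℝ W] [TopologicalSpace W]
  [IsTopologicalAddGroup W] [ContinuousSMul ℝ W]

lemma wedge_apply (a b : V) (ξ : V →L[ℝ] ℝ) : wedge a b ξ = ξ a • b - ξ b • a := rfl

lemma push_apply (S T : V →L[ℝ] W) (B : Tensor2 V) (ξ : W →L[ℝ] ℝ) :
    push S T B ξ = T (B (ξ.comp S)) := rfl

end Linear

/-- The bivector `B + ∂_t ∧ G` on `E × ℝ`. -/
def jacobiModel (B : Tensor2 E) (G : E) : Tensor2 (E × ℝ) :=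
  push (ContinuousLinearMap.inl ℝ E ℝ) (ContinuousLinearMap.inl ℝ E ℝ) B
    + wedge ((0, 1) : E × ℝ) (G, 0)

lemma jacobiModel_apply (B : Tensor2 E) (G : E) (ζ : E × ℝ →L[ℝ] ℝ) :
    jacobiModel B G ζ = (B (ζ.comp (ContinuousLinearMap.inl ℝ E ℝ)) + ζ (0, 1) • G, - ζ (G, 0)) := by
  simp [jacobiModel, push_apply, wedge_apply]

variable [FiniteDimensional ℝ E]

/-- `jacobiModel` as a linear map. -/
def jacobiModelLin : (Tensor2 E × E) →ₗ[ℝ] Tensor2 (E × ℝ) where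
  toFun x := jacobiModel x.1 x.2
  map_add' x y := by
    refine ContinuousLinearMap.ext fun ζ => ?_
    have h : ζ (x.2 + y.2, 0) = ζ (x.2, 0) + ζ (y.2, 0) := by rw [← map_add]; simp
    simp only [jacobiModel_apply, add_apply, Prod.fst_add, Prod.snd_add, h]
    refine Prod.ext ?_ ?_
    · simp only [Prod.mk_add_mk, smul_add]
      abel
    · simp only [Prod.mk_add_mk]
      ring
  map_smul' c x := by
    refine ContinuousLinearMap.ext fun ζ => ?_
    have h : ζ (c • x.2, 0) = c * ζ (x.2, 0) := by rw [← smul_eq_mul, ← map_smul]; simp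
    simp only [jacobiModel_apply, smul_apply, Prod.smul_fst, Prod.smul_snd, h]
    refine Prod.ext ?_ ?_
    · simp only [RingHom.id_apply, Prod.smul_mk, smul_add, smul_comm c]
    · simp only [RingHom.id_apply, Prod.smul_mk, smul_eq_mul, mul_neg]

/-- `jacobiModel` as a continuous linear map. -/
def jacobiModelL : (Tensor2 E × E) →L[ℝ] Tensor2 (E × ℝ) :=
  ⟨jacobiModelLin, LinearMap.continuous_of_finiteDimensional (𝕜 := ℝ) (E := Tensor2 E × E)
    (F' := Tensor2 (E × ℝ)) jacobiModelLin⟩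

lemma jacobiModelL_apply (B : Tensor2 E) (G : E) : jacobiModelL (E := E) (B, G) = jacobiModel B G := rfl

lemma components_jacobiElement (Λ : Π p : M, Tensor2 (TangentSpace I p))
    (Γ : Π p : M, TangentSpace I p) {p q : M} (hq : q ∈ (chartAt H p).source) :
    components (F := E × ℝ) (V := fun q : M => LFib I q) (jacobiElement I Λ Γ) p q
      = jacobiModel (bivecCoord I Λ p q) (vecCoord I Γ p q) := by
  refine ContinuousLinearMap.ext fun ζ => ?_
  rw [jacobiModel_apply, components, push_apply, jacobiElement, add_apply,
    push_apply, wedge_apply, fibreCoord_LFib I hq]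
  have h1 : fibreCoord (V := fun q : M => LFib I q) (E × ℝ) p q (unitSec I q) = (0, 1) := by
    rw [fibreCoord_LFib I hq]; simp [unitSec]
  have h2 : fibreCoord (V := fun q : M => LFib I q) (E × ℝ) p q (inclTM I q (Γ q))
      = (vecCoord I Γ p q, 0) := by
    rw [fibreCoord_LFib I hq]; rfl
  have h3 : (ζ.comp (fibreCoord (V := fun q : M => LFib I q) (E × ℝ) p q)).comp (inclTM I q)
      = (ζ.comp (ContinuousLinearMap.inl ℝ E ℝ)).comp (tangentCoord I p q) := by
    ext v
    have h4 : fibreCoord (V := fun q : M => LFib I q) (E × ℝ) p q (inclTM I q v)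
      = (tangentCoord I p q v, 0) := by
      rw [fibreCoord_LFib I hq]; rfl
    simp [h4]
  rw [h3]
  simp only [ContinuousLinearMap.comp_apply, h1, h2]
  simp [bivecCoord_apply, inclTM, unitSec, vecCoord]

lemma mvfderiv_components_jacobiElement [I.Boundaryless]
    {Λ : Π p : M, Tensor2 (TangentSpace I p)} {Γ : Π p : M, TangentSpace I p} {p : M}
    (hΛ : MDifferentiableAt I 𝓘(ℝ, Tensor2 E) (bivecCoord I Λ p) p)
    (hΓ : MDifferentiableAt I 𝓘(ℝ, E) (vecCoord I Γ p) p) (v : TangentSpace I p) :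
    mvfderiv I (components (F := E × ℝ) (V := fun q : M => LFib I q) (jacobiElement I Λ Γ) p) p v
      = jacobiModel (mvfderiv I (bivecCoord I Λ p) p v) (mvfderiv I (vecCoord I Γ p) p v) := by
  have h : components (F := E × ℝ) (V := fun q : M => LFib I q) (jacobiElement I Λ Γ) p
      =ᶠ[nhds p] fun q => jacobiModelL (E := E) (bivecCoord I Λ p q, vecCoord I Γ p q) := by
    filter_upwards [eventually_mem_chart (H := H) p] with q hq
    exact components_jacobiElement I Λ Γ hq
  have hp : MDifferentiableAt I 𝓘(ℝ, Tensor2 E × E)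
      (fun q => (bivecCoord I Λ p q, vecCoord I Γ p q)) p := hΛ.prodMk_space hΓ
  have e := mvfderiv_clm_comp (I := I) (G := Tensor2 E × E) (G' := Tensor2 (E × ℝ))
    (jacobiModelL (E := E)) hp
  rw [mvfderiv_congr h]
  refine (congrArg (fun T => T v) e).trans ?_
  rw [ContinuousLinearMap.comp_apply, mvfderiv_prodMk I hΛ hΓ, jacobiModelL_apply]

end LiftFormula

section LiftFormula

variable {E : Type*} [NormedAddCommGroup E] [NormedSpace ℝ E]
  {H : Type*} [TopologicalSpace H] (I : ModelWithCorners ℝ E H)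
  {M : Type*} [TopologicalSpace M] [ChartedSpace H M] [IsManifold I ∞ M]
  [FiniteDimensional ℝ E]

/-- The first component of a covector on `E × E × ℝ`. -/
def covHor (ξ : E × E × ℝ →L[ℝ] ℝ) : E →L[ℝ] ℝ := ξ.comp (ContinuousLinearMap.inl ℝ E (E × ℝ))

/-- The second component of a covector on `E × E × ℝ`. -/
def covVer (ξ : E × E × ℝ →L[ℝ] ℝ) : E →L[ℝ] ℝ :=
  (ξ.comp (ContinuousLinearMap.inr ℝ E (E × ℝ))).comp (ContinuousLinearMap.inl ℝ E ℝ)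

/-- The Poisson lift of `Λ + I ∧ Γ` in coordinates, contracted with a covector. -/
def liftModel (B : Tensor2 E) (G : E) (dB : Tensor2 E) (dG : E) (Y : E) (h : ℝ)
    (ξ : E × E × ℝ →L[ℝ] ℝ) : E × E × ℝ :=
  (B (covVer ξ) + ξ (0, 0, 1) • G,
    B (covHor ξ) + dB (covVer ξ) + ξ (0, 0, 1) • dG - h • B (covVer ξ)
      + covVer ξ Y • G - covVer ξ G • Y,
    - covHor ξ G - covVer ξ dG)

lemma liftModel_eq_sum (B : Tensor2 E) (G : E) (dB : Tensor2 E) (dG : E) (Y : E) (h : ℝ)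
    (ξ : E × E × ℝ →L[ℝ] ℝ) :
    (((0 : E), jacobiModel B G
        ((ξ.comp (ContinuousLinearMap.inl ℝ E (E × ℝ))).comp (ContinuousLinearMap.fst ℝ E ℝ)))
      + ((jacobiModel B G (ξ.comp (ContinuousLinearMap.inr ℝ E (E × ℝ)))).1, 0)
      + (0, jacobiModel dB dG (ξ.comp (ContinuousLinearMap.inr ℝ E (E × ℝ))))
      - h • (0, jacobiModel B G (ξ.comp (ContinuousLinearMap.inr ℝ E (E × ℝ))))
      + (ξ (0, Y, h) • (0, G, 0) - ξ (0, G, 0) • (0, Y, h)) : E × E × ℝ)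
    = liftModel B G dB dG Y h ξ := by
  have h1 : (((ξ.comp (ContinuousLinearMap.inl ℝ E (E × ℝ))).comp
      (ContinuousLinearMap.fst ℝ E ℝ)).comp (ContinuousLinearMap.inl ℝ E ℝ)) = covHor ξ := by
    ext; simp [covHor]
  have h2 : ξ (0, Y, h) = covVer ξ Y + h * ξ (0, 0, 1) := by
    have : ((0, Y, h) : E × E × ℝ) = (0, Y, 0) + h • (0, 0, 1) := by simp
    rw [this, map_add, map_smul]; simp [covVer]
  have h3 : ξ (0, G, 0) = covVer ξ G := rfl
  have h4 : ξ (0, dG, 0) = covVer ξ dG := rfl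
  have h5 : ξ (G, 0) = covHor ξ G := rfl
  simp only [jacobiModel_apply, h1, h2, h3]
  refine Prod.ext ?_ (Prod.ext ?_ ?_)
  · simp [liftModel, covVer]
  · have h6 : ξ ((0 : E), (0 : E × ℝ)) = 0 := map_zero ξ
    simp [liftModel, covVer, add_smul, mul_smul, h6]
    abel
  · simp [liftModel, h3, h4, h5]
    ring

variable [I.Boundaryless]

lemma poissonLift_apply {Λ : Π p : M, Tensor2 (TangentSpace I p)} {Γ : Π p : M, TangentSpace I p}
    (n : LTot I M)
    (hΛ : MDifferentiableAt I 𝓘(ℝ, Tensor2 E) (bivecCoord I Λ n.proj) n.proj)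
    (hΓ : MDifferentiableAt I 𝓘(ℝ, E) (vecCoord I Γ n.proj) n.proj)
    (ξ : E × E × ℝ →L[ℝ] ℝ) :
    (poissonLift I (jacobiElement I Λ Γ) n : Tensor2 (E × E × ℝ)) ξ =
      liftModel (E := E) (Λ n.proj) (Γ n.proj) (mvfderiv I (bivecCoord I Λ n.proj) n.proj n.2.1)
        (mvfderiv I (vecCoord I Γ n.proj) n.proj n.2.1) n.2.1 n.2.2 ξ := by
  set p := n.proj with hp
  have hK := components_jacobiElement I Λ Γ (mem_chart_source H p)
  have hdK := mvfderiv_components_jacobiElement I hΛ hΓ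
    (fibreCoord (V := fun q : M => LFib I q) (E × ℝ) p p n.2).1
  rw [fibreCoord_LFib_self I p n.2] at hdK
  rw [bivecCoord_self, vecCoord_self] at hK
  have hs : jacobiElement I Λ Γ p (cocycle I p) = (Γ p, 0) := by
    have h1 : (cocycle I p).comp (inclTM I p) = 0 := by
      ext v; simp [cocycle, inclTM]
    rw [jacobiElement, add_apply, push_apply, wedge_apply, h1]
    simp [cocycle, unitSec, inclTM]
  have e : (poissonLift I (jacobiElement I Λ Γ) n : Tensor2 (E × E × ℝ)) ξ =
      (0, components (F := E × ℝ) (V := fun q : M => LFib I q) (jacobiElement I Λ Γ) p p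
        ((ξ.comp (ContinuousLinearMap.inl ℝ E (E × ℝ))).comp (ContinuousLinearMap.fst ℝ E ℝ)))
      + ((components (F := E × ℝ) (V := fun q : M => LFib I q) (jacobiElement I Λ Γ) p p
        (ξ.comp (ContinuousLinearMap.inr ℝ E (E × ℝ)))).1, 0)
      + (0, mvfderiv I (components (F := E × ℝ) (V := fun q : M => LFib I q)
          (jacobiElement I Λ Γ) p) p
          (fibreCoord (V := fun q : M => LFib I q) (E × ℝ) p p n.2).1
        (ξ.comp (ContinuousLinearMap.inr ℝ E (E × ℝ))))
      - n.2.2 • (0, components (F := E × ℝ) (V := fun q : M => LFib I q) (jacobiElement I Λ Γ) p p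
        (ξ.comp (ContinuousLinearMap.inr ℝ E (E × ℝ))))
      + (ξ (0, fibreCoord (V := fun q : M => LFib I q) (E × ℝ) p p n.2) •
          (0, fibreCoord (V := fun q : M => LFib I q) (E × ℝ) p p
            (jacobiElement I Λ Γ p (cocycle I p)))
        - ξ (0, fibreCoord (V := fun q : M => LFib I q) (E × ℝ) p p
            (jacobiElement I Λ Γ p (cocycle I p))) •
          (0, fibreCoord (V := fun q : M => LFib I q) (E × ℝ) p p n.2)) := rfl
  rw [e, fibreCoord_LFib_self I p n.2, hs, hK, hdK, fibreCoord_LFib_self]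
  exact liftModel_eq_sum _ _ _ _ _ _ _

/-- The right-hand side of the explicit formula for the Poisson lift. -/
def explicitLift (Λ : Π p : M, Tensor2 (TangentSpace I p)) (Γ : Π p : M, TangentSpace I p)
    (n : LTot I M) : Tensor2 (TangentSpace (I.prod 𝓘(ℝ, E × ℝ)) n) :=
  extBivec I (completeLift I (ContinuousLinearMap.id ℝ E) Λ) n
    + wedge (partialT I n) (extVec I (vecCompleteLift I (ContinuousLinearMap.id ℝ E) Γ) n)
    - n.2.2 • extBivec I (verticalLift I Λ) n
    + wedge (extVec I (liouville I) n) (extVec I (vecVerticalLift I Γ) n)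

lemma liftModel_eq_sum' (B : Tensor2 E) (G : E) (dB : Tensor2 E) (dG : E) (Y : E) (h : ℝ)
    (ξ : E × E × ℝ →L[ℝ] ℝ) (J : E × E →L[ℝ] E × E × ℝ) (hJ : ∀ a b : E, J (a, b) = (a, b, 0)) :
    (J (((0 : E), B (covHor ξ)) + (B (covVer ξ), 0) + (0, dB (covVer ξ)))
      + (ξ (0, 0, 1) • J ((G, 0) + (0, dG)) - ξ (J ((G, 0) + (0, dG))) • (0, 0, 1))
      - h • J (0, B (covVer ξ))
      + (ξ (J (0, Y)) • J (0, G) - ξ (J (0, G)) • J (0, Y)) : E × E × ℝ)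
    = liftModel B G dB dG Y h ξ := by
  have h2 : ξ (0, Y, 0) = covVer ξ Y := rfl
  have h3 : ξ (0, G, 0) = covVer ξ G := rfl
  have h4 : ξ (G, dG, 0) = covHor ξ G + covVer ξ dG := by
    have : ((G, dG, 0) : E × E × ℝ) = (G, 0) + (0, dG, 0) := by simp
    rw [this, map_add]; rfl
  simp only [Prod.mk_add_mk, add_zero, zero_add, hJ, h2, h3, h4]
  refine Prod.ext ?_ (Prod.ext ?_ ?_)
  · simp [liftModel]
  · simp [liftModel]
    abel
  · simp [liftModel]
    ring

lemma explicitLift_apply {Λ : Π p : M, Tensor2 (TangentSpace I p)} {Γ : Π p : M, TangentSpace I p}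
    (n : LTot I M) (ξ : E × E × ℝ →L[ℝ] ℝ) :
    (explicitLift I Λ Γ n : Tensor2 (E × E × ℝ)) ξ =
      liftModel (E := E) (Λ n.proj) (Γ n.proj) (mvfderiv I (bivecCoord I Λ n.proj) n.proj n.2.1)
        (mvfderiv I (vecCoord I Γ n.proj) n.proj n.2.1) n.2.1 n.2.2 ξ := by
  set p := n.proj with hp
  set J : E × E →L[ℝ] E × E × ℝ := (ContinuousLinearMap.id ℝ E).prodMap
    (ContinuousLinearMap.inl ℝ E ℝ) with hJ
  have hc1 : (ξ.comp J).comp (ContinuousLinearMap.inl ℝ E E) = covHor ξ := by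
    ext
    simp only [covHor, hJ, ContinuousLinearMap.comp_apply]
    rfl
  have hc2 : (ξ.comp J).comp (ContinuousLinearMap.inr ℝ E E) = covVer ξ := by
    ext
    simp only [covVer, hJ, ContinuousLinearMap.comp_apply]
    rfl
  have e : (explicitLift I Λ Γ n : Tensor2 (E × E × ℝ)) ξ =
      (J (((0 : E), bivecCoord I Λ p p ((ξ.comp J).comp (ContinuousLinearMap.inl ℝ E E)))
        + (bivecCoord I Λ p p ((ξ.comp J).comp (ContinuousLinearMap.inr ℝ E E)), 0)
        + (0, mvfderiv I (bivecCoord I Λ p) p (tangentCoord I p p n.2.1)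
            ((ξ.comp J).comp (ContinuousLinearMap.inr ℝ E E))))
      + (ξ (0, 0, 1) • J ((vecCoord I Γ p p, 0)
            + (0, mvfderiv I (vecCoord I Γ p) p (tangentCoord I p p n.2.1)))
          - ξ (J ((vecCoord I Γ p p, 0)
            + (0, mvfderiv I (vecCoord I Γ p) p (tangentCoord I p p n.2.1))))
            • (0, 0, 1))
      - n.2.2 • J (0, bivecCoord I Λ p p ((ξ.comp J).comp (ContinuousLinearMap.inr ℝ E E)))
      + (ξ (J (0, tangentCoord I p p n.2.1)) • J (0, vecCoord I Γ p p)
          - ξ (J (0, vecCoord I Γ p p)) • J (0, tangentCoord I p p n.2.1))) := rfl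
  have hY : tangentCoord I p p n.2.1 = n.2.1 := by rw [tangentCoord_self]; rfl
  rw [hc1, hc2, hY, bivecCoord_self, vecCoord_self] at e
  exact e.trans (liftModel_eq_sum' (E := E) _ _ _ _ _ _ ξ J fun _ _ => rfl)

lemma poissonLift_eq_explicitLift {Λ : Π p : M, Tensor2 (TangentSpace I p)}
    {Γ : Π p : M, TangentSpace I p} (n : LTot I M)
    (hΛ : MDifferentiableAt I 𝓘(ℝ, Tensor2 E) (bivecCoord I Λ n.proj) n.proj)
    (hΓ : MDifferentiableAt I 𝓘(ℝ, E) (vecCoord I Γ n.proj) n.proj) :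
    poissonLift I (jacobiElement I Λ Γ) n = explicitLift I Λ Γ n := by
  have h : (poissonLift I (jacobiElement I Λ Γ) n : Tensor2 (E × E × ℝ))
      = (explicitLift I Λ Γ n : Tensor2 (E × E × ℝ)) :=
    ContinuousLinearMap.ext fun ξ =>
      (poissonLift_apply I n hΛ hΓ ξ).trans (explicitLift_apply I n ξ).symm
  exact h

end LiftFormula

section TotalSpace

variable {E : Type*} [NormedAddCommGroup E] [NormedSpace ℝ E]
  {H : Type*} [TopologicalSpace H] (I : ModelWithCorners ℝ E H)
  {M : Type*} [TopologicalSpace M] [ChartedSpace H M] [IsManifold I ∞ M]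

/-- The fibre coordinates of a point of `TM ⊕ ℝ` in the chart at `p`. -/
def totFibre (p : M) (n : LTot I M) : E × ℝ := (tangentCoord I p n.proj n.2.1, n.2.2)

lemma extChartAt_LTot {n₀ n : LTot I M} (hn : n.proj ∈ (chartAt H n₀.proj).source) :
    extChartAt (I.prod 𝓘(ℝ, E × ℝ)) n₀ n = (extChartAt I n₀.proj n.proj, totFibre I n₀.proj n) := by
  have hq' : n.proj ∈ (trivializationAt (E × ℝ) (fun q : M => LFib I q) n₀.proj).baseSet := by
    change n.proj ∈ (trivializationAt E (TangentSpace I) n₀.proj).baseSet ∩ Set.univ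
    simpa using hn
  have h := fibreCoord_LFib I hn n.2
  rw [fibreCoord, Trivialization.continuousLinearMapAt_apply,
    Trivialization.coe_linearMapAt_of_mem _ hq'] at h
  rw [FiberBundle.extChartAt]
  refine Prod.ext ?_ h
  rfl

lemma eventually_proj_mem (n : LTot I M) :
    ∀ᶠ m in nhds n, (TotalSpace.proj m : M) ∈ (chartAt H n.proj).source :=
  (FiberBundle.continuous_proj (E × ℝ) (fun q : M => LFib I q)).continuousAt.eventually
    (eventually_mem_chart (H := H) n.proj)

lemma eventually_extChartAt_LTot (n : LTot I M) :
    extChartAt (I.prod 𝓘(ℝ, E × ℝ)) n =ᶠ[nhds n]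
      fun m => (extChartAt I n.proj m.proj, totFibre I n.proj m) := by
  filter_upwards [eventually_proj_mem I n] with m hm
  exact extChartAt_LTot I hm

lemma contMDiff_LTot_proj :
    ContMDiff (I.prod 𝓘(ℝ, E × ℝ)) I ∞ (fun n : LTot I M => n.proj) :=
  contMDiff_proj (fun q : M => LFib I q)

lemma contMDiffAt_totFibre (n : LTot I M) :
    ContMDiffAt (I.prod 𝓘(ℝ, E × ℝ)) 𝓘(ℝ, E × ℝ) ∞ (totFibre I n.proj) n := by
  have h : ContMDiffAt (I.prod 𝓘(ℝ, E × ℝ)) 𝓘(ℝ, E × E × ℝ) ∞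
      (extChartAt (I.prod 𝓘(ℝ, E × ℝ)) n) n := contMDiffAt_extChartAt
  have h2 := (ContinuousLinearMap.snd ℝ E (E × ℝ)).contDiff.contMDiff.contMDiffAt.comp n h
  refine h2.congr_of_eventuallyEq ?_
  filter_upwards [eventually_extChartAt_LTot I n] with m hm
  rw [Function.comp_apply, hm]
  rfl

lemma mvfderiv_totFibre (n : LTot I M) (x : TangentSpace (I.prod 𝓘(ℝ, E × ℝ)) n) :
    mvfderiv (I.prod 𝓘(ℝ, E × ℝ)) (totFibre I n.proj) n x = (x : E × E × ℝ).2 := by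
  have h : MDifferentiableAt (I.prod 𝓘(ℝ, E × ℝ)) 𝓘(ℝ, E × E × ℝ)
      (extChartAt (I.prod 𝓘(ℝ, E × ℝ)) n) n := mdifferentiableAt_extChartAt (mem_chart_source _ n)
  have e := mvfderiv_clm_comp (I := I.prod 𝓘(ℝ, E × ℝ)) (ContinuousLinearMap.snd ℝ E (E × ℝ)) h
  have e2 : (fun m : LTot I M => (ContinuousLinearMap.snd ℝ E (E × ℝ))
      (extChartAt (I.prod 𝓘(ℝ, E × ℝ)) n m)) =ᶠ[nhds n] totFibre I n.proj := by
    filter_upwards [eventually_extChartAt_LTot I n] with m hm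
    rw [hm]
    rfl
  rw [mvfderiv_congr e2] at e
  rw [e]
  have h3 : mvfderiv (I.prod 𝓘(ℝ, E × ℝ)) (extChartAt (I.prod 𝓘(ℝ, E × ℝ)) n) n
      = ContinuousLinearMap.id ℝ (E × E × ℝ) := mfderiv_extChartAt_self
  rw [h3]
  rfl

lemma mvfderiv_comp_proj {G : Type*} [NormedAddCommGroup G] [NormedSpace ℝ G] {g : M → G}
    {n : LTot I M} (hg : MDifferentiableAt I 𝓘(ℝ, G) g n.proj)
    (x : TangentSpace (I.prod 𝓘(ℝ, E × ℝ)) n) :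
    mvfderiv (I.prod 𝓘(ℝ, E × ℝ)) (fun m : LTot I M => g m.proj) n x
      = mvfderiv I g n.proj (x : E × E × ℝ).1 := by
  have hπ : MDifferentiableAt (I.prod 𝓘(ℝ, E × ℝ)) I (fun m : LTot I M => m.proj) n :=
    (contMDiff_LTot_proj I).mdifferentiable (by simp) n
  have h : MDifferentiableAt (I.prod 𝓘(ℝ, E × ℝ)) 𝓘(ℝ, E × E × ℝ)
      (extChartAt (I.prod 𝓘(ℝ, E × ℝ)) n) n := mdifferentiableAt_extChartAt (mem_chart_source _ n)
  have e := mvfderiv_clm_comp (I := I.prod 𝓘(ℝ, E × ℝ)) (ContinuousLinearMap.fst ℝ E (E × ℝ)) h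
  have e2 : (fun m : LTot I M => (ContinuousLinearMap.fst ℝ E (E × ℝ))
      (extChartAt (I.prod 𝓘(ℝ, E × ℝ)) n m)) =ᶠ[nhds n] fun m => extChartAt I n.proj m.proj := by
    filter_upwards [eventually_extChartAt_LTot I n] with m hm
    rw [hm]
    rfl
  rw [mvfderiv_congr e2] at e
  have h3 : mvfderiv (I.prod 𝓘(ℝ, E × ℝ)) (extChartAt (I.prod 𝓘(ℝ, E × ℝ)) n) n
      = ContinuousLinearMap.id ℝ (E × E × ℝ) := mfderiv_extChartAt_self
  rw [h3] at e
  have h4 := mfderiv_comp n (mdifferentiableAt_extChartAt (I := I) (mem_chart_source H n.proj)) hπ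
  rw [mfderiv_extChartAt_self] at h4
  have h5 : ∀ x : TangentSpace (I.prod 𝓘(ℝ, E × ℝ)) n,
      (mfderiv (I.prod 𝓘(ℝ, E × ℝ)) I (fun m : LTot I M => m.proj) n x : E) = (x : E × E × ℝ).1 :=
    fun x => (congrArg (fun T => T x) (h4.symm.trans e))
  have h6 := congrArg (fun T => T x) (mfderiv_comp n hg hπ)
  refine h6.trans ?_
  exact congrArg (fun u : E => (mvfderiv I g n.proj u : G)) (h5 x)

lemma linFun_apply (μ : DualSec I M) (n : LTot I M) :
    linFun I μ n = μ.1 n.proj n.2.1 + μ.2 n.proj * n.2.2 := rfl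

lemma totFibre_self (n : LTot I M) : totFibre I n.proj n = n.2 := by
  rw [totFibre, tangentCoord_self]; rfl

lemma contMDiffAt_formCoord (α : OneForms I M) (p : M) :
    ContMDiffAt I 𝓘(ℝ, E →L[ℝ] ℝ) ∞ (formCoord I α p) p :=
  (contMDiffAt_form_iff I).1 (α.contMDiff p)

lemma contMDiffAt_vecCoord (X : VectorFields I M) (p : M) :
    ContMDiffAt I 𝓘(ℝ, E) ∞ (vecCoord I X p) p :=
  (contMDiffAt_vec_iff I).1 (X.contMDiff p)

lemma linFun_eventuallyEq (μ : DualSec I M) (n : LTot I M) :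
    linFun I μ =ᶠ[nhds n] fun m => formCoord I μ.1 n.proj m.proj (totFibre I n.proj m).1
      + μ.2 m.proj * (totFibre I n.proj m).2 := by
  filter_upwards [eventually_proj_mem I n] with m hm
  rw [linFun_apply]
  congr 1
  have h := formCoord_comp_tangentCoord I μ.1 hm
  rw [← h]
  rfl

lemma contMDiffAt_linFun_aux (μ : DualSec I M) (n : LTot I M) :
    ContMDiffAt (I.prod 𝓘(ℝ, E × ℝ)) 𝓘(ℝ) ∞
      (fun m : LTot I M => formCoord I μ.1 n.proj m.proj (totFibre I n.proj m).1) n := by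
  have h1 := (contMDiffAt_formCoord I μ.1 n.proj).comp n (contMDiff_LTot_proj I n)
  have h2 := (ContinuousLinearMap.fst ℝ E ℝ).contDiff.contMDiff.contMDiffAt.comp n
    (contMDiffAt_totFibre I n)
  exact h1.clm_apply h2

lemma contMDiffAt_linFun_aux' (μ : DualSec I M) (n : LTot I M) :
    ContMDiffAt (I.prod 𝓘(ℝ, E × ℝ)) 𝓘(ℝ) ∞
      (fun m : LTot I M => μ.2 m.proj * (totFibre I n.proj m).2) n := by
  have h3 := (μ.2.contMDiff n.proj).comp n (contMDiff_LTot_proj I n)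
  have h4 := (ContinuousLinearMap.snd ℝ E ℝ).contDiff.contMDiff.contMDiffAt.comp n
    (contMDiffAt_totFibre I n)
  exact h3.mul h4

lemma contMDiff_linFun (μ : DualSec I M) :
    ContMDiff (I.prod 𝓘(ℝ, E × ℝ)) 𝓘(ℝ) ∞ (linFun I μ) := fun n =>
  ((contMDiffAt_linFun_aux I μ n).add (contMDiffAt_linFun_aux' I μ n)).congr_of_eventuallyEq
    (linFun_eventuallyEq I μ n)

lemma contMDiff_comp_proj {f : M → ℝ} (hf : ContMDiff I 𝓘(ℝ) ∞ f) :
    ContMDiff (I.prod 𝓘(ℝ, E × ℝ)) 𝓘(ℝ) ∞ (fun m : LTot I M => f m.proj) :=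
  hf.comp (contMDiff_LTot_proj I)

variable [I.Boundaryless]

lemma mvfderiv_linFun (μ : DualSec I M) (n : LTot I M)
    (x : TangentSpace (I.prod 𝓘(ℝ, E × ℝ)) n) :
    mvfderiv (I.prod 𝓘(ℝ, E × ℝ)) (linFun I μ) n x =
      mvfderiv I (formCoord I μ.1 n.proj) n.proj (x : E × E × ℝ).1 n.2.1
        + μ.1 n.proj (x : E × E × ℝ).2.1
        + (mvfderiv I μ.2 n.proj (x : E × E × ℝ).1 * n.2.2
          + μ.2 n.proj * (x : E × E × ℝ).2.2) := by
  have hα := contMDiffAt_formCoord I μ.1 n.proj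
  have h1 := mdifferentiableAt_of_smooth _ (hα.comp n (contMDiff_LTot_proj I n))
  have hκ := contMDiffAt_totFibre I n
  have h2 := mdifferentiableAt_of_smooth _
    ((ContinuousLinearMap.fst ℝ E ℝ).contDiff.contMDiff.contMDiffAt.comp n hκ)
  have h3 := mdifferentiableAt_of_smooth _
    ((μ.2.contMDiff n.proj).comp n (contMDiff_LTot_proj I n))
  have h4 := mdifferentiableAt_of_smooth _
    ((ContinuousLinearMap.snd ℝ E ℝ).contDiff.contMDiff.contMDiffAt.comp n hκ)
  have e1 := mvfderiv_clm_apply (I.prod 𝓘(ℝ, E × ℝ)) h1 h2 x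
  have e2 := congrArg (fun T => T x) (mvfderiv_mul h3 h4)
  have e0 := mvfderiv_fun_add (mdifferentiableAt_of_smooth _ (contMDiffAt_linFun_aux I μ n))
    (mdifferentiableAt_of_smooth _ (contMDiffAt_linFun_aux' I μ n))
  have a1 : mvfderiv (I.prod 𝓘(ℝ, E × ℝ)) (formCoord I μ.1 n.proj ∘ fun m : LTot I M => m.proj) n
      x = mvfderiv I (formCoord I μ.1 n.proj) n.proj (x : E × E × ℝ).1 :=
    mvfderiv_comp_proj I (mdifferentiableAt_of_smooth _ hα) _
  have a3 : mvfderiv (I.prod 𝓘(ℝ, E × ℝ)) (μ.2 ∘ fun m : LTot I M => m.proj) n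
      x = mvfderiv I μ.2 n.proj (x : E × E × ℝ).1 :=
    mvfderiv_comp_proj I (mdifferentiableAt_of_smooth _ (μ.2.contMDiff n.proj)) _
  have a2 : mvfderiv (I.prod 𝓘(ℝ, E × ℝ)) (⇑(ContinuousLinearMap.fst ℝ E ℝ) ∘ totFibre I n.proj) n
      x = (x : E × E × ℝ).2.1 := by
    refine (congrArg (fun T => T x) (mvfderiv_clm_comp
      (ContinuousLinearMap.fst ℝ E ℝ) (mdifferentiableAt_of_smooth _ hκ))).trans ?_
    rw [ContinuousLinearMap.comp_apply, mvfderiv_totFibre]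
    rfl
  have a4 : mvfderiv (I.prod 𝓘(ℝ, E × ℝ)) (⇑(ContinuousLinearMap.snd ℝ E ℝ) ∘ totFibre I n.proj) n
      x = (x : E × E × ℝ).2.2 := by
    refine (congrArg (fun T => T x) (mvfderiv_clm_comp
      (ContinuousLinearMap.snd ℝ E ℝ) (mdifferentiableAt_of_smooth _ hκ))).trans ?_
    rw [ContinuousLinearMap.comp_apply, mvfderiv_totFibre]
    rfl
  rw [a1, a2] at e1
  have e2' := e2.trans (congrArg₂ (fun a b => μ.2 n.proj * a + (totFibre I n.proj n).2 * b) a4 a3)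
  rw [mvfderiv_congr (linFun_eventuallyEq I μ n), e0]
  refine (congrArg₂ (· + ·) e1 e2').trans ?_
  simp only [Function.comp_apply, totFibre_self, formCoord_self]
  change _ + μ.1 n.proj (x : E × E × ℝ).2.1 + (μ.2 n.proj * (x : E × E × ℝ).2.2 + n.2.2 * _)
    = _ + μ.1 n.proj (x : E × E × ℝ).2.1 + _
  rw [mul_comm n.2.2, add_comm (μ.2 n.proj * (x : E × E × ℝ).2.2)]
  rfl

end TotalSpace

section Brackets

variable {E : Type*} [NormedAddCommGroup E] [NormedSpace ℝ E]
  {H : Type*} [TopologicalSpace H] {I : ModelWithCorners ℝ E H}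
  {M : Type*} [TopologicalSpace M] [ChartedSpace H M] [IsManifold I ∞ M]

lemma IsBivectorField.contMDiffAt_bivecCoord {Λ : Π p : M, Tensor2 (TangentSpace I p)}
    (hΛ : IsBivectorField I Λ) (p : M) :
    ContMDiffAt I 𝓘(ℝ, Tensor2 E) ∞ (bivecCoord I Λ p) p :=
  (contMDiffAt_bivec_iff I).1 (hΛ.smooth p)

lemma skew_apply {V : Type*} [AddCommGroup V] [Module ℝ V] [TopologicalSpace V]
    [IsTopologicalAddGroup V] [ContinuousSMul ℝ V] {B : Tensor2 V}
    (hB : ∀ ξ : V →L[ℝ] ℝ, ξ (B ξ) = 0) (ξ η : V →L[ℝ] ℝ) : η (B ξ) = - ξ (B η) := by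
  have h := hB (ξ + η)
  simp only [map_add, add_apply, hB] at h
  linarith

lemma IsBivectorField.fnBracket_swap {Λ : Π p : M, Tensor2 (TangentSpace I p)}
    (hΛ : IsBivectorField I Λ) (f g : M → ℝ) (p : M) :
    fnBracket I Λ f g p = - fnBracket I Λ g f p :=
  skew_apply (hΛ.skew p) _ _

lemma IsBivectorField.mvfderiv_skew [I.Boundaryless] {Λ : Π p : M, Tensor2 (TangentSpace I p)}
    (hΛ : IsBivectorField I Λ) (p : M) (v : TangentSpace I p) (ξ : E →L[ℝ] ℝ) :
    ξ (mvfderiv I (bivecCoord I Λ p) p v ξ) = 0 := by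
  have h1 := mdifferentiableAt_of_smooth I (hΛ.contMDiffAt_bivecCoord p)
  have h2 : MDifferentiableAt I 𝓘(ℝ, E) (fun q => bivecCoord I Λ p q ξ) p :=
    h1.clm_apply mdifferentiableAt_const
  have e1 := mvfderiv_clm_apply I h1 (mdifferentiableAt_const (c := ξ)) v
  have e2 := congrArg (fun T => T v) (mvfderiv_clm_comp ξ h2)
  have e3 : (fun q => ξ (bivecCoord I Λ p q ξ)) = fun _ => (0 : ℝ) := by
    funext q
    exact hΛ.skew q (ξ.comp (tangentCoord I p q))
  rw [e3, mvfderiv_const] at e2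
  rw [mvfderiv_const] at e1
  have e4 : mvfderiv I (fun q => bivecCoord I Λ p q ξ) p v
      = mvfderiv I (bivecCoord I Λ p) p v ξ := by
    rw [e1]
    exact (congrArg (_ + ·) (map_zero (bivecCoord I Λ p p))).trans (add_zero _)
  rw [← e4]
  exact e2.symm

variable [FiniteDimensional ℝ E]

lemma cov_apply (ξ : E × E × ℝ →L[ℝ] ℝ) (a b : E) (c : ℝ) :
    ξ (a, b, c) = covHor ξ a + covVer ξ b + c * ξ (0, 0, 1) := by
  have : ((a, b, c) : E × E × ℝ) = (a, 0) + (0, b, 0) + c • (0, 0, 1) := by simp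
  rw [this, map_add, map_add, map_smul]; rfl

lemma liftModel_skew {B dB : Tensor2 E} (hB : ∀ ξ : E →L[ℝ] ℝ, ξ (B ξ) = 0)
    (hdB : ∀ ξ : E →L[ℝ] ℝ, ξ (dB ξ) = 0) (G dG Y : E) (h : ℝ) (ξ : E × E × ℝ →L[ℝ] ℝ) :
    ξ (liftModel B G dB dG Y h ξ) = 0 := by
  rw [liftModel, cov_apply]
  simp only [map_add, map_sub, map_smul, hB, hdB, smul_eq_mul]
  rw [skew_apply hB (covVer ξ) (covHor ξ)]
  ring

lemma cov_liftModel {B : Tensor2 E} (hB : ∀ ξ : E →L[ℝ] ℝ, ξ (B ξ) = 0) (dB : Tensor2 E)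
    (G dG Y : E) (h : ℝ) {ξ η : E × E × ℝ →L[ℝ] ℝ} {a b : E →L[ℝ] ℝ} {a' b' : E → ℝ} {s t : ℝ}
    (ha : covVer ξ = a) (hb : covVer η = b) (ha' : ∀ u, covHor ξ u = a' u)
    (hb' : ∀ u, covHor η u = b' u) (hs : ξ (0, 0, 1) = s) (ht : η (0, 0, 1) = t) :
    η (liftModel B G dB dG Y h ξ) =
      b' (B a) + s * b' G - a' (B b) + b (dB a) + s * b dG - h * b (B a) + a Y * b G - a G * b Y
        - t * (a' G + a dG) := by
  rw [liftModel, cov_apply]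
  simp only [map_add, map_sub, map_smul, smul_eq_mul, hs, ht]
  have h1 := skew_apply hB (covHor ξ) (covVer η)
  simp only [ha, hb, ha', hb'] at h1 ⊢
  rw [h1]
  ring

lemma cov_liftModel_of_covVer_eq_zero {B : Tensor2 E} (dB : Tensor2 E)
    {G : E} (dG Y : E) (h : ℝ) {ξ η : E × E × ℝ →L[ℝ] ℝ} {a : E →L[ℝ] ℝ} {s : ℝ} {w : E}
    (hb : covVer η = 0) (ht : η (0, 0, 1) = 0) (ha : covVer ξ = a) (hs : ξ (0, 0, 1) = s)
    (hw : B a + s • G = w) : η (liftModel B G dB dG Y h ξ) = covHor η w := by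
  rw [liftModel, cov_apply, hb, ht, ha, hs, hw]
  simp

variable [I.Boundaryless]

lemma fnBracket_poissonLift {Λ : Π p : M, Tensor2 (TangentSpace I p)} (hΛ : IsBivectorField I Λ)
    (Γ : VectorFields I M) (F F' : LTot I M → ℝ) (n : LTot I M) :
    fnBracket (I.prod 𝓘(ℝ, E × ℝ)) (poissonLift I (jacobiElement I Λ Γ)) F F' n =
      mvfderiv (I.prod 𝓘(ℝ, E × ℝ)) F' n
        (liftModel (E := E) (Λ n.proj) (Γ n.proj) (mvfderiv I (bivecCoord I Λ n.proj) n.proj n.2.1)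
        (mvfderiv I (vecCoord I Γ n.proj) n.proj n.2.1) n.2.1 n.2.2
        (mvfderiv (I.prod 𝓘(ℝ, E × ℝ)) F n)) :=
  congrArg (mvfderiv (I.prod 𝓘(ℝ, E × ℝ)) F' n) (poissonLift_apply I n
    (mdifferentiableAt_of_smooth I (hΛ.contMDiffAt_bivecCoord _))
    (mdifferentiableAt_of_smooth I (contMDiffAt_vecCoord I Γ _)) _)

lemma poissonLift_skew {Λ : Π p : M, Tensor2 (TangentSpace I p)} (hΛ : IsBivectorField I Λ)
    (Γ : VectorFields I M) (n : LTot I M)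
    (ξ : TangentSpace (I.prod 𝓘(ℝ, E × ℝ)) n →L[ℝ] ℝ) :
    ξ (poissonLift I (jacobiElement I Λ Γ) n ξ) = 0 := by
  refine (congrArg ξ (poissonLift_apply I n
    (mdifferentiableAt_of_smooth I (hΛ.contMDiffAt_bivecCoord _))
    (mdifferentiableAt_of_smooth I (contMDiffAt_vecCoord I Γ _)) ξ)).trans ?_
  exact liftModel_skew (E := E) (hΛ.skew n.proj) (hΛ.mvfderiv_skew _ _) _ _ _ _ ξ

lemma covVer_linFun (μ : DualSec I M) (n : LTot I M) :
    covVer (mvfderiv (I.prod 𝓘(ℝ, E × ℝ)) (linFun I μ) n) = (μ.1 n.proj : E →L[ℝ] ℝ) := by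
  ext v
  refine (mvfderiv_linFun I μ n ((0, v, 0) : E × E × ℝ)).trans ?_
  have h1 : mvfderiv I (formCoord I μ.1 n.proj) n.proj (0 : E) n.2.1 = 0 :=
    congrArg (fun T : E →L[ℝ] ℝ => T n.2.1) (map_zero (mvfderiv I (formCoord I μ.1 n.proj) n.proj))
  have h2 : mvfderiv I μ.2 n.proj (0 : E) = 0 := map_zero (mvfderiv I μ.2 n.proj)
  simp only [h1, h2, zero_add, zero_mul, mul_zero, add_zero]
  rfl

lemma mvfderiv_linFun_t (μ : DualSec I M) (n : LTot I M) :
    mvfderiv (I.prod 𝓘(ℝ, E × ℝ)) (linFun I μ) n ((0, 0, 1) : E × E × ℝ) = μ.2 n.proj := by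
  refine (mvfderiv_linFun I μ n ((0, 0, 1) : E × E × ℝ)).trans ?_
  have h1 : mvfderiv I (formCoord I μ.1 n.proj) n.proj (0 : E) n.2.1 = 0 :=
    congrArg (fun T : E →L[ℝ] ℝ => T n.2.1) (map_zero (mvfderiv I (formCoord I μ.1 n.proj) n.proj))
  have h2 : mvfderiv I μ.2 n.proj (0 : E) = 0 := map_zero (mvfderiv I μ.2 n.proj)
  have h3 : μ.1 n.proj (0 : E) = 0 := map_zero (μ.1 n.proj)
  simp only [h1, h2, h3]
  ring

lemma covHor_linFun (μ : DualSec I M) (n : LTot I M) (u : E) :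
    covHor (mvfderiv (I.prod 𝓘(ℝ, E × ℝ)) (linFun I μ) n) u =
      mvfderiv I (formCoord I μ.1 n.proj) n.proj u n.2.1 + mvfderiv I μ.2 n.proj u * n.2.2 := by
  refine (mvfderiv_linFun I μ n ((u, 0) : E × E × ℝ)).trans ?_
  have h3 : μ.1 n.proj (0 : E) = 0 := map_zero (μ.1 n.proj)
  simp only [Prod.fst_zero, Prod.snd_zero, h3]
  ring

lemma covVer_comp_proj {g : M → ℝ} (hg : ContMDiff I 𝓘(ℝ) ∞ g) (n : LTot I M) :
    covVer (mvfderiv (I.prod 𝓘(ℝ, E × ℝ)) (fun m : LTot I M => g m.proj) n) = 0 := by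
  ext v
  refine (mvfderiv_comp_proj I (mdifferentiableAt_of_smooth I (hg n.proj))
    ((0, v, 0) : E × E × ℝ)).trans ?_
  exact map_zero (mvfderiv I g n.proj)

lemma mvfderiv_comp_proj_t {g : M → ℝ} (hg : ContMDiff I 𝓘(ℝ) ∞ g) (n : LTot I M) :
    mvfderiv (I.prod 𝓘(ℝ, E × ℝ)) (fun m : LTot I M => g m.proj) n ((0, 0, 1) : E × E × ℝ)
      = 0 := by
  refine (mvfderiv_comp_proj I (mdifferentiableAt_of_smooth I (hg n.proj))
    ((0, 0, 1) : E × E × ℝ)).trans ?_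
  exact map_zero (mvfderiv I g n.proj)

lemma covHor_comp_proj {g : M → ℝ} (hg : ContMDiff I 𝓘(ℝ) ∞ g) (n : LTot I M) :
    covHor (mvfderiv (I.prod 𝓘(ℝ, E × ℝ)) (fun m : LTot I M => g m.proj) n)
      = (mvfderiv I g n.proj : E →L[ℝ] ℝ) := by
  ext v
  exact mvfderiv_comp_proj I (mdifferentiableAt_of_smooth I (hg n.proj)) ((v, 0) : E × E × ℝ)

lemma fnBracket_proj_proj {Λ : Π p : M, Tensor2 (TangentSpace I p)} (hΛ : IsBivectorField I Λ)
    (Γ : VectorFields I M) {f g : M → ℝ} (hf : ContMDiff I 𝓘(ℝ) ∞ f) (hg : ContMDiff I 𝓘(ℝ) ∞ g)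
    (n : LTot I M) :
    fnBracket (I.prod 𝓘(ℝ, E × ℝ)) (poissonLift I (jacobiElement I Λ Γ))
      (fun m : LTot I M => f m.proj) (fun m : LTot I M => g m.proj) n = 0 := by
  have h0 : Λ n.proj 0 + (0 : ℝ) • Γ n.proj = 0 := by rw [map_zero, zero_smul, add_zero]
  refine (fnBracket_poissonLift hΛ Γ _ _ n).trans ((cov_liftModel_of_covVer_eq_zero (E := E)
    _ _ _ _ (covVer_comp_proj hg n) (mvfderiv_comp_proj_t hg n) (covVer_comp_proj hf n)
    (mvfderiv_comp_proj_t hf n) h0).trans ?_)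
  exact map_zero _

/-- The anchor `Λ_α + f Γ` of `(α, f)`. -/
def anchorVec (Λ : Π p : M, Tensor2 (TangentSpace I p)) (Γ : VectorFields I M)
    (μ : DualSec I M) (p : M) : TangentSpace I p := Λ p (μ.1 p) + μ.2 p • Γ p

lemma fnBracket_linFun_proj {Λ : Π p : M, Tensor2 (TangentSpace I p)} (hΛ : IsBivectorField I Λ)
    (Γ : VectorFields I M) (μ : DualSec I M) {g : M → ℝ} (hg : ContMDiff I 𝓘(ℝ) ∞ g)
    (n : LTot I M) :
    fnBracket (I.prod 𝓘(ℝ, E × ℝ)) (poissonLift I (jacobiElement I Λ Γ))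
      (linFun I μ) (fun m : LTot I M => g m.proj) n = dirDeriv I (anchorVec Λ Γ μ) g n.proj :=
  (fnBracket_poissonLift hΛ Γ _ _ n).trans ((cov_liftModel_of_covVer_eq_zero (E := E)
    _ _ _ _ (covVer_comp_proj hg n) (mvfderiv_comp_proj_t hg n) (covVer_linFun μ n)
    (mvfderiv_linFun_t μ n) rfl).trans
    (congrArg (fun T : E →L[ℝ] ℝ => T (anchorVec Λ Γ μ n.proj)) (covHor_comp_proj hg n)))

/-- The 1-form part of the bracket of `(α, f)` and `(β, g)` in coordinates. -/
def bracketFormCoord (Λ : Π p : M, Tensor2 (TangentSpace I p)) (Γ : VectorFields I M)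
    (μ ν : DualSec I M) (p : M) (v : E) : ℝ :=
  mvfderiv I (formCoord I ν.1 p) p (Λ p (μ.1 p)) v
    - mvfderiv I (formCoord I μ.1 p) p (Λ p (ν.1 p)) v
    + ν.1 p (mvfderiv I (bivecCoord I Λ p) p v (μ.1 p))
    + μ.2 p * (mvfderiv I (formCoord I ν.1 p) p (Γ p) v
      + ν.1 p (mvfderiv I (vecCoord I Γ p) p v))
    - ν.2 p * (mvfderiv I (formCoord I μ.1 p) p (Γ p) v
      + μ.1 p (mvfderiv I (vecCoord I Γ p) p v))
    - (μ.1 p (Γ p) * ν.1 p v - ν.1 p (Γ p) * μ.1 p v)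

lemma fnBracket_linFun_linFun {Λ : Π p : M, Tensor2 (TangentSpace I p)}
    (hΛ : IsBivectorField I Λ) (Γ : VectorFields I M) (μ ν : DualSec I M) (n : LTot I M) :
    fnBracket (I.prod 𝓘(ℝ, E × ℝ)) (poissonLift I (jacobiElement I Λ Γ))
      (linFun I μ) (linFun I ν) n
      = bracketFormCoord Λ Γ μ ν n.proj n.2.1 + jbFun I Λ Γ μ ν n.proj * n.2.2 := by
  refine (fnBracket_poissonLift hΛ Γ _ _ n).trans ((cov_liftModel (E := E) (hΛ.skew n.proj) _ _ _ _ _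
    (covVer_linFun μ n) (covVer_linFun ν n) (covHor_linFun μ n) (covHor_linFun ν n)
    (mvfderiv_linFun_t μ n) (mvfderiv_linFun_t ν n)).trans ?_)
  have h1 : (ν.1 n.proj) (Λ n.proj (μ.1 n.proj)) = - (μ.1 n.proj) (Λ n.proj (ν.1 n.proj)) :=
    skew_apply (hΛ.skew n.proj) _ _
  have key : ∀ x₁ x₂ x₃ x₄ x₅ x₆ x₇ x₈ x₉ x₁₀ x₁₁ y₁ y₂ y₃ y₄ y₅ y₆ f g h : ℝ, y₆ = - y₅ →
      x₁ + y₁ * h + f * (x₂ + y₂ * h) - (x₃ + y₃ * h) + x₄ + f * x₅ - h * y₆ + x₇ * x₈ - x₉ * x₁₀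
        - g * (x₆ + y₄ * h + x₁₁) =
      x₁ - x₃ + x₄ + f * (x₂ + x₅) - g * (x₆ + x₁₁) - (x₉ * x₁₀ - x₈ * x₇)
        + (y₅ + y₁ - y₃ + f * y₂ - g * y₄) * h := by
    intros; subst_vars; ring
  exact key _ _ _ _ _ _ _ _ _ _ _ _ _ _ _ _ _ _ _ _ h1

end Brackets

section FunctionAlgebra

variable {E : Type*} [NormedAddCommGroup E] [NormedSpace ℝ E]
  {H : Type*} [TopologicalSpace H] {I : ModelWithCorners ℝ E H}
  {M : Type*} [TopologicalSpace M] [ChartedSpace H M] [IsManifold I ∞ M] [I.Boundaryless]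
  {Λ : Π p : M, Tensor2 (TangentSpace I p)}

/-- The bracket of a bivector field on the algebra of smooth functions. -/
def smoothBracket (hΛ : IsBivectorField I Λ) (f g : C^∞⟮I, M; 𝓘(ℝ), ℝ⟯) : C^∞⟮I, M; 𝓘(ℝ), ℝ⟯ :=
  ⟨fnBracket I Λ f g, fun p => contMDiffAt_fnBracket I (hΛ.contMDiffAt_bivecCoord p)
    f.contMDiff g.contMDiff⟩

/-- The derivative along a vector field on the algebra of smooth functions. -/
def smoothDeriv (X : VectorFields I M) (f : C^∞⟮I, M; 𝓘(ℝ), ℝ⟯) : C^∞⟮I, M; 𝓘(ℝ), ℝ⟯ :=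
  ⟨dirDeriv I X f, fun p => contMDiffAt_dirDeriv I (contMDiffAt_vecCoord I X p) f.contMDiff⟩

lemma mdifferentiableAt_smooth (f : C^∞⟮I, M; 𝓘(ℝ), ℝ⟯) (p : M) :
    MDifferentiableAt I 𝓘(ℝ) f p := mdifferentiableAt_of_smooth I (f.contMDiff p)

lemma mvfderiv_smooth_add (f g : C^∞⟮I, M; 𝓘(ℝ), ℝ⟯) (p : M) :
    mvfderiv I (f + g : C^∞⟮I, M; 𝓘(ℝ), ℝ⟯) p = mvfderiv I f p + mvfderiv I g p :=
  mvfderiv_fun_add (mdifferentiableAt_smooth f p) (mdifferentiableAt_smooth g p)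

lemma mvfderiv_smooth_mul (f g : C^∞⟮I, M; 𝓘(ℝ), ℝ⟯) (p : M) :
    mvfderiv I (f * g : C^∞⟮I, M; 𝓘(ℝ), ℝ⟯) p = f p • mvfderiv I g p + g p • mvfderiv I f p :=
  mvfderiv_mul (mdifferentiableAt_smooth f p) (mdifferentiableAt_smooth g p)

lemma smoothDeriv_add (X : VectorFields I M) (f g : C^∞⟮I, M; 𝓘(ℝ), ℝ⟯) :
    smoothDeriv X (f + g) = smoothDeriv X f + smoothDeriv X g := by
  ext p
  exact congrArg (fun T => T (X p)) (mvfderiv_smooth_add f g p)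

lemma smoothDeriv_mul (X : VectorFields I M) (f g : C^∞⟮I, M; 𝓘(ℝ), ℝ⟯) :
    smoothDeriv X (f * g) = f * smoothDeriv X g + g * smoothDeriv X f := by
  ext p
  exact congrArg (fun T => T (X p)) (mvfderiv_smooth_mul f g p)

lemma smoothBracket_swap (hΛ : IsBivectorField I Λ) (f g : C^∞⟮I, M; 𝓘(ℝ), ℝ⟯) :
    smoothBracket hΛ f g = - smoothBracket hΛ g f := by
  ext p
  exact hΛ.fnBracket_swap f g p

lemma smoothBracket_add_right (hΛ : IsBivectorField I Λ) (f g h : C^∞⟮I, M; 𝓘(ℝ), ℝ⟯) :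
    smoothBracket hΛ f (g + h) = smoothBracket hΛ f g + smoothBracket hΛ f h := by
  ext p
  exact congrArg (fun T => T (Λ p (mvfderiv I f p))) (mvfderiv_smooth_add g h p)

lemma smoothBracket_mul_right (hΛ : IsBivectorField I Λ) (f g h : C^∞⟮I, M; 𝓘(ℝ), ℝ⟯) :
    smoothBracket hΛ f (g * h) = g * smoothBracket hΛ f h + h * smoothBracket hΛ f g := by
  ext p
  exact congrArg (fun T => T (Λ p (mvfderiv I f p))) (mvfderiv_smooth_mul g h p)

lemma smoothBracket_add_left (hΛ : IsBivectorField I Λ) (f g h : C^∞⟮I, M; 𝓘(ℝ), ℝ⟯) :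
    smoothBracket hΛ (f + g) h = smoothBracket hΛ f h + smoothBracket hΛ g h := by
  rw [smoothBracket_swap, smoothBracket_add_right, smoothBracket_swap hΛ f,
    smoothBracket_swap hΛ g]
  ring

lemma smoothBracket_mul_left (hΛ : IsBivectorField I Λ) (f g h : C^∞⟮I, M; 𝓘(ℝ), ℝ⟯) :
    smoothBracket hΛ (f * g) h = f * smoothBracket hΛ g h + g * smoothBracket hΛ f h := by
  rw [smoothBracket_swap, smoothBracket_mul_right, smoothBracket_swap hΛ f,
    smoothBracket_swap hΛ g]
  ring

lemma smoothBracket_neg_left (hΛ : IsBivectorField I Λ) (f h : C^∞⟮I, M; 𝓘(ℝ), ℝ⟯) :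
    smoothBracket hΛ (-f) h = -smoothBracket hΛ f h := by
  have h1 := smoothBracket_add_left hΛ f 0 h
  have h2 := smoothBracket_add_left hΛ f (-f) h
  rw [add_zero] at h1
  rw [add_neg_cancel] at h2
  linear_combination -h1 - h2

/-- The Jacobiator of the bracket of a bivector field. -/
def jacobiator (hΛ : IsBivectorField I Λ) (f g h : C^∞⟮I, M; 𝓘(ℝ), ℝ⟯) : C^∞⟮I, M; 𝓘(ℝ), ℝ⟯ :=
  smoothBracket hΛ (smoothBracket hΛ f g) h + smoothBracket hΛ (smoothBracket hΛ g h) f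
    + smoothBracket hΛ (smoothBracket hΛ h f) g

lemma jacobiator_cycle (hΛ : IsBivectorField I Λ) (f g h : C^∞⟮I, M; 𝓘(ℝ), ℝ⟯) :
    jacobiator hΛ f g h = jacobiator hΛ g h f := by
  simp only [jacobiator]; ring

lemma jacobiator_add (hΛ : IsBivectorField I Λ) (f f' g h : C^∞⟮I, M; 𝓘(ℝ), ℝ⟯) :
    jacobiator hΛ (f + f') g h = jacobiator hΛ f g h + jacobiator hΛ f' g h := by
  simp only [jacobiator, smoothBracket_add_left, smoothBracket_add_right]; ring

/-- The Hamiltonian vector field of a function. -/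
def hamiltonianVec (hΛ : IsBivectorField I Λ) (f : C^∞⟮I, M; 𝓘(ℝ), ℝ⟯) : VectorFields I M :=
  ⟨fun p => Λ p (mvfderiv I f p), fun p => (contMDiffAt_vec_iff I).2
    (contMDiffAt_vecCoord_sharp I (hΛ.contMDiffAt_bivecCoord p)
      (contMDiffAt_formCoord_mvfderiv I f.contMDiff p))⟩

lemma smoothDeriv_hamiltonianVec (hΛ : IsBivectorField I Λ) (f g : C^∞⟮I, M; 𝓘(ℝ), ℝ⟯) :
    smoothDeriv (hamiltonianVec hΛ f) g = smoothBracket hΛ f g := rfl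

lemma smoothDeriv_comm_of_critical (X Y : VectorFields I M) {f : C^∞⟮I, M; 𝓘(ℝ), ℝ⟯} {p : M}
    (h0 : mvfderiv I f p = 0) :
    smoothDeriv X (smoothDeriv Y f) p = smoothDeriv Y (smoothDeriv X f) p :=
  dirDeriv_comm_of_critical I (mdifferentiableAt_of_smooth I (contMDiffAt_vecCoord I X p))
    (mdifferentiableAt_of_smooth I (contMDiffAt_vecCoord I Y p)) f.contMDiff h0

lemma smoothBracket_of_critical (hΛ : IsBivectorField I Λ) (f : C^∞⟮I, M; 𝓘(ℝ), ℝ⟯)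
    {g : C^∞⟮I, M; 𝓘(ℝ), ℝ⟯} {p : M} (h0 : mvfderiv I g p = 0) : smoothBracket hΛ f g p = 0 :=
  congrArg (fun T => T (Λ p (mvfderiv I f p))) h0

lemma jacobiator_of_critical (hΛ : IsBivectorField I Λ) {f : C^∞⟮I, M; 𝓘(ℝ), ℝ⟯}
    (g h : C^∞⟮I, M; 𝓘(ℝ), ℝ⟯) {p : M} (h0 : mvfderiv I f p = 0) : jacobiator hΛ f g h p = 0 := by
  have e : jacobiator hΛ f g h = smoothBracket hΛ (smoothBracket hΛ g h) f
      + (smoothDeriv (hamiltonianVec hΛ h) (smoothDeriv (hamiltonianVec hΛ g) f)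
        - smoothDeriv (hamiltonianVec hΛ g) (smoothDeriv (hamiltonianVec hΛ h) f)) := by
    simp only [smoothDeriv_hamiltonianVec, jacobiator]
    rw [smoothBracket_swap hΛ f g, smoothBracket_neg_left, smoothBracket_swap hΛ _ h,
      smoothBracket_swap hΛ _ g]
    ring
  rw [e]
  have h1 := smoothBracket_of_critical hΛ (smoothBracket hΛ g h) h0
  have h2 := smoothDeriv_comm_of_critical (hamiltonianVec hΛ h) (hamiltonianVec hΛ g) h0
  change smoothBracket hΛ (smoothBracket hΛ g h) f p + (_ - _) = 0
  rw [h1, h2, sub_self, add_zero]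

lemma mvfderiv_smooth_sub (f g : C^∞⟮I, M; 𝓘(ℝ), ℝ⟯) (p : M) :
    mvfderiv I (f - g : C^∞⟮I, M; 𝓘(ℝ), ℝ⟯) p = mvfderiv I f p - mvfderiv I g p :=
  mvfderiv_fun_sub (mdifferentiableAt_smooth f p) (mdifferentiableAt_smooth g p)

lemma jacobiator_congr (hΛ : IsBivectorField I Λ) {f f' : C^∞⟮I, M; 𝓘(ℝ), ℝ⟯}
    (g h : C^∞⟮I, M; 𝓘(ℝ), ℝ⟯) {p : M} (h0 : mvfderiv I f p = mvfderiv I f' p) :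
    jacobiator hΛ f g h p = jacobiator hΛ f' g h p := by
  have h1 : f = f' + (f - f') := by ring
  have h2 : mvfderiv I (f - f' : C^∞⟮I, M; 𝓘(ℝ), ℝ⟯) p = 0 := by
    rw [mvfderiv_smooth_sub, h0, sub_self]
  rw [h1, jacobiator_add]
  change _ + jacobiator hΛ (f - f') g h p = _
  rw [jacobiator_of_critical hΛ g h h2, add_zero]

lemma smoothDeriv_neg (X : VectorFields I M) (f : C^∞⟮I, M; 𝓘(ℝ), ℝ⟯) :
    smoothDeriv X (-f) = -smoothDeriv X f := by
  have h1 := smoothDeriv_add X f 0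
  have h2 := smoothDeriv_add X f (-f)
  rw [add_zero] at h1
  rw [add_neg_cancel] at h2
  linear_combination -h1 - h2

lemma smoothBracket_zero_left (hΛ : IsBivectorField I Λ) (g : C^∞⟮I, M; 𝓘(ℝ), ℝ⟯) :
    smoothBracket hΛ 0 g = 0 := by
  have h := smoothBracket_add_left hΛ 0 0 g
  rw [add_zero] at h
  exact left_eq_add.1 h

/-- The defect of the homogeneity of a bivector field of degree `-1`. -/
def homogeneityDefect (hΛ : IsBivectorField I Λ)
    (X : VectorFields I M) (f g : C^∞⟮I, M; 𝓘(ℝ), ℝ⟯) : C^∞⟮I, M; 𝓘(ℝ), ℝ⟯ :=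
  smoothDeriv X (smoothBracket hΛ f g) - smoothBracket hΛ (smoothDeriv X f) g
    - smoothBracket hΛ f (smoothDeriv X g) + smoothBracket hΛ f g

lemma homogeneityDefect_swap (hΛ : IsBivectorField I Λ)
    (X : VectorFields I M) (f g : C^∞⟮I, M; 𝓘(ℝ), ℝ⟯) :
    homogeneityDefect hΛ X f g = -homogeneityDefect hΛ X g f := by
  simp only [homogeneityDefect]
  rw [smoothBracket_swap hΛ f g, smoothDeriv_neg, smoothBracket_swap hΛ (smoothDeriv X f),
    smoothBracket_swap hΛ f]
  ring

lemma homogeneityDefect_add (hΛ : IsBivectorField I Λ)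
    (X : VectorFields I M) (f f' g : C^∞⟮I, M; 𝓘(ℝ), ℝ⟯) :
    homogeneityDefect hΛ X (f + f') g
      = homogeneityDefect hΛ X f g + homogeneityDefect hΛ X f' g := by
  simp only [homogeneityDefect, smoothBracket_add_left, smoothDeriv_add]
  ring

lemma homogeneityDefect_of_critical (hΛ : IsBivectorField I Λ) (X : VectorFields I M)
    {f : C^∞⟮I, M; 𝓘(ℝ), ℝ⟯}
    (g : C^∞⟮I, M; 𝓘(ℝ), ℝ⟯) {p : M} (h0 : mvfderiv I f p = 0) :
    homogeneityDefect hΛ X f g p = 0 := by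
  have h1 := smoothBracket_of_critical hΛ (smoothDeriv X g) h0
  have h2 := smoothBracket_of_critical hΛ g h0
  have h3 := smoothDeriv_comm_of_critical X (hamiltonianVec hΛ g) h0
  have e : homogeneityDefect hΛ X f g = smoothDeriv (hamiltonianVec hΛ g) (smoothDeriv X f)
      - smoothDeriv X (smoothDeriv (hamiltonianVec hΛ g) f)
      + smoothBracket hΛ (smoothDeriv X g) f - smoothBracket hΛ g f := by
    simp only [smoothDeriv_hamiltonianVec, homogeneityDefect]
    rw [smoothBracket_swap hΛ f g, smoothDeriv_neg, smoothBracket_swap hΛ (smoothDeriv X f),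
      smoothBracket_swap hΛ f]
    ring
  rw [e]
  change _ - _ + smoothBracket hΛ (smoothDeriv X g) f p - smoothBracket hΛ g f p = 0
  rw [h1, h2, h3]
  ring

lemma homogeneityDefect_congr (hΛ : IsBivectorField I Λ) (X : VectorFields I M)
    {f f' : C^∞⟮I, M; 𝓘(ℝ), ℝ⟯}
    (g : C^∞⟮I, M; 𝓘(ℝ), ℝ⟯) {p : M} (h0 : mvfderiv I f p = mvfderiv I f' p) :
    homogeneityDefect hΛ X f g p = homogeneityDefect hΛ X f' g p := by
  have h1 : f = f' + (f - f') := by ring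
  have h2 : mvfderiv I (f - f' : C^∞⟮I, M; 𝓘(ℝ), ℝ⟯) p = 0 := by
    rw [mvfderiv_smooth_sub, h0, sub_self]
  rw [h1, homogeneityDefect_add]
  change _ + homogeneityDefect hΛ X (f - f') g p = _
  rw [homogeneityDefect_of_critical hΛ X g h2, add_zero]

lemma schoutenSelf_eq_zero_of_jacobiator (hΛ : IsBivectorField I Λ)
    (h : ∀ f g k : C^∞⟮I, M; 𝓘(ℝ), ℝ⟯, jacobiator hΛ f g k = 0) {f g k : M → ℝ}
    (hf : ContMDiff I 𝓘(ℝ) ∞ f) (hg : ContMDiff I 𝓘(ℝ) ∞ g) (hk : ContMDiff I 𝓘(ℝ) ∞ k) (p : M) :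
    schoutenSelf I Λ f g k p = 0 :=
  (congrArg (-2 * ·) (DFunLike.congr_fun (h ⟨f, hf⟩ ⟨g, hg⟩ ⟨k, hk⟩) p)).trans (mul_zero (-2 : ℝ))

lemma schoutenVec_eq_neg_fnBracket (hΛ : IsBivectorField I Λ) (X : VectorFields I M)
    (h : ∀ f g : C^∞⟮I, M; 𝓘(ℝ), ℝ⟯, homogeneityDefect hΛ X f g = 0) {f g : M → ℝ}
    (hf : ContMDiff I 𝓘(ℝ) ∞ f) (hg : ContMDiff I 𝓘(ℝ) ∞ g) (p : M) :
    schoutenVec I X Λ f g p = - fnBracket I Λ f g p :=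
  eq_neg_of_add_eq_zero_left (DFunLike.congr_fun (h ⟨f, hf⟩ ⟨g, hg⟩) p)

lemma jacobiator_congr₃ (hΛ : IsBivectorField I Λ) {f f' g g' h h' : C^∞⟮I, M; 𝓘(ℝ), ℝ⟯} {p : M}
    (hf : mvfderiv I f p = mvfderiv I f' p) (hg : mvfderiv I g p = mvfderiv I g' p)
    (hh : mvfderiv I h p = mvfderiv I h' p) :
    jacobiator hΛ f g h p = jacobiator hΛ f' g' h' p := by
  rw [jacobiator_congr hΛ g h hf, jacobiator_cycle, jacobiator_congr hΛ h f' hg, jacobiator_cycle,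
    jacobiator_congr hΛ f' g' hh, jacobiator_cycle]

lemma homogeneityDefect_congr₂ (hΛ : IsBivectorField I Λ) (X : VectorFields I M)
    {f f' g g' : C^∞⟮I, M; 𝓘(ℝ), ℝ⟯} {p : M}
    (hf : mvfderiv I f p = mvfderiv I f' p) (hg : mvfderiv I g p = mvfderiv I g' p) :
    homogeneityDefect hΛ X f g p = homogeneityDefect hΛ X f' g' p := by
  rw [homogeneityDefect_congr hΛ X g hf, homogeneityDefect_swap, homogeneityDefect_swap hΛ X f' g']
  exact congrArg Neg.neg (homogeneityDefect_congr hΛ X f' hg)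

/-- The Jacobi bracket `{f, g} + f Γ(g) - g Γ(f)`. -/
def jacobiBracket (hΛ : IsBivectorField I Λ) (Γ : VectorFields I M)
    (f g : C^∞⟮I, M; 𝓘(ℝ), ℝ⟯) : C^∞⟮I, M; 𝓘(ℝ), ℝ⟯ :=
  smoothBracket hΛ f g + f * smoothDeriv Γ g - g * smoothDeriv Γ f

/-- The Hamiltonian derivation `{f, h} + f Γ(h)`. -/
def jacobiDeriv (hΛ : IsBivectorField I Λ) (Γ : VectorFields I M)
    (f h : C^∞⟮I, M; 𝓘(ℝ), ℝ⟯) : C^∞⟮I, M; 𝓘(ℝ), ℝ⟯ :=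
  smoothBracket hΛ f h + f * smoothDeriv Γ h

section Identities

variable {Γ : VectorFields I M}

lemma IsJacobi.smoothDeriv_bracket (hJ : IsJacobi I Λ Γ) (f g : C^∞⟮I, M; 𝓘(ℝ), ℝ⟯) :
    smoothDeriv Γ (smoothBracket hJ.bivector f g)
      = smoothBracket hJ.bivector (smoothDeriv Γ f) g
        + smoothBracket hJ.bivector f (smoothDeriv Γ g) := by
  ext p
  have h := hJ.schouten_vec f g f.contMDiff g.contMDiff p
  rw [schoutenVec] at h
  change dirDeriv I Γ (fnBracket I Λ f g) p =
    fnBracket I Λ (dirDeriv I Γ f) g p + fnBracket I Λ f (dirDeriv I Γ g) p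
  linarith

lemma IsJacobi.jacobiator_eq (hJ : IsJacobi I Λ Γ) (f g h : C^∞⟮I, M; 𝓘(ℝ), ℝ⟯) :
    jacobiator hJ.bivector f g h = smoothBracket hJ.bivector f g * smoothDeriv Γ h
      + smoothBracket hJ.bivector g h * smoothDeriv Γ f
      + smoothBracket hJ.bivector h f * smoothDeriv Γ g := by
  ext p
  have e := hJ.schouten_self f g h f.contMDiff g.contMDiff h.contMDiff p
  rw [schoutenSelf, wedgeBivecVec] at e
  change fnBracket I Λ (fnBracket I Λ f g) h p + fnBracket I Λ (fnBracket I Λ g h) f p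
    + fnBracket I Λ (fnBracket I Λ h f) g p = fnBracket I Λ f g p * dirDeriv I Γ h p
    + fnBracket I Λ g h p * dirDeriv I Γ f p + fnBracket I Λ h f p * dirDeriv I Γ g p
  linarith

lemma IsJacobi.jacobiBracket_jacobi (hJ : IsJacobi I Λ Γ) (f g h : C^∞⟮I, M; 𝓘(ℝ), ℝ⟯) :
    jacobiBracket hJ.bivector Γ (jacobiBracket hJ.bivector Γ f g) h
      + jacobiBracket hJ.bivector Γ (jacobiBracket hJ.bivector Γ g h) f
      + jacobiBracket hJ.bivector Γ (jacobiBracket hJ.bivector Γ h f) g = 0 := by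
  have e := hJ.jacobiator_eq f g h
  simp only [jacobiBracket, jacobiator, sub_eq_add_neg, smoothBracket_add_left,
    smoothBracket_neg_left, smoothBracket_mul_left, smoothDeriv_add, smoothDeriv_neg,
    smoothDeriv_mul, hJ.smoothDeriv_bracket] at e ⊢
  have s1 := smoothBracket_swap hJ.bivector f g
  have s2 := smoothBracket_swap hJ.bivector g h
  have s3 := smoothBracket_swap hJ.bivector h f
  have s7 := smoothBracket_swap hJ.bivector (smoothDeriv Γ f) h
  have s8 := smoothBracket_swap hJ.bivector (smoothDeriv Γ g) f
  have s9 := smoothBracket_swap hJ.bivector (smoothDeriv Γ h) g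
  linear_combination e - f * s9 + smoothDeriv Γ g * s3 - g * s7 + smoothDeriv Γ f * s2
    + smoothDeriv Γ h * s1 - h * s8

lemma IsJacobi.jacobiDeriv_jacobiBracket (hJ : IsJacobi I Λ Γ) (f g h : C^∞⟮I, M; 𝓘(ℝ), ℝ⟯) :
    jacobiDeriv hJ.bivector Γ (jacobiBracket hJ.bivector Γ f g) h
      = jacobiDeriv hJ.bivector Γ f (jacobiDeriv hJ.bivector Γ g h)
        - jacobiDeriv hJ.bivector Γ g (jacobiDeriv hJ.bivector Γ f h) := by
  have e := hJ.jacobiator_eq f g h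
  simp only [jacobiBracket, jacobiDeriv, jacobiator, sub_eq_add_neg, smoothBracket_add_left,
    smoothBracket_add_right, smoothBracket_mul_right,
    smoothBracket_neg_left, smoothBracket_mul_left, smoothDeriv_add, smoothDeriv_mul, hJ.smoothDeriv_bracket] at e ⊢
  have s1 := smoothBracket_swap hJ.bivector g f
  have s3 := smoothBracket_swap hJ.bivector h f
  have s4 := smoothBracket_swap hJ.bivector f (smoothBracket hJ.bivector g h)
  have s5 := smoothBracket_swap hJ.bivector g (smoothBracket hJ.bivector f h)
  rw [s3, smoothBracket_neg_left] at e
  rw [s4, s5, s1]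
  linear_combination e

end Identities

end FunctionAlgebra

section PoissonLift

variable {E : Type*} [NormedAddCommGroup E] [NormedSpace ℝ E]
  {H : Type*} [TopologicalSpace H] {I : ModelWithCorners ℝ E H}
  {M : Type*} [TopologicalSpace M] [ChartedSpace H M] [IsManifold I ∞ M] [I.Boundaryless]
  {Λ : Π p : M, Tensor2 (TangentSpace I p)} {Γ : VectorFields I M}

/-- The first jet `(df, f)` of a function. -/
def jet (f : C^∞⟮I, M; 𝓘(ℝ), ℝ⟯) : DualSec I M :=
  (⟨fun p => mvfderiv I f p, contMDiff_mvfderiv I f.contMDiff⟩, f)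

/-- `ι_μ` as a smooth function. -/
def linFunMap (μ : DualSec I M) : C^∞⟮I.prod 𝓘(ℝ, E × ℝ), LTot I M; 𝓘(ℝ), ℝ⟯ :=
  ⟨linFun I μ, contMDiff_linFun I μ⟩

/-- The pullback of a function to `TM ⊕ ℝ`. -/
def basicFun (f : C^∞⟮I, M; 𝓘(ℝ), ℝ⟯) : C^∞⟮I.prod 𝓘(ℝ, E × ℝ), LTot I M; 𝓘(ℝ), ℝ⟯ :=
  ⟨fun m => f m.proj, contMDiff_comp_proj I f.contMDiff⟩

lemma linFunMap_add (μ ν : DualSec I M) : linFunMap (μ + ν) = linFunMap μ + linFunMap ν := by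
  ext n
  change (μ.1 n.proj + ν.1 n.proj) n.2.1 + (μ.2 n.proj + ν.2 n.proj) * n.2.2
    = μ.1 n.proj n.2.1 + μ.2 n.proj * n.2.2 + (ν.1 n.proj n.2.1 + ν.2 n.proj * n.2.2)
  rw [add_apply]
  ring

lemma linFunMap_injective : Function.Injective (linFunMap (I := I) (M := M)) := by
  intro μ ν h
  have h' : ∀ (p : M) (v : TangentSpace I p) (t : ℝ), μ.1 p v + μ.2 p * t = ν.1 p v + ν.2 p * t :=
    fun p v t => congrArg (fun F => F (⟨p, (v, t)⟩ : LTot I M)) h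
  refine Prod.ext ?_ ?_
  · ext p v
    simpa using h' p v 0
  · ext p
    simpa using h' p 0 1

lemma jet_add (f g : C^∞⟮I, M; 𝓘(ℝ), ℝ⟯) : jet (f + g) = jet f + jet g := by
  refine Prod.ext ?_ rfl
  ext p v
  exact congrArg (fun T => T v) (mvfderiv_smooth_add f g p)

lemma jet_zero : jet (0 : C^∞⟮I, M; 𝓘(ℝ), ℝ⟯) = 0 := by
  have h := jet_add (I := I) (M := M) 0 0
  rw [add_zero] at h
  exact (left_eq_add.1 h)

variable [FiniteDimensional ℝ E]

lemma fnBracket_jet_jet (hΛ : IsBivectorField I Λ) (f g : C^∞⟮I, M; 𝓘(ℝ), ℝ⟯) (n : LTot I M) :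
    fnBracket (I.prod 𝓘(ℝ, E × ℝ)) (poissonLift I (jacobiElement I Λ Γ))
      (linFun I (jet f)) (linFun I (jet g)) n
      = linFun I (jet (jacobiBracket hΛ Γ f g)) n := by
  rw [fnBracket_linFun_linFun hΛ, linFun_apply]
  set p := n.proj
  have hsk := skew_apply (hΛ.skew p)
  have e2 : jbFun I Λ Γ (jet f) (jet g) p = (jet (jacobiBracket hΛ Γ f g)).2 p := by
    change mvfderiv I f p (Λ p (mvfderiv I g p)) + mvfderiv I g p (Λ p (mvfderiv I f p))
      - mvfderiv I f p (Λ p (mvfderiv I g p)) + f p * _ - g p * _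
      = mvfderiv I g p (Λ p (mvfderiv I f p)) + f p * _ - g p * _
    have key : ∀ x y z w : ℝ, x + y - x + z - w = y + z - w := by intros; ring
    exact key _ _ _ _
  have e1 : bracketFormCoord Λ Γ (jet f) (jet g) p n.2.1
      = (jet (jacobiBracket hΛ Γ f g)).1 p n.2.1 := by
    have dΛ := mdifferentiableAt_of_smooth I (hΛ.contMDiffAt_bivecCoord p)
    have dΓ := mdifferentiableAt_of_smooth I (contMDiffAt_vecCoord I Γ p)
    have sf := contMDiffAt_formCoord_mvfderiv I f.contMDiff p
    have sg := contMDiffAt_formCoord_mvfderiv I g.contMDiff p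
    have df := mdifferentiableAt_of_smooth I sf
    have dg := mdifferentiableAt_of_smooth I sg
    have dh := mdifferentiableAt_of_smooth I
      (contMDiffAt_vecCoord_sharp I (hΛ.contMDiffAt_bivecCoord p) sf)
    have a1 := mvfderiv_form_apply I dg dh n.2.1
    have a2 := mvfderiv_vecCoord_sharp I dΛ df n.2.1
    have b1 : (jet (jacobiBracket hΛ Γ f g)).1 p n.2.1 =
        mvfderiv I (smoothBracket hΛ f g) p n.2.1
        + (f p * mvfderiv I (smoothDeriv Γ g) p n.2.1 + smoothDeriv Γ g p * mvfderiv I f p n.2.1)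
        - (g p * mvfderiv I (smoothDeriv Γ f) p n.2.1
          + smoothDeriv Γ f p * mvfderiv I g p n.2.1) := by
      change mvfderiv I (jacobiBracket hΛ Γ f g) p n.2.1 = _
      rw [jacobiBracket, mvfderiv_smooth_sub, mvfderiv_smooth_add, mvfderiv_smooth_mul,
        mvfderiv_smooth_mul]
      rfl
    have c1 : mvfderiv I (smoothBracket hΛ f g) p n.2.1 =
        mvfderiv I (formCoord I (mvfderiv I g) p) p (Λ p (mvfderiv I f p)) n.2.1
        + mvfderiv I g p (mvfderiv I (bivecCoord I Λ p) p n.2.1 (mvfderiv I f p))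
        - mvfderiv I (formCoord I (mvfderiv I f) p) p (Λ p (mvfderiv I g p)) n.2.1 := by
      have h1 := hsk (mvfderiv I (formCoord I (mvfderiv I f) p) p n.2.1) (mvfderiv I g p)
      refine a1.trans ?_
      rw [mvfderiv_formCoord_symm I g.contMDiff, mvfderiv_formCoord_symm I f.contMDiff, add_sub_assoc,
        sub_eq_add_neg]
      refine congrArg (_ + ·) ?_
      refine (congrArg (mvfderiv I g p) a2).trans ((map_add (mvfderiv I g p) _ _).trans ?_)
      refine congrArg (_ + ·) (Eq.trans ?_ h1)
      rw [bivecCoord_self]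
      rfl
    have c2 : ∀ {h : C^∞⟮I, M; 𝓘(ℝ), ℝ⟯}, mvfderiv I (smoothDeriv Γ h) p n.2.1 =
        mvfderiv I (formCoord I (mvfderiv I h) p) p (Γ p) n.2.1
          + mvfderiv I h p (mvfderiv I (vecCoord I Γ p) p n.2.1) := fun {h} =>
      (mvfderiv_form_apply I (mdifferentiableAt_of_smooth I
        (contMDiffAt_formCoord_mvfderiv I h.contMDiff p)) dΓ n.2.1).trans
        (congrArg (· + _) (mvfderiv_formCoord_symm I h.contMDiff _ _))
    rw [b1, c1, c2, c2]
    have key : ∀ x₁ x₂ x₃ y z s t u v a b : ℝ, x₁ - x₂ + x₃ + a * y - b * z - (s * t - u * v)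
        = x₁ + x₃ - x₂ + (a * y + u * v) - (b * z + s * t) := by intros; ring
    exact key _ _ _ _ _ _ _ _ _ _ _
  rw [e1, e2]

lemma fnBracket_jet_basic (hΛ : IsBivectorField I Λ) (f g : C^∞⟮I, M; 𝓘(ℝ), ℝ⟯) (n : LTot I M) :
    fnBracket (I.prod 𝓘(ℝ, E × ℝ)) (poissonLift I (jacobiElement I Λ Γ))
      (linFun I (jet f)) (basicFun g) n = jacobiDeriv hΛ Γ f g n.proj := by
  refine (fnBracket_linFun_proj hΛ Γ (jet f) g.contMDiff n).trans ?_
  rw [dirDeriv, anchorVec, map_add, map_smul]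
  rfl

lemma contMDiff_fnBracket_adjoin {Λ : Π p : M, Tensor2 (TangentSpace I p)}
    {S : Set C^∞⟮I, M; 𝓘(ℝ), ℝ⟯} {f g : C^∞⟮I, M; 𝓘(ℝ), ℝ⟯}
    (h : ∀ f ∈ S, ∀ g ∈ S, ContMDiff I 𝓘(ℝ) ∞ (fnBracket I Λ f g))
    (hf : f ∈ Algebra.adjoin ℝ S) (hg : g ∈ Algebra.adjoin ℝ S) :
    ContMDiff I 𝓘(ℝ) ∞ (fnBracket I Λ f g) := by
  have hc : ∀ (c : ℝ) (p : M), mvfderiv I (algebraMap ℝ C^∞⟮I, M; 𝓘(ℝ), ℝ⟯ c) p = 0 := fun c p =>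
    mvfderiv_const (c := c)
  induction hf using Algebra.adjoin_induction with
  | mem f hf =>
    induction hg using Algebra.adjoin_induction with
    | mem g hg => exact h f hf g hg
    | algebraMap c =>
      have e : fnBracket I Λ f (algebraMap ℝ C^∞⟮I, M; 𝓘(ℝ), ℝ⟯ c) = fun _ => 0 := by
        funext p; rw [fnBracket, hc]; rfl
      rw [e]; exact contMDiff_const
    | add g g' _ _ ih ih' =>
      have e : fnBracket I Λ f (g + g' : C^∞⟮I, M; 𝓘(ℝ), ℝ⟯)
          = fun p => fnBracket I Λ f g p + fnBracket I Λ f g' p := by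
        funext p; simp only [fnBracket, mvfderiv_smooth_add]; rfl
      rw [e]; exact ih.add ih'
    | mul g g' _ _ ih ih' =>
      have e : fnBracket I Λ f (g * g' : C^∞⟮I, M; 𝓘(ℝ), ℝ⟯)
          = fun p => g p * fnBracket I Λ f g' p + g' p * fnBracket I Λ f g p := by
        funext p; simp only [fnBracket, mvfderiv_smooth_mul]; rfl
      rw [e]; exact (g.contMDiff.mul ih').add (g'.contMDiff.mul ih)
  | algebraMap c =>
    have e : fnBracket I Λ (algebraMap ℝ C^∞⟮I, M; 𝓘(ℝ), ℝ⟯ c) g = fun _ => 0 := by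
      funext p; rw [fnBracket, hc, map_zero, map_zero]
    rw [e]; exact contMDiff_const
  | add f f' _ _ ih ih' =>
    have e : fnBracket I Λ (f + f' : C^∞⟮I, M; 𝓘(ℝ), ℝ⟯) g
        = fun p => fnBracket I Λ f g p + fnBracket I Λ f' g p := by
      funext p; simp only [fnBracket, mvfderiv_smooth_add, map_add]
    rw [e]; exact ih.add ih'
  | mul f f' _ _ ih ih' =>
    have e : fnBracket I Λ (f * f' : C^∞⟮I, M; 𝓘(ℝ), ℝ⟯) g
        = fun p => f p * fnBracket I Λ f' g p + f' p * fnBracket I Λ f g p := by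
      funext p; simp only [fnBracket, mvfderiv_smooth_mul, map_add, map_smul]; rfl
    rw [e]; exact (f.contMDiff.mul ih').add (f'.contMDiff.mul ih)

/-- The functions `λ_f` and the basic functions. -/
def jetBasic (I : ModelWithCorners ℝ E H) (M : Type*) [TopologicalSpace M] [ChartedSpace H M]
    [IsManifold I ∞ M] [I.Boundaryless] :
    Set C^∞⟮I.prod 𝓘(ℝ, E × ℝ), LTot I M; 𝓘(ℝ), ℝ⟯ :=
  Set.range (fun f => linFunMap (jet f)) ∪ Set.range basicFun

lemma contMDiff_fnBracket_jetBasic (hΛ : IsBivectorField I Λ)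
    {F G : C^∞⟮I.prod 𝓘(ℝ, E × ℝ), LTot I M; 𝓘(ℝ), ℝ⟯}
    (hF : F ∈ jetBasic I M) (hG : G ∈ jetBasic I M) :
    ContMDiff (I.prod 𝓘(ℝ, E × ℝ)) 𝓘(ℝ) ∞
      (fnBracket (I.prod 𝓘(ℝ, E × ℝ)) (poissonLift I (jacobiElement I Λ Γ)) F G) := by
  rcases hF with ⟨f, rfl⟩ | ⟨f, rfl⟩ <;> rcases hG with ⟨g, rfl⟩ | ⟨g, rfl⟩
  · exact (contMDiff_linFun I _).congr fun n => fnBracket_jet_jet hΛ f g n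
  · exact (basicFun (jacobiDeriv hΛ Γ f g)).contMDiff.congr fun n => fnBracket_jet_basic hΛ f g n
  · refine (basicFun (jacobiDeriv hΛ Γ g f)).contMDiff.neg.congr fun n => ?_
    refine Eq.trans ?_ (congrArg Neg.neg (fnBracket_jet_basic hΛ g f n))
    exact skew_apply (poissonLift_skew hΛ Γ n) _ _
  · exact contMDiff_const.congr fun n => fnBracket_proj_proj hΛ Γ f.contMDiff g.contMDiff n

/-- Every linear form on the chart of the total space is near a given point an element of the
algebra generated by the functions `λ_f` and the basic functions. -/
lemma exists_adjoin_jetBasic_eq_chart [T2Space M] (n : LTot I M) (ξ : E × E × ℝ →L[ℝ] ℝ) :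
    ∃ F ∈ Algebra.adjoin ℝ (jetBasic I M),
      F =ᶠ[nhds n] fun m => ξ (extChartAt (I.prod 𝓘(ℝ, E × ℝ)) n m) := by
  obtain ⟨a, ha, ha'⟩ := exists_smooth_eq_chart I n.proj (covHor ξ)
  obtain ⟨b, hb, hb'⟩ := exists_smooth_eq_chart I n.proj (covVer ξ)
  set a₁ : C^∞⟮I, M; 𝓘(ℝ), ℝ⟯ := ⟨a, ha⟩
  set b₁ : C^∞⟮I, M; 𝓘(ℝ), ℝ⟯ := ⟨b, hb⟩
  have j : ∀ f : C^∞⟮I, M; 𝓘(ℝ), ℝ⟯, linFunMap (jet f) ∈ Algebra.adjoin ℝ (jetBasic I M) :=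
    fun f => Algebra.subset_adjoin (Or.inl ⟨f, rfl⟩)
  have k : ∀ f : C^∞⟮I, M; 𝓘(ℝ), ℝ⟯, basicFun f ∈ Algebra.adjoin ℝ (jetBasic I M) :=
    fun f => Algebra.subset_adjoin (Or.inr ⟨f, rfl⟩)
  refine ⟨basicFun a₁ + (linFunMap (jet b₁) - linFunMap (jet 1) * basicFun b₁)
    + ξ (0, 0, 1) • linFunMap (jet 1),
    add_mem (add_mem (k a₁) (sub_mem (j b₁) (mul_mem (j 1) (k b₁)))) (Subalgebra.smul_mem _ (j 1) _),
    ?_⟩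
  have hπ := (FiberBundle.continuous_proj (E × ℝ) (fun q : M => LFib I q)).continuousAt (x := n)
  filter_upwards [eventually_extChartAt_LTot I n, hπ.eventually ha',
    hπ.eventually (eventually_mvfderiv_of_eq_chart I hb')] with m hm h1 h2
  have h3 : linFun I (jet b₁) m
      = covVer ξ (tangentCoord I n.proj m.proj m.2.1) + b m.proj * m.2.2 := by
    refine congrArg (· + b m.proj * m.2.2) ?_
    exact congrArg (fun T => T m.2.1) h2
  have h4 : linFun I (jet 1) m = m.2.2 := by
    have : mvfderiv I ((1 : C^∞⟮I, M; 𝓘(ℝ), ℝ⟯) : M → ℝ) m.proj = 0 :=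
      mvfderiv_const (c := (1 : ℝ))
    refine (congrArg (fun T => T m.2.1 + 1 * m.2.2) this).trans ?_
    rw [one_mul]
    exact zero_add _
  rw [hm]
  change a m.proj + (linFun I (jet b₁) m - linFun I (jet 1) m * b m.proj)
    + ξ (0, 0, 1) * linFun I (jet 1) m = ξ (_, _, _)
  rw [h3, h4]
  refine Eq.trans ?_ (cov_apply ξ _ _ _).symm
  refine (congrArg (· + _ + _) h1).trans ?_
  change _ = _ + covVer ξ (tangentCoord I n.proj m.proj m.2.1) + m.2.2 * _
  ring

lemma IsBivectorField.poissonLift [T2Space M] (hΛ : IsBivectorField I Λ) (Γ : VectorFields I M) :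
    IsBivectorField (I.prod 𝓘(ℝ, E × ℝ)) (poissonLift I (jacobiElement I Λ Γ)) := by
  refine ⟨fun n => ?_, fun n ξ => poissonLift_skew hΛ Γ n ξ⟩
  refine (contMDiffAt_bivec_iff (I.prod 𝓘(ℝ, E × ℝ))).2 ?_
  choose T hT hT' using exists_adjoin_jetBasic_eq_chart n
  exact contMDiffAt_bivecCoord_of_test (I.prod 𝓘(ℝ, E × ℝ)) (fun ξ => T ξ) hT' fun ξ η =>
    contMDiff_fnBracket_adjoin (fun F hF G hG => contMDiff_fnBracket_jetBasic hΛ hF hG)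
      (hT ξ) (hT η) n

end PoissonLift

section Poisson

variable {E : Type*} [NormedAddCommGroup E] [NormedSpace ℝ E]
  {H : Type*} [TopologicalSpace H] {I : ModelWithCorners ℝ E H}
  {M : Type*} [TopologicalSpace M] [ChartedSpace H M] [IsManifold I ∞ M] [I.Boundaryless]
  {Λ : Π p : M, Tensor2 (TangentSpace I p)} {Γ : VectorFields I M}

lemma liouville_eq (n : LTot I M) :
    (liouville I n : E × E × ℝ) = ((0, n.2) : E × E × ℝ) := by
  have h : (liouville I n : E × E × ℝ) =
    (0, fibreCoord (V := fun q : M => LFib I q) (E × ℝ) n.proj n.proj n.2) := rfl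
  rw [h, fibreCoord_LFib_self]

lemma dirDeriv_liouville_linFun (μ : DualSec I M) (n : LTot I M) :
    dirDeriv (I.prod 𝓘(ℝ, E × ℝ)) (liouville I) (linFun I μ) n = linFun I μ n := by
  refine (congrArg (mvfderiv (I.prod 𝓘(ℝ, E × ℝ)) (linFun I μ) n) (liouville_eq n)).trans ?_
  refine (mvfderiv_linFun I μ n ((0, n.2) : E × E × ℝ)).trans ?_
  have h1 : mvfderiv I (formCoord I μ.1 n.proj) n.proj (0 : E) n.2.1 = 0 :=
    congrArg (fun T : E →L[ℝ] ℝ => T n.2.1) (map_zero (mvfderiv I (formCoord I μ.1 n.proj) n.proj))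
  have h2 : mvfderiv I μ.2 n.proj (0 : E) = 0 := map_zero (mvfderiv I μ.2 n.proj)
  simp only [h1, h2, zero_add, zero_mul]
  rfl

lemma dirDeriv_liouville_basicFun (f : C^∞⟮I, M; 𝓘(ℝ), ℝ⟯) (n : LTot I M) :
    dirDeriv (I.prod 𝓘(ℝ, E × ℝ)) (liouville I) (basicFun f) n = 0 := by
  refine (congrArg (mvfderiv (I.prod 𝓘(ℝ, E × ℝ)) (basicFun f) n) (liouville_eq n)).trans ?_
  refine (mvfderiv_comp_proj I (mdifferentiableAt_smooth f n.proj) ((0, n.2) : E × E × ℝ)).trans ?_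
  exact map_zero (mvfderiv I f n.proj)

lemma contMDiff_dirDeriv_adjoin {X : Π p : M, TangentSpace I p}
    {S : Set C^∞⟮I, M; 𝓘(ℝ), ℝ⟯} {f : C^∞⟮I, M; 𝓘(ℝ), ℝ⟯}
    (h : ∀ f ∈ S, ContMDiff I 𝓘(ℝ) ∞ (dirDeriv I X f)) (hf : f ∈ Algebra.adjoin ℝ S) :
    ContMDiff I 𝓘(ℝ) ∞ (dirDeriv I X f) := by
  induction hf using Algebra.adjoin_induction with
  | mem f hf => exact h f hf
  | algebraMap c =>
    exact (contMDiff_const (c := (0 : ℝ))).congr fun p =>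
      congrArg (fun T => T (X p)) (mvfderiv_const (I := I) (c := c) (x := p))
  | add f g _ _ ih ih' =>
    exact (ih.add ih').congr fun p => congrArg (fun T => T (X p)) (mvfderiv_smooth_add f g p)
  | mul f g _ _ ih ih' =>
    exact ((f.contMDiff.mul ih').add (g.contMDiff.mul ih)).congr fun p =>
      congrArg (fun T => T (X p)) (mvfderiv_smooth_mul f g p)

variable [FiniteDimensional ℝ E] [T2Space M]

variable (I M) in
/-- The Liouville vector field of `TM ⊕ ℝ` as a smooth vector field. -/
def liouvilleField : VectorFields (I.prod 𝓘(ℝ, E × ℝ)) (LTot I M) :=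
  ⟨liouville I, fun n => by
    refine (contMDiffAt_vec_iff (I.prod 𝓘(ℝ, E × ℝ))).2 ?_
    choose T hT hT' using exists_adjoin_jetBasic_eq_chart n
    refine contMDiffAt_vecCoord_of_test (I.prod 𝓘(ℝ, E × ℝ)) (fun ξ => T ξ) hT' fun ξ =>
      contMDiff_dirDeriv_adjoin ?_ (hT ξ) n
    rintro F (⟨f, rfl⟩ | ⟨f, rfl⟩)
    · exact (contMDiff_linFun I (jet f)).congr fun n => dirDeriv_liouville_linFun _ n
    · exact contMDiff_const.congr fun n => dirDeriv_liouville_basicFun f n⟩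

lemma smoothDeriv_liouvilleField_linFunMap (μ : DualSec I M) :
    smoothDeriv (liouvilleField I M) (linFunMap μ) = linFunMap μ := by
  ext n
  exact dirDeriv_liouville_linFun μ n

lemma smoothDeriv_liouvilleField_basicFun (f : C^∞⟮I, M; 𝓘(ℝ), ℝ⟯) :
    smoothDeriv (liouvilleField I M) (basicFun f) = 0 := by
  ext n
  exact dirDeriv_liouville_basicFun f n

lemma smoothBracket_jet_jet (hΛ : IsBivectorField I Λ) (f g : C^∞⟮I, M; 𝓘(ℝ), ℝ⟯) :
    smoothBracket (hΛ.poissonLift Γ) (linFunMap (jet f)) (linFunMap (jet g))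
      = linFunMap (jet (jacobiBracket hΛ Γ f g)) := by
  ext n
  exact fnBracket_jet_jet hΛ f g n

lemma smoothBracket_jet_basicFun (hΛ : IsBivectorField I Λ) (f g : C^∞⟮I, M; 𝓘(ℝ), ℝ⟯) :
    smoothBracket (hΛ.poissonLift Γ) (linFunMap (jet f)) (basicFun g)
      = basicFun (jacobiDeriv hΛ Γ f g) := by
  ext n
  exact fnBracket_jet_basic hΛ f g n

lemma smoothBracket_basicFun_jet (hΛ : IsBivectorField I Λ) (f g : C^∞⟮I, M; 𝓘(ℝ), ℝ⟯) :
    smoothBracket (hΛ.poissonLift Γ) (basicFun g) (linFunMap (jet f))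
      = -basicFun (jacobiDeriv hΛ Γ f g) := by
  rw [smoothBracket_swap, smoothBracket_jet_basicFun]

lemma smoothBracket_basicFun_basicFun (hΛ : IsBivectorField I Λ) (f g : C^∞⟮I, M; 𝓘(ℝ), ℝ⟯) :
    smoothBracket (hΛ.poissonLift Γ) (basicFun f) (basicFun g) = 0 := by
  ext n
  exact fnBracket_proj_proj hΛ Γ f.contMDiff g.contMDiff n

/-- The differentials of the functions `λ_f + g` exhaust the covectors. -/
lemma exists_jet_add_basic (F : C^∞⟮I.prod 𝓘(ℝ, E × ℝ), LTot I M; 𝓘(ℝ), ℝ⟯) (n : LTot I M) :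
    ∃ f g : C^∞⟮I, M; 𝓘(ℝ), ℝ⟯, mvfderiv (I.prod 𝓘(ℝ, E × ℝ)) F n
      = mvfderiv (I.prod 𝓘(ℝ, E × ℝ)) (linFunMap (jet f) + basicFun g :
        C^∞⟮I.prod 𝓘(ℝ, E × ℝ), LTot I M; 𝓘(ℝ), ℝ⟯) n := by
  set ξ : E × E × ℝ →L[ℝ] ℝ := mvfderiv (I.prod 𝓘(ℝ, E × ℝ)) F n
  obtain ⟨a, ha, ha'⟩ := exists_smooth_mvfderiv_eq I n.proj (covVer (E := E) ξ)
  set f : C^∞⟮I, M; 𝓘(ℝ), ℝ⟯ := ⟨fun p => a p + (ξ (0, 0, 1) - a n.proj),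
    ha.add contMDiff_const⟩ with hf
  obtain ⟨b, hb, hb'⟩ := exists_smooth_mvfderiv_eq I n.proj
    (covHor ξ - covHor (mvfderiv (I.prod 𝓘(ℝ, E × ℝ)) (linFunMap (jet f)) n))
  refine ⟨f, ⟨b, hb⟩, ?_⟩
  have hdf : mvfderiv I f n.proj = covVer (E := E) ξ := by
    refine (mvfderiv_fun_add (mdifferentiableAt_of_smooth I (ha n.proj))
      mdifferentiableAt_const).trans ?_
    rw [mvfderiv_const, add_zero, ha']
  have h1 : covVer (mvfderiv (I.prod 𝓘(ℝ, E × ℝ)) (linFun I (jet f)) n) = covVer ξ :=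
    (covVer_linFun (jet f) n).trans hdf
  have h2 : mvfderiv (I.prod 𝓘(ℝ, E × ℝ)) (linFun I (jet f)) n ((0, 0, 1) : E × E × ℝ)
      = ξ (0, 0, 1) := (mvfderiv_linFun_t (jet f) n).trans (add_sub_cancel _ _)
  have h3 := (covHor_comp_proj hb n).trans hb'
  have h4 := covVer_comp_proj hb n
  have h5 := mvfderiv_comp_proj_t hb n
  rw [mvfderiv_smooth_add]
  have key : ∀ ξ η ζ : E × E × ℝ →L[ℝ] ℝ, covVer η = covVer ξ → η (0, 0, 1) = ξ (0, 0, 1) →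
      covHor ζ = covHor ξ - covHor η → covVer ζ = 0 → ζ (0, 0, 1) = 0 → ξ = η + ζ := by
    intro ξ η ζ k1 k2 k3 k4 k5
    refine ContinuousLinearMap.ext fun ⟨x, y, z⟩ => ?_
    rw [add_apply, cov_apply, cov_apply η, cov_apply ζ, k1, k2, k3, k4, k5]
    simp only [sub_apply, zero_apply]
    ring
  exact key _ _ _ h1 h2 h3 h4 h5

lemma linFunMap_zero : linFunMap (0 : DualSec I M) = 0 := by
  have h := linFunMap_add (0 : DualSec I M) 0
  rw [add_zero] at h
  exact left_eq_add.1 h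

lemma jacobiator_jet_jet_jet (hJ : IsJacobi I Λ Γ) (f g h : C^∞⟮I, M; 𝓘(ℝ), ℝ⟯) :
    jacobiator (hJ.bivector.poissonLift Γ) (linFunMap (jet f)) (linFunMap (jet g))
      (linFunMap (jet h)) = 0 := by
  have e := smoothBracket_jet_jet (Γ := Γ) hJ.bivector
  rw [jacobiator, e, e, e, e, e, e, ← linFunMap_add, ← jet_add, ← linFunMap_add, ← jet_add,
    hJ.jacobiBracket_jacobi, jet_zero, linFunMap_zero]

lemma jacobiator_jet_jet_basicFun (hJ : IsJacobi I Λ Γ) (f g h : C^∞⟮I, M; 𝓘(ℝ), ℝ⟯) :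
    jacobiator (hJ.bivector.poissonLift Γ) (linFunMap (jet f)) (linFunMap (jet g))
      (basicFun h) = 0 := by
  have e1 := smoothBracket_jet_jet (Γ := Γ) hJ.bivector
  have e2 := smoothBracket_jet_basicFun (Γ := Γ) hJ.bivector
  have e3 := smoothBracket_basicFun_jet (Γ := Γ) hJ.bivector
  rw [jacobiator, e1, e2, e2, e3, e3, smoothBracket_neg_left, e3, hJ.jacobiDeriv_jacobiBracket]
  ext n
  change (jacobiDeriv _ _ _ _ n.proj - jacobiDeriv _ _ _ _ n.proj)
    + -jacobiDeriv _ _ _ _ n.proj + - -jacobiDeriv _ _ _ _ n.proj = (0 : ℝ)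
  ring

lemma jacobiator_basicFun_basicFun_jet (hΛ : IsBivectorField I Λ)
    (f g h : C^∞⟮I, M; 𝓘(ℝ), ℝ⟯) :
    jacobiator (hΛ.poissonLift Γ) (basicFun f) (basicFun g) (linFunMap (jet h)) = 0 := by
  have e2 := smoothBracket_jet_basicFun (Γ := Γ) hΛ
  have e3 := smoothBracket_basicFun_jet (Γ := Γ) hΛ
  have e4 := smoothBracket_basicFun_basicFun (Γ := Γ) hΛ
  rw [jacobiator, e4, e3, e2, smoothBracket_neg_left, e4, e4, smoothBracket_zero_left]
  ring

lemma jacobiator_basicFun_basicFun_basicFun (hΛ : IsBivectorField I Λ)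
    (f g h : C^∞⟮I, M; 𝓘(ℝ), ℝ⟯) :
    jacobiator (hΛ.poissonLift Γ) (basicFun f) (basicFun g) (basicFun h) = 0 := by
  have e4 := smoothBracket_basicFun_basicFun (Γ := Γ) hΛ
  rw [jacobiator, e4, e4, e4, smoothBracket_zero_left, smoothBracket_zero_left,
    smoothBracket_zero_left]
  ring

lemma cyclic_triadditive_eq_zero {A : Type*} [AddCommGroup A] {J : A → A → A → A}
    (hc : ∀ x y z, J x y z = J y z x) (ha : ∀ x x' y z, J (x + x') y z = J x y z + J x' y z)
    {x x' y y' z z' : A} (h₁ : J x y z = 0) (h₂ : J x y z' = 0) (h₃ : J y z x' = 0)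
    (h₄ : J z x y' = 0) (h₅ : J x' y' z = 0) (h₆ : J y' z' x = 0) (h₇ : J z' x' y = 0)
    (h₈ : J x' y' z' = 0) : J (x + x') (y + y') (z + z') = 0 := by
  have k₁ : J z x y = 0 := (hc _ _ _).trans h₁
  have k₂ : J z' x y = 0 := (hc _ _ _).trans h₂
  have k₃ : J z x' y = 0 := (hc _ _ _).trans ((hc _ _ _).trans h₃)
  have k₄ : J z x' y' = 0 := (hc _ _ _).trans h₅
  have k₅ : J z' x y' = 0 := (hc _ _ _).trans ((hc _ _ _).trans h₆)
  have k₆ : J z' x' y' = 0 := (hc _ _ _).trans h₈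
  rw [ha, hc x, hc x', ha, ha, hc y, hc y', hc y, hc y', ha, ha, ha, ha, k₁, k₂, k₃, k₄, k₅, k₆,
    h₄, h₇]
  simp

lemma skew_biadditive_eq_zero {A : Type*} [AddCommGroup A] {J : A → A → A}
    (hs : ∀ x y, J x y = - J y x) (ha : ∀ x x' y, J (x + x') y = J x y + J x' y)
    {x x' y y' : A} (h₁ : J x y = 0) (h₂ : J x y' = 0) (h₃ : J y x' = 0) (h₄ : J x' y' = 0) :
    J (x + x') (y + y') = 0 := by
  rw [ha, hs x, hs x', ha, ha, hs y, hs y', hs y', h₁, h₂, h₃, h₄]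
  simp

lemma jacobiator_poissonLift (hJ : IsJacobi I Λ Γ)
    (F G K : C^∞⟮I.prod 𝓘(ℝ, E × ℝ), LTot I M; 𝓘(ℝ), ℝ⟯) :
    jacobiator (hJ.bivector.poissonLift Γ) F G K = 0 := by
  ext n
  obtain ⟨f, f', hf⟩ := exists_jet_add_basic F n
  obtain ⟨g, g', hg⟩ := exists_jet_add_basic G n
  obtain ⟨k, k', hk⟩ := exists_jet_add_basic K n
  have z2 := jacobiator_jet_jet_basicFun hJ
  have z3 := jacobiator_basicFun_basicFun_jet (Γ := Γ) hJ.bivector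
  exact (jacobiator_congr₃ _ hf hg hk).trans (DFunLike.congr_fun (cyclic_triadditive_eq_zero
    (jacobiator_cycle _) (jacobiator_add _) (jacobiator_jet_jet_jet hJ f g k) (z2 f g k')
    (z2 g k f') (z2 k f g') (z3 f' g' k) (z3 g' k' f) (z3 k' f' g)
    (jacobiator_basicFun_basicFun_basicFun hJ.bivector f' g' k')) n)

lemma isPoisson_poissonLift (hJ : IsJacobi I Λ Γ) :
    IsPoisson (I.prod 𝓘(ℝ, E × ℝ)) (poissonLift I (jacobiElement I Λ Γ)) :=
  ⟨hJ.bivector.poissonLift Γ, fun _ _ _ hF hG hK n =>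
    schoutenSelf_eq_zero_of_jacobiator (hJ.bivector.poissonLift Γ) (jacobiator_poissonLift hJ)
      hF hG hK n⟩

lemma homogeneityDefect_poissonLift (hΛ : IsBivectorField I Λ)
    (F G : C^∞⟮I.prod 𝓘(ℝ, E × ℝ), LTot I M; 𝓘(ℝ), ℝ⟯) :
    homogeneityDefect (hΛ.poissonLift Γ) (liouvilleField I M) F G = 0 := by
  ext n
  obtain ⟨f, f', hf⟩ := exists_jet_add_basic F n
  obtain ⟨g, g', hg⟩ := exists_jet_add_basic G n
  have e1 := smoothBracket_jet_jet (Γ := Γ) hΛ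
  have e2 := smoothBracket_jet_basicFun (Γ := Γ) hΛ
  have e4 := smoothBracket_basicFun_basicFun (Γ := Γ) hΛ
  have d1 := smoothDeriv_liouvilleField_linFunMap (I := I) (M := M)
  have d2 := smoothDeriv_liouvilleField_basicFun (I := I) (M := M)
  have z := smoothBracket_zero_left (hΛ.poissonLift Γ)
  have z' : ∀ F, smoothBracket (hΛ.poissonLift Γ) F 0 = 0 := fun F => by
    rw [smoothBracket_swap, z, neg_zero]
  have k1 : homogeneityDefect (hΛ.poissonLift Γ) (liouvilleField I M) (linFunMap (jet f))
      (linFunMap (jet g)) = 0 := by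
    rw [homogeneityDefect, d1, d1, e1, d1]; ring
  have k2 : ∀ f g, homogeneityDefect (hΛ.poissonLift Γ) (liouvilleField I M) (linFunMap (jet f))
      (basicFun g) = 0 := fun f g => by
    rw [homogeneityDefect, d1, d2, e2, d2, z']; ring
  have k3 : homogeneityDefect (hΛ.poissonLift Γ) (liouvilleField I M) (basicFun f')
      (basicFun g') = 0 := by
    have := smoothDeriv_add (liouvilleField I M) 0 0
    rw [add_zero] at this
    rw [homogeneityDefect, d2, d2, e4, z, z', left_eq_add.1 this]; ring
  exact (homogeneityDefect_congr₂ _ _ hf hg).trans (DFunLike.congr_fun (skew_biadditive_eq_zero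
    (homogeneityDefect_swap _ _) (homogeneityDefect_add _ _) k1 (k2 f g') (k2 g f') k3) n)

lemma isHomogeneous_poissonLift (hΛ : IsBivectorField I Λ) :
    IsHomogeneous I (poissonLift I (jacobiElement I Λ Γ)) := fun _ _ hF hG n =>
  schoutenVec_eq_neg_fnBracket (hΛ.poissonLift Γ) (liouvilleField I M)
    (homogeneityDefect_poissonLift hΛ) hF hG n

end Poisson

section InducedBracket

variable {E : Type*} [NormedAddCommGroup E] [NormedSpace ℝ E]
  {H : Type*} [TopologicalSpace H] {I : ModelWithCorners ℝ E H}
  {M : Type*} [TopologicalSpace M] [ChartedSpace H M] [IsManifold I ∞ M]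
  {Λ : Π p : M, Tensor2 (TangentSpace I p)} {Γ : VectorFields I M}

variable (I) in
lemma contMDiffAt_frameSection (p : M) (v : E) (c : ℝ) :
    ContMDiffAt I (I.prod 𝓘(ℝ, E × ℝ)) ∞
      (fun q => (⟨q, (tangentCoordSymm I p q v, c)⟩ : LTot I M)) p := by
  rw [contMDiffAt_totalSpace]
  refine ⟨contMDiffAt_id, (contMDiffAt_const (c := ((v, c) : E × ℝ))).congr_of_eventuallyEq ?_⟩
  filter_upwards [eventually_mem_chart (H := H) p] with q hq
  have hq' : q ∈ (trivializationAt (E × ℝ) (fun q : M => LFib I q) p).baseSet := by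
    change q ∈ (trivializationAt E (TangentSpace I) p).baseSet ∩ Set.univ
    simpa using hq
  have h := fibreCoord_LFib I hq (tangentCoordSymm I p q v, c)
  rw [fibreCoord, Trivialization.continuousLinearMapAt_apply,
    Trivialization.coe_linearMapAt_of_mem _ hq'] at h
  refine h.trans ?_
  rw [tangentCoord_tangentCoordSymm I hq]

/-- The linear algebra of the coordinate formula for the 1-form part of the bracket. -/
def bracketFormModel (α β x₁ x₂ y₁ y₂ : E →L[ℝ] ℝ) (dB : E →L[ℝ] Tensor2 E) (dG : E →L[ℝ] E)
    (f g a b : ℝ) : E →L[ℝ] ℝ :=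
  x₁ - x₂ + β.comp ((ContinuousLinearMap.apply ℝ E α).comp dB) + f • (y₁ + β.comp dG)
    - g • (y₂ + α.comp dG) - (a • β - b • α)

/-- The 1-form part of the bracket of `(α, f)` and `(β, g)`. -/
def bracketForm (Λ : Π p : M, Tensor2 (TangentSpace I p)) (Γ : VectorFields I M)
    (μ ν : DualSec I M) (p : M) : TangentSpace I p →L[ℝ] ℝ :=
  bracketFormModel (E := E) (μ.1 p) (ν.1 p) (mvfderiv I (formCoord I ν.1 p) p (Λ p (μ.1 p)))
    (mvfderiv I (formCoord I μ.1 p) p (Λ p (ν.1 p))) (mvfderiv I (formCoord I ν.1 p) p (Γ p))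
    (mvfderiv I (formCoord I μ.1 p) p (Γ p)) (mvfderiv I (bivecCoord I Λ p) p)
    (mvfderiv I (vecCoord I Γ p) p) (μ.2 p) (ν.2 p) (μ.1 p (Γ p)) (ν.1 p (Γ p))

variable [I.Boundaryless] [FiniteDimensional ℝ E] [T2Space M]

/-- The bracket on sections of `T*M ⊕ ℝ` induced by the Poisson lift of `Λ + I ∧ Γ`. -/
def inducedBracket (hΛ : IsBivectorField I Λ) (Γ : VectorFields I M) (μ ν : DualSec I M) :
    DualSec I M :=
  (⟨bracketForm Λ Γ μ ν, fun p => (contMDiffAt_form_iff I).2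
    (contMDiffAt_clm_of_apply I fun v => by
      refine (((smoothBracket (hΛ.poissonLift Γ) (linFunMap μ) (linFunMap ν)).contMDiff _).comp p
        (contMDiffAt_frameSection I p v 0)).congr_of_eventuallyEq (Filter.Eventually.of_forall
        fun q => ?_)
      refine Eq.trans ?_ (fnBracket_linFun_linFun hΛ Γ μ ν _).symm
      exact (add_zero _).symm.trans (congrArg (_ + ·) (mul_zero _).symm))⟩,
  ⟨jbFun I Λ Γ μ ν, fun p => by
      refine (((smoothBracket (hΛ.poissonLift Γ) (linFunMap μ) (linFunMap ν)).contMDiff _).comp p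
        (contMDiffAt_frameSection I p 0 1)).congr_of_eventuallyEq (Filter.Eventually.of_forall
        fun q => ?_)
      refine Eq.trans ?_ (fnBracket_linFun_linFun hΛ Γ μ ν _).symm
      have h : bracketFormCoord Λ Γ μ ν q (tangentCoordSymm I p q 0 : TangentSpace I q) = 0 :=
        (congrArg (bracketForm Λ Γ μ ν q) (map_zero (tangentCoordSymm I p q))).trans
          (map_zero (bracketForm Λ Γ μ ν q))
      exact (mul_one _).symm.trans ((zero_add _).symm.trans (congrArg (· + _) h.symm))⟩)

lemma induces_inducedBracket (hΛ : IsBivectorField I Λ) (Γ : VectorFields I M) :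
    Induces I (poissonLift I (jacobiElement I Λ Γ)) (inducedBracket hΛ Γ) :=
  fun μ ν n => fnBracket_linFun_linFun hΛ Γ μ ν n

lemma Induces.linFunMap_eq {br : DualSec I M → DualSec I M → DualSec I M}
    (hΛ : IsBivectorField I Λ) (h : Induces I (poissonLift I (jacobiElement I Λ Γ)) br)
    (μ ν : DualSec I M) :
    linFunMap (br μ ν) = smoothBracket (hΛ.poissonLift Γ) (linFunMap μ) (linFunMap ν) := by
  ext n
  exact (h μ ν n).symm

lemma Induces.eq_inducedBracket {br : DualSec I M → DualSec I M → DualSec I M}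
    (hΛ : IsBivectorField I Λ) (h : Induces I (poissonLift I (jacobiElement I Λ Γ)) br) :
    br = inducedBracket hΛ Γ := by
  funext μ ν
  apply linFunMap_injective
  rw [h.linFunMap_eq hΛ, (induces_inducedBracket hΛ Γ).linFunMap_eq hΛ]

lemma existsUnique_induces (hΛ : IsBivectorField I Λ) (Γ : VectorFields I M) :
    ∃! br, Induces I (poissonLift I (jacobiElement I Λ Γ)) br :=
  ⟨inducedBracket hΛ Γ, induces_inducedBracket hΛ Γ, fun _ h => h.eq_inducedBracket hΛ⟩

end InducedBracket

section Algebroid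

variable {E : Type*} [NormedAddCommGroup E] [NormedSpace ℝ E]
  {H : Type*} [TopologicalSpace H] {I : ModelWithCorners ℝ E H}
  {M : Type*} [TopologicalSpace M] [ChartedSpace H M] [IsManifold I ∞ M] [I.Boundaryless]
  {Λ : Π p : M, Tensor2 (TangentSpace I p)} {Γ : VectorFields I M}

lemma linFunMap_smul (c : ℝ) (μ : DualSec I M) : linFunMap (c • μ) = c • linFunMap μ := by
  ext n
  change c * μ.1 n.proj n.2.1 + c * μ.2 n.proj * n.2.2
    = c * (μ.1 n.proj n.2.1 + μ.2 n.proj * n.2.2)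
  ring

lemma linFunMap_fsmul (f : C^∞⟮I, M; 𝓘(ℝ), ℝ⟯) (μ : DualSec I M) :
    linFunMap (DualSec.fsmul I f μ) = basicFun f * linFunMap μ := by
  ext n
  change f n.proj * μ.1 n.proj n.2.1 + f n.proj * μ.2 n.proj * n.2.2
    = f n.proj * (μ.1 n.proj n.2.1 + μ.2 n.proj * n.2.2)
  ring

lemma mvfderiv_smooth_smul (c : ℝ) (f : C^∞⟮I, M; 𝓘(ℝ), ℝ⟯) (p : M) :
    mvfderiv I (c • f : C^∞⟮I, M; 𝓘(ℝ), ℝ⟯) p = c • mvfderiv I f p :=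
  mvfderiv_clm_comp (c • ContinuousLinearMap.id ℝ ℝ) (mdifferentiableAt_smooth f p)

lemma smoothBracket_smul_right (hΛ : IsBivectorField I Λ) (c : ℝ)
    (f g : C^∞⟮I, M; 𝓘(ℝ), ℝ⟯) : smoothBracket hΛ f (c • g) = c • smoothBracket hΛ f g := by
  ext p
  exact congrArg (fun T => T (Λ p (mvfderiv I f p))) (mvfderiv_smooth_smul c g p)

lemma smoothBracket_smul_left (hΛ : IsBivectorField I Λ) (c : ℝ)
    (f g : C^∞⟮I, M; 𝓘(ℝ), ℝ⟯) : smoothBracket hΛ (c • f) g = c • smoothBracket hΛ f g := by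
  rw [smoothBracket_swap, smoothBracket_smul_right, smoothBracket_swap hΛ f, smul_neg]

lemma contMDiffAt_vecCoord_anchorVec (hΛ : IsBivectorField I Λ) (μ : DualSec I M) (p : M) :
    ContMDiffAt I 𝓘(ℝ, E) ∞ (vecCoord I (anchorVec Λ Γ μ) p) p := by
  have h : vecCoord I (anchorVec Λ Γ μ) p
      = fun q => vecCoord I (fun q => Λ q (μ.1 q)) p q + μ.2 q • vecCoord I Γ p q := by
    funext q
    rw [vecCoord, anchorVec, map_add, map_smul]
    rfl
  rw [h]
  exact (contMDiffAt_vecCoord_sharp I (hΛ.contMDiffAt_bivecCoord p)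
    (contMDiffAt_formCoord I μ.1 p)).add ((μ.2.contMDiff p).smul (contMDiffAt_vecCoord I Γ p))

/-- The anchor as a smooth vector field. -/
def anchorField (hΛ : IsBivectorField I Λ) (Γ : VectorFields I M) (μ : DualSec I M) :
    VectorFields I M :=
  ⟨anchorVec Λ Γ μ, fun p => (contMDiffAt_vec_iff I).2 (contMDiffAt_vecCoord_anchorVec hΛ μ p)⟩

lemma anchorField_add (hΛ : IsBivectorField I Λ) (μ ν : DualSec I M) :
    anchorField hΛ Γ (μ + ν) = anchorField hΛ Γ μ + anchorField hΛ Γ ν := by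
  ext p
  change Λ p (μ.1 p + ν.1 p) + (μ.2 p + ν.2 p) • Γ p
    = (Λ p (μ.1 p) + μ.2 p • Γ p) + (Λ p (ν.1 p) + ν.2 p • Γ p)
  rw [map_add, add_smul]
  abel

lemma anchorField_fsmul (hΛ : IsBivectorField I Λ) (f : C^∞⟮I, M; 𝓘(ℝ), ℝ⟯) (μ : DualSec I M) :
    anchorField hΛ Γ (DualSec.fsmul I f μ) = vsmul I f (anchorField hΛ Γ μ) := by
  ext p
  change Λ p (f p • μ.1 p) + (f p * μ.2 p) • Γ p = f p • (Λ p (μ.1 p) + μ.2 p • Γ p)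
  rw [map_smul, smul_add, mul_smul]

variable [FiniteDimensional ℝ E] [T2Space M]

lemma Induces.isLieAlgebroidBracket {br : DualSec I M → DualSec I M → DualSec I M}
    (hJ : IsJacobi I Λ Γ) (h : Induces I (poissonLift I (jacobiElement I Λ Γ)) br) :
    IsLieAlgebroidBracket I br := by
  have e := h.linFunMap_eq hJ.bivector
  refine ⟨fun μ₁ μ₂ ν => ?_, fun c μ ν => ?_, fun μ => ?_, fun μ ν₁ ν₂ => ?_, fun c μ ν => ?_,
    fun μ ν κ => ?_, anchorField hJ.bivector Γ, anchorField_add _, anchorField_fsmul _,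
    fun μ f ν p => ?_⟩
  · apply linFunMap_injective
    rw [linFunMap_add, e, e, e, linFunMap_add, smoothBracket_add_left]
  · apply linFunMap_injective
    rw [linFunMap_smul, e, e, linFunMap_smul, smoothBracket_smul_left]
  · apply linFunMap_injective
    rw [e, linFunMap_zero]
    ext n
    exact poissonLift_skew hJ.bivector Γ n _
  · apply linFunMap_injective
    rw [linFunMap_add, e, e, e, linFunMap_add, smoothBracket_add_right]
  · apply linFunMap_injective
    rw [linFunMap_smul, e, e, linFunMap_smul, smoothBracket_smul_right]
  · apply linFunMap_injective
    rw [linFunMap_add, linFunMap_add, e, e, e, e, e, e, linFunMap_zero]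
    exact jacobiator_poissonLift hJ _ _ _
  · refine ContinuousLinearMap.ext fun x => ?_
    have h1 := DFunLike.congr_fun (e μ (DualSec.fsmul I f ν)) (⟨p, x⟩ : LTot I M)
    rw [linFunMap_fsmul, smoothBracket_mul_right, ← e] at h1
    refine h1.trans ?_
    have h2 := fnBracket_linFun_proj hJ.bivector Γ μ f.contMDiff (⟨p, x⟩ : LTot I M)
    refine (congrArg (fun y => f p * _ + linFun I ν ⟨p, x⟩ * y) h2).trans ?_
    exact congrArg (_ + ·) (mul_comm _ _)

end Algebroid

section Formulas

variable {E : Type*} [NormedAddCommGroup E] [NormedSpace ℝ E]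
  {H : Type*} [TopologicalSpace H] {I : ModelWithCorners ℝ E H}
  {M : Type*} [TopologicalSpace M] [ChartedSpace H M] [IsManifold I ∞ M]
  {Λ : Π p : M, Tensor2 (TangentSpace I p)} {Γ : VectorFields I M}

lemma contraction_jacobiElement (μ : DualSec I M) (p : M) :
    contraction I (jacobiElement I Λ Γ) μ p = (anchorVec Λ Γ μ p, -(μ.1 p (Γ p))) := by
  have h1 : (DualSec.toDual I μ p).comp (inclTM I p) = μ.1 p := by
    ext v
    change μ.1 p v + μ.2 p * 0 = μ.1 p v
    rw [mul_zero, add_zero]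
  have h2 : DualSec.toDual I μ p (unitSec I p) = μ.2 p := by
    change μ.1 p 0 + μ.2 p * 1 = μ.2 p
    rw [map_zero, mul_one, zero_add]
  have h3 : DualSec.toDual I μ p (inclTM I p (Γ p)) = μ.1 p (Γ p) :=
    congrArg (fun T => T (Γ p)) h1
  rw [contraction, jacobiElement, add_apply, push_apply, wedge_apply, h1, h2, h3]
  refine Prod.ext ?_ ?_
  · change Λ p (μ.1 p) + (μ.2 p • Γ p - μ.1 p (Γ p) • 0) = Λ p (μ.1 p) + μ.2 p • Γ p
    rw [smul_zero, sub_zero]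
  · change (0 : ℝ) + (μ.2 p * 0 - μ.1 p (Γ p) * 1) = _
    ring

variable [I.Boundaryless]

lemma lieForm_anchorVec (hΛ : IsBivectorField I Λ) (μ : DualSec I M) (β : OneForms I M)
    (Z : VectorFields I M) (p : M) :
    lieForm I (anchorVec Λ Γ μ) β Z p = lieForm I (sharp I Λ μ.1) β Z p
      + μ.2 p * lieForm I Γ β Z p + dirDeriv I Z μ.2 p * β p (Γ p) := by
  have sΛ := contMDiffAt_vecCoord_sharp I (hΛ.contMDiffAt_bivecCoord p)
    (contMDiffAt_formCoord I μ.1 p)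
  have dΛ := mdifferentiableAt_of_smooth I sΛ
  have dΓ := mdifferentiableAt_of_smooth I (contMDiffAt_vecCoord I Γ p)
  have dZ := mdifferentiableAt_of_smooth I (contMDiffAt_vecCoord I Z p)
  have dβ := mdifferentiableAt_of_smooth I (contMDiffAt_formCoord I β p)
  have df := mdifferentiableAt_smooth μ.2 p
  have dA := mdifferentiableAt_of_smooth I (contMDiffAt_vecCoord_anchorVec (Γ := Γ) hΛ μ p)
  have e1 := lieForm_eq_coord I dA dZ dβ
  have e2 := lieForm_eq_coord I dΛ dZ dβ
  have e3 := lieForm_eq_coord I dΓ dZ dβ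
  have h : vecCoord I (anchorVec Λ Γ μ) p
      = fun q => vecCoord I (fun q => Λ q (μ.1 q)) p q + μ.2 q • vecCoord I Γ p q := by
    funext q
    rw [vecCoord, anchorVec, map_add, map_smul]
    rfl
  have e4 : mvfderiv I (vecCoord I (anchorVec Λ Γ μ) p) p (Z p)
      = mvfderiv I (vecCoord I (fun q => Λ q (μ.1 q)) p) p (Z p)
        + (μ.2 p • mvfderiv I (vecCoord I Γ p) p (Z p) + dirDeriv I Z μ.2 p • vecCoord I Γ p p) := by
    have h1 := congrArg (fun T => T (Z p)) (mvfderiv_fun_add dΛ (df.smul dΓ))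
    have h2 := congrArg (fun T => T (Z p)) (mvfderiv_smul df dΓ)
    rw [h]
    exact h1.trans (congrArg (_ + ·) h2)
  have e5 : β p (mvfderiv I (vecCoord I (anchorVec Λ Γ μ) p) p (Z p) : E)
      = β p (mvfderiv I (vecCoord I (fun q => Λ q (μ.1 q)) p) p (Z p) : E)
        + (μ.2 p * β p (mvfderiv I (vecCoord I Γ p) p (Z p) : E)
          + dirDeriv I Z μ.2 p * β p (Γ p)) := by
    rw [vecCoord_self] at e4
    refine (congrArg (β p) e4).trans ((map_add (β p) _ _).trans (congrArg (_ + ·)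
      ((map_add (β p) _ _).trans (congrArg₂ (· + ·) (map_smul (β p) _ _) (map_smul (β p) _ _)))))
  have e6 : mvfderiv I (formCoord I β p) p (anchorVec Λ Γ μ p) (Z p)
      = mvfderiv I (formCoord I β p) p (Λ p (μ.1 p)) (Z p)
        + μ.2 p * mvfderiv I (formCoord I β p) p (Γ p) (Z p) := by
    rw [anchorVec, map_add, map_smul]
    rfl
  refine e1.trans ((congrArg₂ (· + ·) e6 e5).trans ?_)
  have key : ∀ x y z w f g b l m : ℝ, l = x + z → m = y + w →
      x + f * y + (z + (f * w + g * b)) = l + f * m + g * b := by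
    intros; subst_vars; ring
  exact key _ _ _ _ _ _ _ _ _ e2 e3

lemma jbForm_eq_bracketForm (hΛ : IsBivectorField I Λ) (μ ν : DualSec I M)
    (Z : VectorFields I M) (p : M) :
    jbForm I Λ Γ μ ν Z p = bracketForm Λ Γ μ ν p (Z p) := by
  have sΛ := hΛ.contMDiffAt_bivecCoord p
  have dΛ := mdifferentiableAt_of_smooth I sΛ
  have dΓ := mdifferentiableAt_of_smooth I (contMDiffAt_vecCoord I Γ p)
  have dZ := mdifferentiableAt_of_smooth I (contMDiffAt_vecCoord I Z p)
  have dα := mdifferentiableAt_of_smooth I (contMDiffAt_formCoord I μ.1 p)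
  have dβ := mdifferentiableAt_of_smooth I (contMDiffAt_formCoord I ν.1 p)
  have dA := mdifferentiableAt_of_smooth I
    (contMDiffAt_vecCoord_sharp I sΛ (contMDiffAt_formCoord I μ.1 p))
  have dB := mdifferentiableAt_of_smooth I
    (contMDiffAt_vecCoord_sharp I sΛ (contMDiffAt_formCoord I ν.1 p))
  have l1 := lieForm_eq_coord I dA dZ dβ
  have l2 := lieForm_eq_coord I dB dZ dα
  have l3 := lieForm_eq_coord I dΓ dZ dβ
  have l4 := lieForm_eq_coord I dΓ dZ dα
  have l5 := mvfderiv_form_apply I dβ dA (Z p)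
  have m1 : ν.1 p (mvfderiv I (vecCoord I (fun q => Λ q (μ.1 q)) p) p (Z p) : E) =
      ν.1 p (mvfderiv I (bivecCoord I Λ p) p (Z p) (μ.1 p) : E)
      + ν.1 p (Λ p (mvfderiv I (formCoord I μ.1 p) p (Z p))) := by
    have h := mvfderiv_vecCoord_sharp I dΛ dα (Z p)
    rw [bivecCoord_self] at h
    exact (congrArg (ν.1 p) h).trans (map_add (ν.1 p) _ _)
  have m2 : μ.1 p (mvfderiv I (vecCoord I (fun q => Λ q (ν.1 q)) p) p (Z p) : E) =
      μ.1 p (mvfderiv I (bivecCoord I Λ p) p (Z p) (ν.1 p) : E)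
      + μ.1 p (Λ p (mvfderiv I (formCoord I ν.1 p) p (Z p))) := by
    have h := mvfderiv_vecCoord_sharp I dΛ dβ (Z p)
    rw [bivecCoord_self] at h
    exact (congrArg (μ.1 p) h).trans (map_add (μ.1 p) _ _)
  have s1 : ν.1 p (mvfderiv I (bivecCoord I Λ p) p (Z p) (μ.1 p) : E)
      = - μ.1 p (mvfderiv I (bivecCoord I Λ p) p (Z p) (ν.1 p) : E) :=
    skew_apply (V := E) (hΛ.mvfderiv_skew p (Z p)) (μ.1 p) (ν.1 p)
  have s2 : μ.1 p (Λ p (mvfderiv I (formCoord I ν.1 p) p (Z p)))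
      = - mvfderiv I (formCoord I ν.1 p) p (Z p) (Λ p (μ.1 p)) :=
    skew_apply (hΛ.skew p) _ _
  have key : ∀ L₁ L₂ D L₃ L₄ f g a b a' b' x₁ x₂ u v w y₁ y₂ z₁ z₂ r s t k : ℝ,
      L₁ = x₁ + r → L₂ = x₂ + s → D = w + r → L₃ = y₁ + z₁ → L₄ = y₂ + z₂ → r = u + t →
      s = v + k → u = - v → k = - w →
      L₁ - L₂ - D + f * L₃ - g * L₄ - (a * b' - b * a')
        = x₁ - x₂ + u + f * (y₁ + z₁) - g * (y₂ + z₂) - (a * b' - b * a') := by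
    intros; subst_vars; ring
  exact key _ _ _ _ _ _ _ _ _ _ _ _ _ _ _ _ _ _ _ _ _ _ _ _ l1 l2 l5 l3 l4 m1 m2 s1 s2

/-- `α(X)` as a smooth function. -/
def formApply (α : OneForms I M) (X : VectorFields I M) : C^∞⟮I, M; 𝓘(ℝ), ℝ⟯ :=
  ⟨fun q => α q (X q), fun p =>
    contMDiffAt_form_apply I (contMDiffAt_formCoord I α p) (contMDiffAt_vecCoord I X p)⟩

/-- `Λ_α` as a smooth vector field. -/
def sharpField (hΛ : IsBivectorField I Λ) (α : OneForms I M) : VectorFields I M :=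
  ⟨sharp I Λ α, fun p => (contMDiffAt_vec_iff I).2
    (contMDiffAt_vecCoord_sharp I (hΛ.contMDiffAt_bivecCoord p) (contMDiffAt_formCoord I α p))⟩

lemma liePhi_contraction (μ ν : DualSec I M) (Z : VectorFields I M)
    (k : C^∞⟮I, M; 𝓘(ℝ), ℝ⟯) (p : M) :
    liePhi I (contraction I (jacobiElement I Λ Γ) μ) (DualSec.toDual I ν)
      (fun q => (Z q, k q)) p
      = lieForm I (anchorVec Λ Γ μ) ν.1 Z p + dirDeriv I (anchorVec Λ Γ μ) ν.2 p * k p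
        - μ.1 p (Γ p) * ν.1 p (Z p) - μ.1 p (Γ p) * ν.2 p * k p
        - ν.2 p * dirDeriv I Z (formApply μ.1 Γ) p := by
  have h : contraction I (jacobiElement I Λ Γ) μ
      = fun q => (anchorVec Λ Γ μ q, (-formApply μ.1 Γ : C^∞⟮I, M; 𝓘(ℝ), ℝ⟯) q) :=
    funext fun q => contraction_jacobiElement μ q
  have h1 : dirDeriv I (anchorVec Λ Γ μ) (formApply ν.1 Z + ν.2 * k : C^∞⟮I, M; 𝓘(ℝ), ℝ⟯) p
      = dirDeriv I (anchorVec Λ Γ μ) (formApply ν.1 Z) p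
        + (ν.2 p * dirDeriv I (anchorVec Λ Γ μ) k p
          + k p * dirDeriv I (anchorVec Λ Γ μ) ν.2 p) := by
    rw [dirDeriv, mvfderiv_smooth_add, mvfderiv_smooth_mul]
    rfl
  have h2 : dirDeriv I Z (-formApply μ.1 Γ : C^∞⟮I, M; 𝓘(ℝ), ℝ⟯) p
      = - dirDeriv I Z (formApply μ.1 Γ) p :=
    DFunLike.congr_fun (smoothDeriv_neg Z (formApply μ.1 Γ)) p
  have h3 : lieForm I (anchorVec Λ Γ μ) ν.1 Z p = dirDeriv I (anchorVec Λ Γ μ) (formApply ν.1 Z) p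
      - ν.1 p (VectorField.mlieBracket I (anchorVec Λ Γ μ) Z p) := rfl
  have e : liePhi I (contraction I (jacobiElement I Λ Γ) μ) (DualSec.toDual I ν)
      (fun q => (Z q, k q)) p
      = dirDeriv I (anchorVec Λ Γ μ) (formApply ν.1 Z + ν.2 * k : C^∞⟮I, M; 𝓘(ℝ), ℝ⟯) p
        + -(μ.1 p (Γ p)) * (ν.1 p (Z p) + ν.2 p * k p)
        - brPhi I (fun q => (Z q, k q)) (fun q => DualSec.toDual I ν q
          (contraction I (jacobiElement I Λ Γ) μ q)) p
        - (ν.1 p (VectorField.mlieBracket I (anchorVec Λ Γ μ) Z p)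
          + ν.2 p * (dirDeriv I (anchorVec Λ Γ μ) k p
            - dirDeriv I Z (-formApply μ.1 Γ : C^∞⟮I, M; 𝓘(ℝ), ℝ⟯) p))
        + brPhi I (fun q => (Z q, k q)) (fun q => DualSec.toDual I ν q
          (contraction I (jacobiElement I Λ Γ) μ q)) p := by
    rw [h]
    rfl
  rw [e, h1, h2, h3]
  ring

lemma dPhiFun_pairing (hΛ : IsBivectorField I Λ) (μ ν : DualSec I M) (Z : VectorFields I M)
    (k : C^∞⟮I, M; 𝓘(ℝ), ℝ⟯) (p : M) :
    dPhiFun I (pairing I (jacobiElement I Λ Γ) μ ν) (fun q => (Z q, k q)) p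
      = dirDeriv I Z (formPairing I Λ μ.1 ν.1) p
        + (μ.2 p * dirDeriv I Z (formApply ν.1 Γ) p + ν.1 p (Γ p) * dirDeriv I Z μ.2 p)
        - (ν.2 p * dirDeriv I Z (formApply μ.1 Γ) p + μ.1 p (Γ p) * dirDeriv I Z ν.2 p)
        + k p * (formPairing I Λ μ.1 ν.1 p + μ.2 p * ν.1 p (Γ p) - ν.2 p * μ.1 p (Γ p)) := by
  set w : C^∞⟮I, M; 𝓘(ℝ), ℝ⟯ := formApply ν.1 (sharpField hΛ μ.1) + μ.2 * formApply ν.1 Γ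
    - ν.2 * formApply μ.1 Γ with hw
  have h : pairing I (jacobiElement I Λ Γ) μ ν = w := by
    funext q
    have h1 : pairing I (jacobiElement I Λ Γ) μ ν q = ν.1 q (anchorVec Λ Γ μ q)
        + ν.2 q * -(μ.1 q (Γ q)) :=
      congrArg (DualSec.toDual I ν q) (contraction_jacobiElement μ q)
    have h2 : ν.1 q (anchorVec Λ Γ μ q) = ν.1 q (Λ q (μ.1 q)) + μ.2 q * ν.1 q (Γ q) := by
      rw [anchorVec, map_add, map_smul]
      rfl
    rw [h1, h2, mul_neg, ← sub_eq_add_neg]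
    rfl
  have e : dirDeriv I Z w p = dirDeriv I Z (formPairing I Λ μ.1 ν.1) p
        + (μ.2 p * dirDeriv I Z (formApply ν.1 Γ) p + ν.1 p (Γ p) * dirDeriv I Z μ.2 p)
        - (ν.2 p * dirDeriv I Z (formApply μ.1 Γ) p + μ.1 p (Γ p) * dirDeriv I Z ν.2 p) := by
    rw [dirDeriv, hw, mvfderiv_smooth_sub, mvfderiv_smooth_add, mvfderiv_smooth_mul,
      mvfderiv_smooth_mul]
    rfl
  rw [h, ← e]
  rfl

lemma cartanBracket_eq (hΛ : IsBivectorField I Λ) (μ ν : DualSec I M) (Z : VectorFields I M)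
    (k : C^∞⟮I, M; 𝓘(ℝ), ℝ⟯) (p : M) :
    cartanBracket I (jacobiElement I Λ Γ) μ ν (fun q => (Z q, k q)) p
      = jbForm I Λ Γ μ ν Z p + jbFun I Λ Γ μ ν p * k p := by
  have h : ∀ μ ν : DualSec I M, dirDeriv I (anchorVec Λ Γ μ) ν.2 p
      = dirDeriv I (sharp I Λ μ.1) ν.2 p + μ.2 p * dirDeriv I Γ ν.2 p := fun μ ν => by
    rw [dirDeriv, anchorVec, map_add, map_smul]
    rfl
  have hs : formPairing I Λ ν.1 μ.1 p = - formPairing I Λ μ.1 ν.1 p :=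
    skew_apply (hΛ.skew p) _ _
  rw [cartanBracket, liePhi_contraction, liePhi_contraction, dPhiFun_pairing hΛ,
    lieForm_anchorVec hΛ, lieForm_anchorVec hΛ, h, h, jbForm, jbFun, hs]
  ring

variable [FiniteDimensional ℝ E] [T2Space M]

lemma inducedBracket_fst_apply (hΛ : IsBivectorField I Λ) (μ ν : DualSec I M)
    (Z : VectorFields I M) (p : M) :
    (inducedBracket hΛ Γ μ ν).1 p (Z p) = jbForm I Λ Γ μ ν Z p :=
  (jbForm_eq_bracketForm hΛ μ ν Z p).symm

lemma inducedBracket_snd_apply (hΛ : IsBivectorField I Λ) (μ ν : DualSec I M) (p : M) :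
    (inducedBracket hΛ Γ μ ν).2 p = jbFun I Λ Γ μ ν p := rfl

lemma toDual_inducedBracket (hΛ : IsBivectorField I Λ) (μ ν : DualSec I M)
    (Z : VectorFields I M) (k : C^∞⟮I, M; 𝓘(ℝ), ℝ⟯) (p : M) :
    DualSec.toDual I (inducedBracket hΛ Γ μ ν) p (Z p, k p)
      = cartanBracket I (jacobiElement I Λ Γ) μ ν (fun q => (Z q, k q)) p := by
  rw [cartanBracket_eq hΛ, ← inducedBracket_fst_apply hΛ]
  rfl

end Formulas

end JacobiLift

end

theorem theorem13
    {E : Type*} [NormedAddCommGroup E] [NormedSpace ℝ E] [FiniteDimensional ℝ E]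
    {H : Type*} [TopologicalSpace H] (I : ModelWithCorners ℝ E H) [I.Boundaryless]
    {M : Type*} [TopologicalSpace M] [T2Space M] [ChartedSpace H M] [IsManifold I ∞ M]
    (Λ : Π p : M, JacobiLift.Tensor2 (TangentSpace I p)) (Γ : JacobiLift.VectorFields I M)
    (hJ : JacobiLift.IsJacobi I Λ Γ) :
    -- the Poisson lift is a homogeneous Poisson structure on `TM ⊕ ℝ`
    (JacobiLift.IsPoisson (I.prod 𝓘(ℝ, E × ℝ))
        (JacobiLift.poissonLift I (JacobiLift.jacobiElement I Λ Γ)) ∧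
      JacobiLift.IsHomogeneous I (JacobiLift.poissonLift I (JacobiLift.jacobiElement I Λ Γ))) ∧
    -- `X^c_Φ = Λ^c + ∂_t ∧ Γ^c - t Λ^v + ∇ ∧ Γ^v`
    (∀ n : JacobiLift.LTot I M,
      JacobiLift.poissonLift I (JacobiLift.jacobiElement I Λ Γ) n
          = JacobiLift.extBivec I
              (JacobiLift.completeLift I (ContinuousLinearMap.id ℝ E) Λ) n
          + JacobiLift.wedge (JacobiLift.partialT I n)
              (JacobiLift.extVec I
                (JacobiLift.vecCompleteLift I (ContinuousLinearMap.id ℝ E) Γ) n)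
          - n.2.2 • JacobiLift.extBivec I (JacobiLift.verticalLift I Λ) n
          + JacobiLift.wedge (JacobiLift.extVec I (JacobiLift.liouville I) n)
              (JacobiLift.extVec I (JacobiLift.vecVerticalLift I Γ) n)) ∧
    -- the bracket induced on sections of `T*M ⊕ ℝ` exists and is unique
    (∃! br, JacobiLift.Induces I (JacobiLift.poissonLift I (JacobiLift.jacobiElement I Λ Γ)) br) ∧
    ∀ br, JacobiLift.Induces I (JacobiLift.poissonLift I (JacobiLift.jacobiElement I Λ Γ)) br →
      JacobiLift.IsLieAlgebroidBracket I br ∧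
      -- `X_μ = (i_α Λ + f Γ, -i_α Γ)`
      (∀ (μ : JacobiLift.DualSec I M) (p : M), JacobiLift.contraction I (JacobiLift.jacobiElement I Λ Γ) μ p
        = (Λ p (μ.1 p) + μ.2 p • Γ p, -(μ.1 p (Γ p)))) ∧
      -- `[μ, ν] = £^Φ_{X_μ} ν - £^Φ_{X_ν} μ - d^Φ ⟨X, μ ∧ ν⟩`
      (∀ (μ ν : JacobiLift.DualSec I M) (Z : JacobiLift.VectorFields I M)
          (k : C^∞⟮I, M; 𝓘(ℝ), ℝ⟯) (p : M),
        JacobiLift.DualSec.toDual I (br μ ν) p (Z p, k p)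
          = JacobiLift.cartanBracket I (JacobiLift.jacobiElement I Λ Γ) μ ν
              (fun q => (Z q, k q)) p) ∧
      -- the bracket is the one associated with a Jacobi structure
      ∀ μ ν : JacobiLift.DualSec I M,
        (∀ (Z : JacobiLift.VectorFields I M) (p : M),
          (br μ ν).1 p (Z p) = JacobiLift.jbForm I Λ Γ μ ν Z p) ∧
        ∀ p : M, (br μ ν).2 p = JacobiLift.jbFun I Λ Γ μ ν p := by
  have hΛ := hJ.bivector
  refine ⟨⟨JacobiLift.isPoisson_poissonLift hJ, JacobiLift.isHomogeneous_poissonLift hΛ⟩,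
    fun n => JacobiLift.poissonLift_eq_explicitLift I n
      (JacobiLift.mdifferentiableAt_of_smooth I (hΛ.contMDiffAt_bivecCoord _))
      (JacobiLift.mdifferentiableAt_of_smooth I (JacobiLift.contMDiffAt_vecCoord I Γ _)),
    JacobiLift.existsUnique_induces hΛ Γ, fun br hbr => ⟨hbr.isLieAlgebroidBracket hJ,
      fun μ p => JacobiLift.contraction_jacobiElement μ p, ?_⟩⟩
  obtain rfl := hbr.eq_inducedBracket hΛ
  exact ⟨JacobiLift.toDual_inducedBracket hΛ, fun μ ν =>
    ⟨JacobiLift.inducedBracket_fst_apply hΛ μ ν, JacobiLift.inducedBracket_snd_apply hΛ μ ν⟩⟩
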